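/- Let $\Sigma$ be the compact oriented surface of genus one with one boundary component, and let $\Gamma$ be its mapping class group relative to the boundary: the group of homeomorphisms of $\Sigma$ that fix $\partial\Sigma$ pointwise, modulo homotopy relative to $\partial\Sigma$ (for surfaces this is the same as isotopy relative to $\partial\Sigma$). Let $x,y\in\Gamma$ be the right-handed Dehn twists about two simple closed curves that meet transversely in exactly one point, and let $\delta\in\Gamma$ be the right-handed Dehn twist about a curve parallel to the boundary. An open book with page $\Sigma$ is given by its monodromy $\phi\in\Gamma$, and conjugate monodromies give the same open book. Call $\phi\in\Gamma$ pseudo-Anosov if the induced map $\phi_\#$ on $H_1(\Sigma;\mathbb{Z})$ satisfies $|\operatorname{trace}(\phi_\#)|>2$ (for the once-punctured torus this is equivalent to the usual definition). Then every open book with page $\Sigma$ is the same as one whose monodromy has one of the following forms, where $d\in\mathbb{Z}$: A. $\delta^d\, x^{a_1}y^{-1}\cdots x^{a_n}y^{-1}$, where all $a_i\ge 0$ are integers and some $a_j\neq 0$; B. $\delta^d (xy)^3\, x^{a_1}y^{-1}\cdots x^{a_n}y^{-1}$, where all $a_i\ge 0$ are integers and some $a_j\neq 0$; C. $\delta^d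 y^m$, where $m\in\mathbb{Z}$; D. $\delta^d (xy)^3 y^m$, where $m\in\mathbb{Z}$; E. $\delta^d x^m y^{-1}$, where $m\in\{-1,-2,-3\}$; F. $\delta^d (xy)^3 x^m y^{-1}$, where $m\in\{-1,-2,-3\}$. Moreover, every monodromy of type A or B is pseudo-Anosov, and no monodromy of type C, D, E or F is pseudo-Anosov. -/

import Mathlib

open scoped Real

noncomputable section

namespace OneHoledTorus

/-! ### The surface -/

/-- The flat torus `ℝ²/ℤ²`, oriented by the standard orientation of `ℝ²`. -/
abbrev Torus : Type := UnitAddCircle × UnitAddCircle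

/-- Euclidean distance from the origin of the torus (`‖t‖` is the distance from `t` to `0` in
`ℝ/ℤ`). -/
def radius (p : Torus) : ℝ := √(‖p.1‖ ^ 2 + ‖p.2‖ ^ 2)

/-- The compact oriented surface of genus one with one boundary component: the torus with the open
round disc of radius `1/4` about the origin removed. -/
abbrev Surface : Type := {p : Torus // 1 / 4 ≤ radius p}

/-- The boundary circle. -/
def boundary : Set Surface := {p | radius p.1 = 1 / 4}

/-! ### The mapping class group -/

/-- Self-homeomorphisms of the surface fixing the boundary pointwise (on this connected surface with
nonempty boundary they automatically preserve the orientation). -/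
def HomeoFixingBoundary : Subgroup (Surface ≃ₜ Surface) where
  carrier := {f | ∀ p ∈ boundary, f p = p}
  mul_mem' {f g} hf hg p hp := by
    rw [Homeomorph.mul_apply, hg p hp, hf p hp]
  one_mem' _ _ := rfl
  inv_mem' {f} hf p hp := by
    change f.symm p = p
    rw [Homeomorph.symm_apply_eq, hf p hp]

/-- The underlying continuous map. -/
def toMap (f : HomeoFixingBoundary) : C(Surface, Surface) := ⟨f.1, f.1.continuous⟩

/-- The boundary-fixing homeomorphisms that are homotopic to the identity relative to the boundary.
(On a compact surface, by a theorem of Baer and Epstein, being homotopic relative to the boundary is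
the same as being isotopic relative to the boundary.) -/
def HomotopicToId : Subgroup HomeoFixingBoundary where
  carrier := {f | (toMap f).HomotopicRel (ContinuousMap.id Surface) boundary}
  mul_mem' {f g} hf hg := by
    obtain ⟨F⟩ := hf
    obtain ⟨G⟩ := hg
    refine ContinuousMap.HomotopicRel.trans (g := toMap f) ⟨?_⟩ ⟨F⟩
    exact (G.compContinuousMap (toMap f)).cast rfl (ContinuousMap.comp_id _)
  one_mem' := ContinuousMap.HomotopicRel.refl _
  inv_mem' {f} hf := by
    have h := hf.comp_continuousMap (toMap f⁻¹)
    have e : (toMap f⁻¹).comp (toMap f) = ContinuousMap.id Surface :=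
      ContinuousMap.ext fun p => f.1.symm_apply_apply p
    rw [e, ContinuousMap.comp_id] at h
    exact h.symm

instance : HomotopicToId.Normal where
  conj_mem f hf g := by
    obtain ⟨F⟩ := hf
    have hg : ∀ p ∈ boundary, g.1.symm p = p := (g⁻¹).2
    refine ⟨⟨⟨⟨fun q => g.1 (F (q.1, g.1.symm q.2)), by fun_prop⟩, ?_, ?_⟩, ?_⟩⟩
    · intro p
      change g.1 (F (0, g.1.symm p)) = _
      rw [F.apply_zero]
      rfl
    · intro p
      change g.1 (F (1, g.1.symm p)) = _
      rw [F.apply_one]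
      exact g.1.apply_symm_apply p
    · intro t p hp
      change g.1 (F (t, g.1.symm p)) = g.1 (f.1 (g.1.symm p))
      have hp' : g.1.symm p ∈ boundary := by rw [hg p hp]; exact hp
      rw [F.eq_fst t hp']
      rfl

/-- The mapping class group of the surface relative to its boundary: boundary-fixing
homeomorphisms, up to homotopy relative to the boundary. -/
abbrev MCG : Type := HomeoFixingBoundary ⧸ HomotopicToId

/-! ### Dehn twists about the two dual curves -/

/-- The ramp rising linearly from `0` on `t ≤ 1/4` to `1` on `t ≥ 3/4`. -/
def ramp (t : ℝ) : ℝ := max 0 (min 1 (2 * t - 1 / 2))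

/-- The ramp on `[0, 1]`, as a degree-one map of the circle to itself that is trivial on the arc
`‖t‖ ≤ 1/4`. -/
def shift : UnitAddCircle → UnitAddCircle :=
  AddCircle.liftIco 1 0 fun t => ((ramp t : ℝ) : UnitAddCircle)

theorem continuous_shift : Continuous shift := by
  refine AddCircle.liftIco_continuous ?_ ?_
  · have : ((1 : ℝ) : UnitAddCircle) = 0 := AddCircle.coe_period 1
    norm_num [ramp, this]
  · unfold ramp
    fun_prop

theorem shift_eq_zero {t : UnitAddCircle} (ht : ‖t‖ ≤ 1 / 4) : shift t = 0 := by
  have h := (AddCircle.equivIco 1 0 t).2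
  have e : ((AddCircle.equivIco 1 0 t : ℝ) : UnitAddCircle) = t :=
    (AddCircle.equivIco 1 0).symm_apply_apply t
  set s : ℝ := (AddCircle.equivIco 1 0 t : ℝ) with hs
  rw [← e] at ht ⊢
  unfold shift
  rw [AddCircle.liftIco_coe_apply h]
  rw [UnitAddCircle.norm_eq, abs_le] at ht
  simp only [Set.mem_Ico, zero_add] at h
  have hr : round s = 0 ∨ round s = 1 := by
    have h1 : (round s : ℝ) < 2 := by linarith
    have h2 : (-1 : ℝ) < round s := by linarith
    have h3 : round s < 2 := by exact_mod_cast h1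
    have h4 : -1 < round s := by exact_mod_cast h2
    omega
  rcases hr with hr | hr <;> rw [hr] at ht <;> push_cast at ht
  · have : ramp s = 0 := by
      unfold ramp
      rw [min_eq_right (by linarith), max_eq_left (by linarith)]
    simp [this]
  · have : ramp s = 1 := by
      unfold ramp
      rw [min_eq_left (by linarith), max_eq_right (by norm_num)]
    simp [this]

theorem norm_fst_le_radius (p : Torus) : ‖p.1‖ ≤ radius p :=
  Real.le_sqrt_of_sq_le (by nlinarith [sq_nonneg ‖p.2‖])

theorem norm_snd_le_radius (p : Torus) : ‖p.2‖ ≤ radius p :=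
  Real.le_sqrt_of_sq_le (by nlinarith [sq_nonneg ‖p.1‖])

/-- A homeomorphism of the torus that preserves the surface and fixes its boundary pointwise gives a
boundary-fixing homeomorphism of the surface. -/
def restrict (f : Torus ≃ₜ Torus) (h : ∀ p, 1 / 4 ≤ radius p ↔ 1 / 4 ≤ radius (f p))
    (hb : ∀ p, radius p = 1 / 4 → f p = p) : HomeoFixingBoundary :=
  ⟨f.subtype h, fun p hp => Subtype.ext (hb p.1 hp)⟩

/-- A homeomorphism of the torus that is the identity on the closed disc preserves the surface. -/
theorem radius_iff (f : Torus ≃ₜ Torus) (hf : ∀ p, radius p ≤ 1 / 4 → f p = p) (p : Torus) :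
    1 / 4 ≤ radius p ↔ 1 / 4 ≤ radius (f p) := by
  constructor
  · intro h
    by_contra! h'
    have := f.injective (hf (f p) h'.le)
    rw [this] at h'
    exact absurd h (not_le.mpr h')
  · intro h
    by_contra! h'
    rw [hf p h'.le] at h
    exact absurd h (not_le.mpr h')

/-- The shear `(a, b) ↦ (a + shift b, b)` of the torus, a right-handed Dehn twist about the
horizontal curve `b = 1/2`: an arc crossing that curve upwards is carried to the right. -/
def shearX : Torus ≃ₜ Torus where
  toFun p := (p.1 + shift p.2, p.2)
  invFun p := (p.1 - shift p.2, p.2)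
  left_inv p := by simp
  right_inv p := by simp
  continuous_toFun := by have := continuous_shift; fun_prop
  continuous_invFun := by have := continuous_shift; fun_prop

/-- The shear `(a, b) ↦ (a, b - shift a)` of the torus, a right-handed Dehn twist about the vertical
curve `a = 1/2`: an arc crossing that curve from left to right is carried downwards. -/
def shearY : Torus ≃ₜ Torus where
  toFun p := (p.1, p.2 - shift p.1)
  invFun p := (p.1, p.2 + shift p.1)
  left_inv p := by simp
  right_inv p := by simp
  continuous_toFun := by have := continuous_shift; fun_prop
  continuous_invFun := by have := continuous_shift; fun_prop

theorem shearX_fix (p : Torus) (hp : radius p ≤ 1 / 4) : shearX p = p :=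
  Prod.ext (by simp [shearX, shift_eq_zero ((norm_snd_le_radius p).trans hp)]) rfl

theorem shearY_fix (p : Torus) (hp : radius p ≤ 1 / 4) : shearY p = p :=
  Prod.ext rfl (by simp [shearY, shift_eq_zero ((norm_fst_le_radius p).trans hp)])

/-- The class of the right-handed Dehn twist about the horizontal curve. -/
def x : MCG :=
  (restrict shearX (radius_iff _ shearX_fix) fun p hp => shearX_fix p hp.le : HomeoFixingBoundary)

/-- The class of the right-handed Dehn twist about the vertical curve. -/
def y : MCG :=
  (restrict shearY (radius_iff _ shearY_fix) fun p hp => shearY_fix p hp.le : HomeoFixingBoundary)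

/-! ### The boundary twist -/

/-- The representative in `[-1/2, 1/2)` of a point of the circle. -/
def coord (t : UnitAddCircle) : ℝ := AddCircle.equivIco 1 (-1 / 2) t

/-- The representative in the fundamental square centred at the origin, as a complex number. -/
def toComplex (p : Torus) : ℂ := ⟨coord p.1, coord p.2⟩

/-- The projection of the plane to the torus. -/
def ofComplex (z : ℂ) : Torus := ((z.re : UnitAddCircle), (z.im : UnitAddCircle))

/-- The angle, `0` for `r ≤ 1/4` and `2π` for `r ≥ 3/8`, linear in between. -/
def angle (r : ℝ) : ℝ := 2 * π * max 0 (min 1 (8 * r - 2))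

/-- Rotate the circle of radius `r` about the origin by `c` times `angle r`; this is the identity
for `r ≤ 1/4` and, if `c` is an integer, for `r ≥ 3/8`. -/
def rotate (c : ℤ) (p : Torus) : Torus :=
  ofComplex (toComplex p * Complex.exp ((c * angle (radius p) : ℝ) * Complex.I))

theorem coe_coord (t : UnitAddCircle) : (coord t : UnitAddCircle) = t :=
  (AddCircle.equivIco 1 (-1 / 2)).symm_apply_apply t

theorem coord_mem (t : UnitAddCircle) : -1 / 2 ≤ coord t ∧ coord t < 1 / 2 := by
  have h := (AddCircle.equivIco 1 (-1 / 2) t).2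
  refine ⟨h.1, ?_⟩
  have h2 := h.2
  unfold coord
  linarith

theorem coord_coe {r : ℝ} (h : |r| < 1 / 2) : coord (r : UnitAddCircle) = r := by
  rw [abs_lt] at h
  unfold coord
  rw [AddCircle.equivIco_coe_eq (by constructor <;> linarith)]

theorem norm_eq_abs_coord (t : UnitAddCircle) : ‖t‖ = |coord t| := by
  have h := coord_mem t
  conv_lhs => rw [← coe_coord t]
  rw [AddCircle.norm_coe_eq_abs_iff 1 one_ne_zero, abs_one, abs_le]
  constructor <;> linarith

theorem radius_eq (p : Torus) : radius p = ‖toComplex p‖ := by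
  rw [radius, norm_eq_abs_coord, norm_eq_abs_coord, Complex.norm_eq_sqrt_sq_add_sq]
  simp [toComplex]

theorem ofComplex_toComplex (p : Torus) : ofComplex (toComplex p) = p :=
  Prod.ext (coe_coord _) (coe_coord _)

theorem toComplex_ofComplex {z : ℂ} (hz : ‖z‖ < 1 / 2) : toComplex (ofComplex z) = z :=
  Complex.ext (coord_coe ((Complex.abs_re_le_norm z).trans_lt hz))
    (coord_coe ((Complex.abs_im_le_norm z).trans_lt hz))

theorem angle_inner {r : ℝ} (h : r ≤ 1 / 4) : angle r = 0 := by
  unfold angle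
  rw [min_eq_right (by linarith), max_eq_left (by linarith), mul_zero]

theorem angle_outer {r : ℝ} (h : 3 / 8 ≤ r) : angle r = 2 * π := by
  unfold angle
  rw [min_eq_left (by linarith), max_eq_right (by norm_num), mul_one]

theorem rotate_inner (c : ℤ) {p : Torus} (h : radius p ≤ 1 / 4) : rotate c p = p := by
  simp [rotate, angle_inner h, ofComplex_toComplex]

theorem rotate_outer (c : ℤ) {p : Torus} (h : 3 / 8 ≤ radius p) : rotate c p = p := by
  have : Complex.exp ((c * angle (radius p) : ℝ) * Complex.I) = 1 := by
    rw [angle_outer h, Complex.exp_eq_one_iff]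
    exact ⟨c, by push_cast; ring⟩
  rw [rotate, this, mul_one, ofComplex_toComplex]

theorem rotate_rotate (c : ℤ) (p : Torus) : rotate (-c) (rotate c p) = p := by
  rcases le_or_gt (3 / 8) (radius p) with h | h
  · rw [rotate_outer c h, rotate_outer (-c) h]
  · set z := toComplex p * Complex.exp ((c * angle (radius p) : ℝ) * Complex.I) with hz
    have hn : ‖z‖ = radius p := by
      rw [hz, norm_mul, Complex.norm_exp_ofReal_mul_I, mul_one, radius_eq]
    have ht : toComplex (rotate c p) = z := toComplex_ofComplex (by rw [hn]; linarith)
    have hr : radius (rotate c p) = radius p := by rw [radius_eq, ht, hn]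
    rw [rotate, ht, hr, hz, mul_assoc, ← Complex.exp_add]
    have : ((c * angle (radius p) : ℝ) : ℂ) * Complex.I
        + (((-c : ℤ) * angle (radius p) : ℝ) : ℂ) * Complex.I = 0 := by
      push_cast; ring
    rw [this, Complex.exp_zero, mul_one, ofComplex_toComplex]

theorem continuous_radius : Continuous radius := by
  unfold radius
  fun_prop

theorem continuousAt_coord {t : UnitAddCircle} (h : ‖t‖ < 1 / 2) : ContinuousAt coord t := by
  refine continuous_subtype_val.continuousAt.comp (AddCircle.continuousAt_equivIco 1 (-1 / 2) ?_)
  intro e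
  rw [e, (AddCircle.norm_coe_eq_abs_iff 1 one_ne_zero).mpr (by norm_num)] at h
  norm_num at h

theorem continuous_rotate (c : ℤ) : Continuous (rotate c) := by
  rw [continuous_iff_continuousAt]
  intro p
  rcases le_or_gt (radius p) (3 / 8) with h | h
  · have h1 : ContinuousAt (fun q : Torus => coord q.1) p :=
      ContinuousAt.comp (f := Prod.fst)
        (continuousAt_coord (by linarith [norm_fst_le_radius p])) continuousAt_fst
    have h2 : ContinuousAt (fun q : Torus => coord q.2) p :=
      ContinuousAt.comp (f := Prod.snd)
        (continuousAt_coord (by linarith [norm_snd_le_radius p])) continuousAt_snd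
    have h3 : ContinuousAt toComplex p := by
      have e : toComplex = fun q : Torus => (coord q.1 : ℂ) + (coord q.2 : ℂ) * Complex.I := by
        funext q
        exact Complex.mk_eq_add_mul_I _ _
      rw [e]
      exact (Complex.continuous_ofReal.continuousAt.comp h1).add
        ((Complex.continuous_ofReal.continuousAt.comp h2).mul continuousAt_const)
    have h4 : Continuous fun q : Torus =>
        Complex.exp ((c * angle (radius q) : ℝ) * Complex.I) := by
      have := continuous_radius
      unfold angle
      fun_prop
    have h5 : Continuous ofComplex :=
      ((AddCircle.continuous_mk' 1).comp Complex.continuous_re).prodMk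
        ((AddCircle.continuous_mk' 1).comp Complex.continuous_im)
    exact h5.continuousAt.comp (h3.mul h4.continuousAt)
  · refine continuousAt_id.congr ?_
    filter_upwards [continuous_radius.continuousAt.eventually (lt_mem_nhds h)] with q hq
    exact (rotate_outer c (le_of_lt hq)).symm

/-- The right-handed Dehn twist about a circle parallel to the boundary: an arc leaving the boundary
radially turns to the right, that is, clockwise about the removed disc. -/
def twistBoundary : Torus ≃ₜ Torus where
  toFun := rotate (-1)
  invFun := rotate 1
  left_inv p := rotate_rotate (-1) p
  right_inv p := rotate_rotate 1 p
  continuous_toFun := continuous_rotate (-1)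
  continuous_invFun := continuous_rotate 1

theorem twistBoundary_fix (p : Torus) (hp : radius p ≤ 1 / 4) : twistBoundary p = p :=
  rotate_inner (-1) hp

/-- The class of the right-handed Dehn twist about a curve parallel to the boundary. -/
def δ : MCG :=
  (restrict twistBoundary (radius_iff _ twistBoundary_fix)
    fun p hp => twistBoundary_fix p hp.le : HomeoFixingBoundary)

/-! ### The action on homology, and pseudo-Anosov classes -/

/-- A base point on the boundary. -/
def basePoint : Surface :=
  ⟨(((1 / 4 : ℝ) : UnitAddCircle), 0), by
    rw [radius, (AddCircle.norm_coe_eq_abs_iff 1 one_ne_zero).mpr (by norm_num [abs_le])]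
    norm_num⟩

theorem basePoint_mem : basePoint ∈ boundary := by
  change radius (((1 / 4 : ℝ) : UnitAddCircle), 0) = 1 / 4
  rw [radius, (AddCircle.norm_coe_eq_abs_iff 1 one_ne_zero).mpr (by norm_num [abs_le])]
  norm_num

/-- The first homology group `H₁(Σ; ℤ)`, as the abelianized fundamental group. -/
abbrev H₁ : Type := Additive (Abelianization (FundamentalGroup Surface basePoint))

theorem toMap_basePoint (f : HomeoFixingBoundary) : toMap f basePoint = basePoint :=
  f.2 basePoint basePoint_mem

/-- The map induced on the fundamental group by a boundary-fixing homeomorphism. -/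
def inducedπ₁ (f : HomeoFixingBoundary) :
    FundamentalGroup Surface basePoint →* FundamentalGroup Surface basePoint :=
  FundamentalGroup.mapOfEq (toMap f) (toMap_basePoint f)

/-- The map induced on first homology by a boundary-fixing homeomorphism. -/
def inducedH₁ (f : HomeoFixingBoundary) : H₁ →ₗ[ℤ] H₁ :=
  (MonoidHom.toAdditive (Abelianization.map (inducedπ₁ f))).toIntLinearMap

theorem inducedπ₁_congr {f g : HomeoFixingBoundary}
    (h : (toMap f).HomotopicRel (toMap g) boundary) : inducedπ₁ f = inducedπ₁ g := by
  obtain ⟨F⟩ := h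
  ext γ
  induction γ using Path.Homotopic.Quotient.ind with
  | mk γ =>
  rw [inducedπ₁, inducedπ₁, FundamentalGroup.mapOfEq_apply, FundamentalGroup.mapOfEq_apply]
  refine Quotient.sound ⟨⟨⟨⟨fun q => F (q.1, γ q.2), by fun_prop⟩, ?_, ?_⟩, ?_⟩⟩
  · intro t
    exact F.apply_zero _
  · intro t
    exact F.apply_one _
  · rintro s t (rfl | rfl)
    · change F (s, γ 0) = toMap f (γ 0)
      exact F.eq_fst s (by rw [γ.source]; exact basePoint_mem)
    · change F (s, γ 1) = toMap f (γ 1)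
      exact F.eq_fst s (by rw [γ.target]; exact basePoint_mem)

/-- The trace of the action of a mapping class on `H₁(Σ; ℤ)`. -/
def homologyTrace (φ : MCG) : ℤ :=
  Quotient.liftOn' φ (fun f => LinearMap.trace ℤ H₁ (inducedH₁ f)) fun f g h => by
    have h' : f⁻¹ * g ∈ HomotopicToId := QuotientGroup.leftRel_apply.mp h
    obtain ⟨F⟩ := h'
    have k : (toMap f).HomotopicRel (toMap g) boundary := by
      refine ContinuousMap.HomotopicRel.symm ⟨(F.compContinuousMap (toMap f)).cast ?_ ?_⟩
      · exact ContinuousMap.ext fun p => f.1.apply_symm_apply (g.1 p)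
      · exact ContinuousMap.comp_id _
    simp only [inducedH₁, inducedπ₁_congr k]

/-- A mapping class of the one-holed torus is pseudo-Anosov if the trace of its action on first
homology is greater than two in absolute value. -/
def IsPseudoAnosov (φ : MCG) : Prop := 2 < |homologyTrace φ|

/-! ### Open books and the six types -/

/-- An open book with page the one-holed torus is given by its monodromy, and two monodromies give
the same open book if a boundary-fixing homeomorphism of the page conjugates one to the other (up to
homotopy relative to the boundary). -/
def SameOpenBook (φ ψ : MCG) : Prop := ∃ h : MCG, h * φ * h⁻¹ = ψ

/-- The product `x ^ a₁ * y⁻¹ * ⋯ * x ^ aₙ * y⁻¹`. -/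
def word (a : List ℕ) : MCG := (a.map fun k => x ^ k * y⁻¹).prod

/-- `δ ^ d * x ^ a₁ * y⁻¹ * ⋯ * x ^ aₙ * y⁻¹` with all `aᵢ ≥ 0` and some `aⱼ ≠ 0`. -/
def TypeA (φ : MCG) : Prop := ∃ (d : ℤ) (a : List ℕ), (∃ k ∈ a, k ≠ 0) ∧ φ = δ ^ d * word a

/-- `δ ^ d * (x * y) ^ 3 * x ^ a₁ * y⁻¹ * ⋯ * x ^ aₙ * y⁻¹` with all `aᵢ ≥ 0` and some
`aⱼ ≠ 0`. -/
def TypeB (φ : MCG) : Prop :=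
  ∃ (d : ℤ) (a : List ℕ), (∃ k ∈ a, k ≠ 0) ∧ φ = δ ^ d * (x * y) ^ 3 * word a

/-- `δ ^ d * y ^ m`. -/
def TypeC (φ : MCG) : Prop := ∃ d m : ℤ, φ = δ ^ d * y ^ m

/-- `δ ^ d * (x * y) ^ 3 * y ^ m`. -/
def TypeD (φ : MCG) : Prop := ∃ d m : ℤ, φ = δ ^ d * (x * y) ^ 3 * y ^ m

/-- `δ ^ d * x ^ m * y⁻¹` with `m ∈ {-1, -2, -3}`. -/
def TypeE (φ : MCG) : Prop :=
  ∃ d m : ℤ, (m = -1 ∨ m = -2 ∨ m = -3) ∧ φ = δ ^ d * x ^ m * y⁻¹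

/-- `δ ^ d * (x * y) ^ 3 * x ^ m * y⁻¹` with `m ∈ {-1, -2, -3}`. -/
def TypeF (φ : MCG) : Prop :=
  ∃ d m : ℤ, (m = -1 ∨ m = -2 ∨ m = -3) ∧ φ = δ ^ d * (x * y) ^ 3 * x ^ m * y⁻¹

end OneHoledTorus

end

/-! The argument reduces the classification to a conjugacy problem in a group with two generators
that satisfy the braid relation, and the trace claims to 2 × 2 integer matrices.

Geometry. The surface retracts onto the boundary of the fundamental square, a wedge of two circles,
and its universal cover is built as the pullback of the Cayley tree of the free group `F₂`. Every
boundary-fixing homeomorphism has a unique lift fixing a base point over the boundary, so the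
mapping class group acts on the deck group `F₂`. Every mapping class fixes the boundary word `bdry`,
because each such lift fixes the lifted boundary line (`Cover.act_bdry`). The action is faithful
(`mcgAct_injective`): if the action is trivial, the lift and the identity can be joined
equivariantly along geodesics of the tree; this homotopy descends to the surface and is then
straightened near the boundary. The twists act by explicit automorphisms, determined by arcs that
they fix, by the invariance of `bdry` and by their effect on the integer lattice
(`isTwistAction_mcgAct`).

Free groups. Any endomorphism of `F₂` fixing `bdry` is a product of twists
(`IsTwistAction.exists_eq`). This is Nielsen reduction: apply twists and conjugations to the images
of the generators until their total length is minimal; since the commutator is still conjugate to a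
cyclically reduced word of length four, both are then single letters. With faithfulness this shows
that `x` and `y` generate the mapping class group, satisfy the braid relation, and that `δ = (x * y)
^ 6`.

Conjugacy. The element `(x * y) ^ 3` is central. Modulo it, `s = x * y * x` and `t = x * y` have
orders dividing two and three, and `x = t⁻¹ * s`, `y⁻¹ = t * s`. Hence every element is conjugate to
`s`, to a power of `t` or to a word in the positive letters `x` and `y⁻¹`. A word using both letters
gives types A and B, a word in one letter gives C and D, and the torsion elements give the remaining
cases, E and F. The parity of the exponent of `(x * y) ^ 3` decides between the two members of each
pair (`exists_conj_of_braid`, `exists_type`).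

Traces. Homology is identified with `ℤ²`, on which `δ` acts trivially and `(x * y) ^ 3` by `-1`. The
words of types A and B give matrices of determinant one with positive entries, so their trace
exceeds two; in the other types the trace is computed directly. -/

noncomputable section
namespace OneHoledTorus

/-! ### Conjugacy in groups generated by two braiding elements -/

section Braid

variable {G : Type*} [Group G]

/-- The product of a list of letters, `true` standing for `x` and `false` for `y⁻¹`. -/
def posWord (x y : G) (l : List Bool) : G := (l.map fun i => if i then x else y⁻¹).prod

/-- The product `x ^ a₁ * y⁻¹ * ⋯ * x ^ aₙ * y⁻¹`. -/
def runWord (x y : G) (a : List ℕ) : G := (a.map fun k => x ^ k * y⁻¹).prod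

/-! ### Words in the letters `x` and `y⁻¹`, up to cyclic rotation -/

section Words

variable {x y : G}

theorem posWord_append (l m : List Bool) : posWord x y (l ++ m) = posWord x y l * posWord x y m := by
  simp [posWord]

theorem posWord_cons (i : Bool) (l : List Bool) :
    posWord x y (i :: l) = posWord x y [i] * posWord x y l := by
  simp [posWord]

theorem posWord_true : posWord x y [true] = x := by simp [posWord]

theorem posWord_false : posWord x y [false] = y⁻¹ := by simp [posWord]

/-- Each run `x ^ k * y⁻¹` is closed by a letter `y⁻¹`, so a word splits into runs exactly when it
ends in that letter. Nonemptiness of `a` gives a leading `x` a first run to join. -/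
theorem exists_runWord (l : List Bool) : ∃ a : List ℕ,
    posWord x y (l ++ [false]) = runWord x y a ∧ (true ∈ l → ∃ k ∈ a, k ≠ 0) ∧ a ≠ [] := by
  induction l with
  | nil => exact ⟨[0], by simp [posWord, runWord]⟩
  | cons i l ih =>
    obtain ⟨a, h1, h2, h3⟩ := ih
    cases i
    · refine ⟨0 :: a, ?_, fun h => ?_, by simp⟩
      · rw [List.cons_append, posWord_cons, h1]
        simp [posWord, runWord]
      · obtain ⟨k, hk, hk'⟩ := h2 (by simpa using h)
        exact ⟨k, by simp [hk], hk'⟩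
    · obtain ⟨k, a, rfl⟩ := List.exists_cons_of_ne_nil h3
      refine ⟨(k + 1) :: a, ?_, fun _ => ⟨k + 1, by simp, by simp⟩, by simp⟩
      rw [List.cons_append, posWord_cons, h1]
      simp [posWord, runWord, pow_succ', mul_assoc]

theorem isConj_posWord_append (l m : List Bool) :
    IsConj (posWord x y (l ++ m)) (posWord x y (m ++ l)) :=
  isConj_iff.2 ⟨posWord x y m, by simp [posWord_append, mul_assoc]⟩

/-- A positive word is conjugate to a product of runs or a power of a single letter. -/
theorem posWord_conj (l : List Bool) :
    (∃ a : List ℕ, (∃ k ∈ a, k ≠ 0) ∧ IsConj (posWord x y l) (runWord x y a)) ∨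
      (∃ n : ℕ, posWord x y l = x ^ n) ∨ ∃ n : ℕ, posWord x y l = y⁻¹ ^ n := by
  by_cases hf : false ∈ l
  · by_cases ht : true ∈ l
    · left
      -- Rotate the word cyclically so that an occurrence of `y⁻¹` comes last.
      obtain ⟨l₁, l₂, rfl⟩ := List.append_of_mem hf
      obtain ⟨a, h1, h2, -⟩ := exists_runWord (x := x) (y := y) (l₂ ++ l₁)
      refine ⟨a, h2 (by simpa [or_comm] using ht), ?_⟩
      rw [← h1]
      have := isConj_posWord_append (x := x) (y := y) (l₁ ++ [false]) l₂
      simpa using this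
    · right; right
      refine ⟨l.length, ?_⟩
      have := List.eq_replicate_of_mem (l := l) (a := false) fun b hb => by
        cases b; exacts [rfl, absurd hb ht]
      rw [this]
      simp [posWord]
  · right; left
    refine ⟨l.length, ?_⟩
    have := List.eq_replicate_of_mem (l := l) (a := true) fun b hb => by
      cases b; exacts [absurd hb hf, rfl]
    rw [this]
    simp [posWord]

end Words

/-- Generators `s` and `t` of orders dividing two and three. -/
structure IsTwoThree (s t : G) : Prop where
  sq : s * s = 1
  cube : t ^ (3 : ℤ) = 1
  gen : ∀ g : G, g ∈ Subgroup.closure {s, t}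

/-! ### Normal forms and conjugacy in quotients of `ℤ/2 * ℤ/3` -/

namespace IsTwoThree

variable {s t : G} (H : IsTwoThree s t)
include H

local notation "W" => posWord (t⁻¹ * s) (t * s)⁻¹

theorem zpow_three_mul (j q : ℤ) : t ^ (j + 3 * q) = t ^ j := by
  rw [zpow_add, zpow_mul, H.cube, one_zpow, mul_one]

/-- Modulo three the exponent is `1` or `-1`, and `t * s` and `t⁻¹ * s` are the two letters. -/
theorem zpow_mul_s {j : ℤ} (hj : ¬ 3 ∣ j) : ∃ i : Bool, t ^ j * s = W [i] := by
  have h3 : j % 3 = 1 ∨ j % 3 = 2 := by omega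
  have hq := Int.emod_add_mul_ediv j 3
  rcases h3 with h3 | h3 <;> rw [h3] at hq
  · exact ⟨false, by rw [← hq, H.zpow_three_mul, posWord_false]; simp⟩
  · refine ⟨true, ?_⟩
    have : (2 : ℤ) + 3 * (j / 3) = -1 + 3 * (j / 3 + 1) := by ring
    rw [← hq, this, H.zpow_three_mul, posWord_true]
    simp

omit H in
theorem letter (i : Bool) : ∃ j : ℤ, W [i] = t ^ j * s := by
  cases i
  · exact ⟨1, by simp [posWord_false]⟩
  · exact ⟨-1, by simp [posWord_true]⟩

theorem zpow_of_dvd {j : ℤ} (hj : 3 ∣ j) : t ^ j = 1 := by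
  obtain ⟨q, rfl⟩ := hj
  rw [zpow_mul, H.cube, one_zpow]

/-- A factor `s` on the right either completes `t ^ j` to a new letter or, when `t ^ j = 1`, cancels
the `s` that ends the last letter, whose power of `t` becomes the new tail. This is what keeps the
normal form stable under the generators. -/
theorem normalForm_mul_s {ε : Bool} {l : List Bool} {j : ℤ} :
    ∃ (ε' : Bool) (l' : List Bool) (j' : ℤ),
      (if ε then s else 1) * W l * t ^ j * s = (if ε' then s else 1) * W l' * t ^ j' := by
  by_cases hj : 3 ∣ j
  · rw [H.zpow_of_dvd hj, mul_one]
    rcases List.eq_nil_or_concat l with rfl | ⟨l, i, rfl⟩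
    · refine ⟨!ε, [], 0, ?_⟩
      cases ε <;> simp [posWord, H.sq]
    · obtain ⟨k, hk⟩ := letter (s := s) (t := t) i
      refine ⟨ε, l, k, ?_⟩
      rw [List.concat_eq_append, posWord_append, hk]
      simp only [mul_assoc, H.sq, mul_one]
  · obtain ⟨i, hi⟩ := H.zpow_mul_s hj
    refine ⟨ε, l ++ [i], 0, ?_⟩
    rw [mul_assoc, hi, posWord_append, zpow_zero, mul_one, mul_assoc]

theorem exists_normalForm (g : G) : ∃ (ε : Bool) (l : List Bool) (j : ℤ),
    g = (if ε then s else 1) * W l * t ^ j := by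
  induction H.gen g using Subgroup.closure_induction_right with
  | one => exact ⟨false, [], 0, by simp [posWord]⟩
  | mul_right g _ z hz ih =>
    obtain ⟨ε, l, j, rfl⟩ := ih
    rcases hz with rfl | rfl
    · exact H.normalForm_mul_s
    · exact ⟨ε, l, j + 1, by rw [zpow_add_one, mul_assoc _ _ z]⟩
  | mul_inv_cancel g _ z hz ih =>
    obtain ⟨ε, l, j, rfl⟩ := ih
    rcases hz with rfl | rfl
    · rw [inv_eq_of_mul_eq_one_left H.sq]
      exact H.normalForm_mul_s
    · exact ⟨ε, l, j - 1, by rw [zpow_sub_one, mul_assoc _ _ z⁻¹]⟩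

/-- The normal form is read cyclically. Without a leading `s`, the first letter gives its power of
`t` to the tail and leaves its `s` in front. With a leading `s`, that `s` moves to the end, where it
forms a letter with the tail or cancels the last letter's `s`. Whenever no positive word results at
once, the number of letters drops. -/
theorem normalForm_conj (n : ℕ) : ∀ (l : List Bool), l.length = n → ∀ (ε : Bool) (j : ℤ),
    (∃ l', IsConj ((if ε then s else 1) * W l * t ^ j) (W l')) ∨
      IsConj ((if ε then s else 1) * W l * t ^ j) s ∨
      ∃ k : ℤ, IsConj ((if ε then s else 1) * W l * t ^ j) (t ^ k) := by
  induction n with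
  | zero =>
    intro l hl ε j
    obtain rfl : l = [] := List.length_eq_zero_iff.1 hl
    have hW : W [] = 1 := rfl
    rw [hW, mul_one]
    cases ε
    · exact Or.inr (Or.inr ⟨j, by rw [if_neg (by simp), one_mul]⟩)
    · by_cases hj : 3 ∣ j
      · exact Or.inr (Or.inl (by rw [if_pos rfl, H.zpow_of_dvd hj, mul_one]))
      · obtain ⟨i, hi⟩ := H.zpow_mul_s hj
        exact Or.inl ⟨[i], isConj_iff.2 ⟨t ^ j, by rw [← hi]; simp [mul_assoc]⟩⟩
  | succ n ih =>
    intro l hl ε j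
    cases ε
    · by_cases hj : 3 ∣ j
      · exact Or.inl ⟨l, by rw [if_neg (by simp), H.zpow_of_dvd hj, one_mul, mul_one]⟩
      · obtain ⟨i, l, rfl⟩ := List.exists_cons_of_length_eq_add_one hl
        obtain ⟨k, hk⟩ := letter (s := s) (t := t) i
        have key : IsConj ((if false = true then s else 1) * W (i :: l) * t ^ j)
            ((if true = true then s else 1) * W l * t ^ (j + k)) := by
          refine isConj_iff.2 ⟨(t ^ k)⁻¹, ?_⟩
          rw [posWord_cons, hk, zpow_add]
          simp [mul_assoc]
        have := ih l (by simpa using hl) true (j + k)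
        exact this.imp (fun ⟨l', h⟩ => ⟨l', key.trans h⟩)
          (Or.imp key.trans fun ⟨k, h⟩ => ⟨k, key.trans h⟩)
    · by_cases hj : 3 ∣ j
      · rcases List.eq_nil_or_concat l with rfl | ⟨l, i, rfl⟩
        · simp at hl
        obtain ⟨k, hk⟩ := letter (s := s) (t := t) i
        have key : IsConj ((if true = true then s else 1) * W (l.concat i) * t ^ j)
            ((if false = true then s else 1) * W l * t ^ k) := by
          refine isConj_iff.2 ⟨s⁻¹, ?_⟩
          rw [List.concat_eq_append, posWord_append, hk, H.zpow_of_dvd hj]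
          simp [mul_assoc, H.sq]
        have := ih l (by simpa using hl) false k
        exact this.imp (fun ⟨l', h⟩ => ⟨l', key.trans h⟩)
          (Or.imp key.trans fun ⟨k, h⟩ => ⟨k, key.trans h⟩)
      · obtain ⟨i, hi⟩ := H.zpow_mul_s hj
        refine Or.inl ⟨l ++ [i], isConj_iff.2 ⟨s⁻¹, ?_⟩⟩
        rw [posWord_append, ← hi]
        simp [mul_assoc]

end IsTwoThree

/-! ### The central element `(x * y) ^ 3` and the quotient by it -/

section Quotient

variable {x y : G}

theorem isTwoThree_of_braid (hb : x * y * x = y * x * y) (hc : (x * y) ^ 3 = 1)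
    (hg : ∀ g : G, g ∈ Subgroup.closure {x, y}) : IsTwoThree (x * y * x) (x * y) := by
  have hsq : x * y * x * (x * y * x) = 1 := by
    rw [← hc]
    symm
    calc (x * y) ^ 3 = x * y * x * (y * x * y) := by
          simp only [pow_succ, pow_zero, one_mul, mul_assoc]
      _ = _ := by rw [← hb]
  refine ⟨hsq, by exact_mod_cast hc, fun g => ?_⟩
  have hle : Subgroup.closure {x, y} ≤ Subgroup.closure {x * y * x, x * y} := by
    have h1 : x * y * x ∈ Subgroup.closure {x * y * x, x * y} := Subgroup.subset_closure (by simp)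
    have h2 : x * y ∈ Subgroup.closure {x * y * x, x * y} := Subgroup.subset_closure (by simp)
    have hx : x ∈ Subgroup.closure {x * y * x, x * y} := by
      have := mul_mem (inv_mem h2) h1
      rwa [inv_mul_cancel_left] at this
    rw [Subgroup.closure_le]
    rintro z (rfl | rfl)
    · exact hx
    · have := mul_mem (inv_mem hx) h2
      rwa [inv_mul_cancel_left] at this
  exact hle (hg g)

/-- Conjugacy classes when `x` and `y` braid, generate the group and `(x * y) ^ 3 = 1`. -/
theorem exists_conj_of_braid_of_cube (hb : x * y * x = y * x * y) (hc : (x * y) ^ 3 = 1)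
    (hg : ∀ g : G, g ∈ Subgroup.closure {x, y}) (g : G) :
    (∃ a : List ℕ, (∃ k ∈ a, k ≠ 0) ∧ IsConj g (runWord x y a)) ∨
      (∃ m : ℤ, IsConj g (y ^ m)) ∨
      ∃ m : ℤ, (m = -1 ∨ m = -2 ∨ m = -3) ∧ IsConj g (x ^ m * y⁻¹) := by
  have H := isTwoThree_of_braid hb hc hg
  -- For `s = x * y * x` and `t = x * y` the letters `t⁻¹ * s` and `t * s` are `x` and `y⁻¹`; only
  -- the second identity needs the cube relation.
  have hx : (x * y)⁻¹ * (x * y * x) = x := by group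
  have hy : ((x * y) * (x * y * x))⁻¹ = y := by
    refine inv_eq_of_mul_eq_one_right ?_
    rw [← hc]
    simp only [pow_succ, pow_zero, one_mul, mul_assoc]
  have hxy : IsConj x y := isConj_iff.2 ⟨(x * y * x)⁻¹, by
    rw [inv_inv, mul_assoc, inv_mul_eq_iff_eq_mul]
    conv_lhs => rw [hb]
    simp only [mul_assoc]⟩
  -- An involution equals its inverse `x⁻¹ * y⁻¹ * x⁻¹`, and rotating this collects the two factors
  -- `x⁻¹`.
  have hs : IsConj (x * y * x) (x ^ (-2 : ℤ) * y⁻¹) := by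
    rw [← inv_eq_of_mul_eq_one_left H.sq]
    exact isConj_iff.2 ⟨x⁻¹, by group⟩
  have ht : ∀ k : ℤ, (x * y) ^ k = 1 ∨ IsConj ((x * y) ^ k) (x ^ (-1 : ℤ) * y⁻¹) ∨
      IsConj ((x * y) ^ k) (x ^ (-3 : ℤ) * y⁻¹) := by
    intro k
    have hq := Int.emod_add_mul_ediv k 3
    have h3 : k % 3 = 0 ∨ k % 3 = 1 ∨ k % 3 = 2 := by omega
    rw [← hq, H.zpow_three_mul]
    rcases h3 with h3 | h3 | h3 <;> rw [h3]
    · exact Or.inl (zpow_zero _)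
    · refine Or.inr (Or.inr ?_)
      -- Write `t` as `t ^ (-2)`: by the braid relation this is `x⁻¹ * y⁻¹ * x⁻¹ * x⁻¹`, which
      -- rotates to `x ^ (-3) * y⁻¹`. In the next case `t ^ 2` is written as `t⁻¹`.
      rw [← H.zpow_three_mul 1 (-1)]
      have hb' : x⁻¹ * y⁻¹ * x⁻¹ = y⁻¹ * x⁻¹ * y⁻¹ := by
        have := congrArg (·⁻¹) hb
        simpa [mul_assoc] using this
      have : (x * y) ^ ((1 : ℤ) + 3 * (-1)) = x⁻¹ * y⁻¹ * x⁻¹ * x⁻¹ := by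
        rw [hb']
        norm_num
        simp only [pow_succ, pow_zero, one_mul, mul_inv_rev, mul_assoc]
      rw [this]
      exact isConj_iff.2 ⟨x ^ (-2 : ℤ), by group⟩
    · refine Or.inr (Or.inl ?_)
      rw [← H.zpow_three_mul 2 (-1)]
      exact isConj_iff.2 ⟨y, by norm_num⟩
  obtain ⟨ε, l, j, h⟩ := H.exists_normalForm g
  have key := H.normalForm_conj _ l rfl ε j
  rw [← h, hx, hy] at key
  rcases key with ⟨l', h⟩ | h | ⟨k, h⟩
  · rcases posWord_conj (x := x) (y := y) l' with ⟨a, ha, h'⟩ | ⟨n, h'⟩ | ⟨n, h'⟩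
    · exact Or.inl ⟨a, ha, h.trans h'⟩
    · refine Or.inr (Or.inl ⟨n, h.trans ?_⟩)
      rw [h', zpow_natCast]
      exact hxy.pow n
    · exact Or.inr (Or.inl ⟨-n, by rwa [zpow_neg, zpow_natCast, ← inv_pow, ← h']⟩)
  · exact Or.inr (Or.inr ⟨-2, by simp, h.trans hs⟩)
  · rcases ht k with h' | h' | h'
    · exact Or.inr (Or.inl ⟨0, by rwa [zpow_zero, ← h']⟩)
    · exact Or.inr (Or.inr ⟨-1, by simp, h.trans h'⟩)
    · exact Or.inr (Or.inr ⟨-3, by simp, h.trans h'⟩)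

/-- Conjugation by `x * y * x` exchanges `x` and `y`, and `(x * y) ^ 3` is its square, so it
commutes with both generators. -/
theorem commute_braid (hb : x * y * x = y * x * y)
    (hg : ∀ g : G, g ∈ Subgroup.closure {x, y}) (g : G) : Commute g ((x * y) ^ 3) := by
  have hsq : (x * y) ^ 3 = x * y * x * (x * y * x) := by
    calc (x * y) ^ 3 = x * y * x * (y * x * y) := by
          simp only [pow_succ, pow_zero, one_mul, mul_assoc]
      _ = _ := by rw [← hb]
  have hx : x * (x * y * x) = (x * y * x) * y := by
    conv_lhs => rw [hb]
    simp only [mul_assoc]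
  have hy : y * (x * y * x) = (x * y * x) * x := by
    rw [← mul_assoc, ← mul_assoc, ← hb]
  rw [hsq]
  induction hg g using Subgroup.closure_induction with
  | mem g hg =>
    unfold Commute SemiconjBy
    rcases hg with rfl | rfl
    · rw [← mul_assoc, hx, mul_assoc, hy, ← mul_assoc]
    · rw [← mul_assoc, hy, mul_assoc, hx, ← mul_assoc]
  | one => exact Commute.one_left _
  | mul _ _ _ _ h1 h2 => exact h1.mul_left h2
  | inv _ _ h1 => exact h1.inv_left

/-- Conjugacy classes of a group generated by two braiding elements. -/
theorem exists_conj_of_braid (hb : x * y * x = y * x * y)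
    (hg : ∀ g : G, g ∈ Subgroup.closure {x, y}) (g : G) :
    ∃ (ρ h : G) (k : ℤ), h * g * h⁻¹ = ((x * y) ^ 3) ^ k * ρ ∧
      ((∃ a : List ℕ, (∃ k ∈ a, k ≠ 0) ∧ ρ = runWord x y a) ∨ (∃ m : ℤ, ρ = y ^ m) ∨
      ∃ m : ℤ, (m = -1 ∨ m = -2 ∨ m = -3) ∧ ρ = x ^ m * y⁻¹) := by
  have hn : (Subgroup.zpowers ((x * y) ^ 3)).Normal := ⟨by
    rintro _ ⟨k, rfl⟩ h
    refine ⟨k, ?_⟩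
    have := ((commute_braid hb hg h).zpow_right k).eq
    simp only
    rw [this, mul_inv_cancel_right]⟩
  let quo := QuotientGroup.mk' (Subgroup.zpowers ((x * y) ^ 3))
  -- A conjugacy in the quotient lifts up to a power of the central element; centrality lets that
  -- power stand on the left.
  have hlift : ∀ ρ : G, IsConj (quo g) (quo ρ) →
      ∃ (h : G) (k : ℤ), h * g * h⁻¹ = ((x * y) ^ 3) ^ k * ρ := by
    intro ρ hρ
    obtain ⟨h, hh⟩ := isConj_iff.1 hρ
    obtain ⟨h, rfl⟩ := QuotientGroup.mk'_surjective _ h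
    have : quo ρ = quo (h * g * h⁻¹) := by simp [quo, ← hh]
    obtain ⟨k, hk⟩ := QuotientGroup.eq.1 this
    refine ⟨h, k, ?_⟩
    simp only at hk
    rw [← ((commute_braid hb hg ρ).zpow_right k).eq, hk, mul_inv_cancel_left]
  have hc : (quo x * quo y) ^ 3 = 1 := by
    rw [← map_mul, ← map_pow]
    exact (QuotientGroup.eq_one_iff _).2 (Subgroup.mem_zpowers _)
  have hgen : ∀ q, q ∈ Subgroup.closure {quo x, quo y} := by
    intro q
    obtain ⟨q, rfl⟩ := QuotientGroup.mk'_surjective _ q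
    have := Subgroup.mem_map_of_mem quo (hg q)
    rwa [MonoidHom.map_closure, Set.image_pair] at this
  have hrun : ∀ a, quo (runWord x y a) = runWord (quo x) (quo y) a := by
    intro a
    simp [runWord, map_list_prod, Function.comp_def]
  rcases exists_conj_of_braid_of_cube (x := quo x) (y := quo y)
    (by rw [← map_mul, ← map_mul, hb, map_mul, map_mul]) hc hgen (quo g)
    with ⟨a, ha, h⟩ | ⟨m, h⟩ | ⟨m, hm, h⟩
  · rw [← hrun] at h
    obtain ⟨h, k, hk⟩ := hlift _ h
    exact ⟨_, h, k, hk, Or.inl ⟨a, ha, rfl⟩⟩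
  · rw [← map_zpow] at h
    obtain ⟨h, k, hk⟩ := hlift _ h
    exact ⟨_, h, k, hk, Or.inr (Or.inl ⟨m, rfl⟩)⟩
  · rw [← map_zpow, ← map_inv, ← map_mul] at h
    obtain ⟨h, k, hk⟩ := hlift _ h
    exact ⟨_, h, k, hk, Or.inr (Or.inr ⟨m, hm, rfl⟩)⟩

end Quotient
end Braid
end OneHoledTorus
end

noncomputable section
namespace OneHoledTorus

/-! ### Commutators in free groups -/

namespace FreeWord

open FreeGroup

variable {α : Type*}

theorem exists_lcp [DecidableEq α] : ∀ L M : List α, ∃ P A B : List α,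
    L = P ++ A ∧ M = P ++ B ∧ ∀ a ∈ A.head?, ∀ b ∈ B.head?, a ≠ b
  | [], M => ⟨[], [], M, by simp⟩
  | L, [] => ⟨[], L, [], by simp⟩
  | l :: L, m :: M => by
    by_cases h : l = m
    · obtain ⟨P, A, B, h1, h2, h3⟩ := exists_lcp L M
      exact ⟨l :: P, A, B, by simp [h1], by simp [h2, h], h3⟩
    · exact ⟨[], l :: L, m :: M, by simp, by simp, by simpa using h⟩

theorem IsReduced.invRev {L : List (α × Bool)} (h : IsReduced L) :
    IsReduced (FreeGroup.invRev L) := by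
  unfold FreeGroup.invRev
  unfold FreeGroup.IsReduced at h ⊢
  rw [List.isChain_reverse, List.isChain_map]
  refine h.imp fun a b hab => ?_
  intro e
  simpa using (hab e.symm).symm

theorem isReduced_invRev_append {A B : List (α × Bool)} (hA : IsReduced A) (hB : IsReduced B)
    (h : ∀ a ∈ A.head?, ∀ b ∈ B.head?, a ≠ b) : IsReduced (FreeGroup.invRev A ++ B) := by
  have hA' := IsReduced.invRev hA
  unfold FreeGroup.IsReduced at hA' hB ⊢
  refine List.isChain_append.2 ⟨hA', hB, ?_⟩
  intro a ha b hb e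
  cases A with
  | nil => simp [FreeGroup.invRev] at ha
  | cons p A =>
    have : a = (p.1, !p.2) := by simpa [FreeGroup.invRev] using ha.symm
    subst this
    have := h p (by simp) b hb
    by_contra hne
    apply this
    ext
    · exact e
    · simpa using hne

theorem mk_append (L M : List (α × Bool)) :
    (FreeGroup.mk (L ++ M) : FreeGroup α) = FreeGroup.mk L * FreeGroup.mk M := by
  rw [FreeGroup.mul_mk]

theorem mk_invRev (L : List (α × Bool)) :
    (FreeGroup.mk (FreeGroup.invRev L) : FreeGroup α) = (FreeGroup.mk L)⁻¹ := by
  rw [FreeGroup.inv_mk]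

variable [DecidableEq α]

theorem norm_mk_of_isReduced {L : List (α × Bool)} (h : IsReduced L) :
    (FreeGroup.mk L).norm = L.length := by
  rw [FreeGroup.norm, FreeGroup.toWord_mk, h.reduce_eq]

/-- The length of `x⁻¹ * y` when the words of `x` and `y` part after a common prefix. -/
theorem norm_inv_mul {x y : FreeGroup α} {P A B : List (α × Bool)} (hx : x.toWord = P ++ A)
    (hy : y.toWord = P ++ B) (h : ∀ a ∈ A.head?, ∀ b ∈ B.head?, a ≠ b) :
    (x⁻¹ * y).norm = A.length + B.length := by
  have hA : IsReduced A := (isReduced_toWord (x := x)).infix ⟨P, [], by simp [hx]⟩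
  have hB : IsReduced B := (isReduced_toWord (x := y)).infix ⟨P, [], by simp [hy]⟩
  have : x⁻¹ * y = FreeGroup.mk (FreeGroup.invRev A ++ B) := by
    rw [← FreeGroup.mk_toWord (x := x), ← FreeGroup.mk_toWord (x := y), hx, hy, mk_append,
      mk_append, mk_append, mk_invRev]
    group
  rw [this, norm_mk_of_isReduced (isReduced_invRev_append hA hB h), List.length_append,
    FreeGroup.invRev_length]

theorem norm_pow_of_isCyclicallyReduced {L : List (α × Bool)} (h : IsCyclicallyReduced L) (n : ℕ) :
    ((FreeGroup.mk L) ^ n).norm = n * L.length := by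
  have : (FreeGroup.mk L) ^ n = FreeGroup.mk (List.replicate n L).flatten := by
    induction n with
    | zero => simp [FreeGroup.one_eq_mk]
    | succ n ih => rw [pow_succ', ih, List.replicate_succ, List.flatten_cons, mk_append]
  rw [this, norm_mk_of_isReduced (h.flatten_replicate n).isReduced]
  simp

/-- Compare the growth of powers: `n`-th powers of cyclically reduced words have length `n` times
the original, while conjugation by `g` adds at most `2 * g.norm`, independently of `n`. -/
theorem length_le_of_conj {K C : List (α × Bool)} (hK : IsCyclicallyReduced K)
    (hC : IsCyclicallyReduced C) {g : FreeGroup α}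
    (h : FreeGroup.mk K = g * FreeGroup.mk C * g⁻¹) : K.length ≤ C.length := by
  by_contra! hlt
  have key : ∀ n : ℕ, n * K.length ≤ 2 * g.norm + n * C.length := by
    intro n
    rw [← norm_pow_of_isCyclicallyReduced hK, ← norm_pow_of_isCyclicallyReduced hC, h, conj_pow]
    refine (FreeGroup.norm_mul_le _ _).trans ?_
    rw [norm_inv_eq]
    have := FreeGroup.norm_mul_le g (FreeGroup.mk C ^ n)
    omega
  have := key (2 * g.norm + 1)
  nlinarith

theorem length_eq_of_conj {K C : List (α × Bool)} (hK : IsCyclicallyReduced K)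
    (hC : IsCyclicallyReduced C) {g : FreeGroup α}
    (h : FreeGroup.mk K = g * FreeGroup.mk C * g⁻¹) : K.length = C.length := by
  refine le_antisymm (length_le_of_conj hK hC h) (length_le_of_conj (g := g⁻¹) hC hK ?_)
  rw [h]
  group

/-- `P` and `Q⁻¹` are the parts of `x` lost to its neighbours in a product. If nothing were left,
both would be exactly half of `x`; as prefixes of the same `Z` they would coincide, and `x = P *
P⁻¹` would be trivial. -/
theorem exists_middle {x : FreeGroup α} {Z P Q : List (α × Bool)} (hx : x ≠ 1)
    (hP : P <+: x.toWord) (hQ : Q <+: FreeGroup.invRev x.toWord) (hPZ : P <+: Z) (hQZ : Q <+: Z)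
    (hP2 : 2 * P.length ≤ x.toWord.length) (hQ2 : 2 * Q.length ≤ x.toWord.length) :
    ∃ m, m ≠ [] ∧ x.toWord = P ++ m ++ FreeGroup.invRev Q := by
  obtain ⟨A, hA⟩ := hP
  obtain ⟨B, hB⟩ := hQ
  have hB' : x.toWord = FreeGroup.invRev B ++ FreeGroup.invRev Q := by
    rw [← FreeGroup.invRev_append, hB, FreeGroup.invRev_invRev]
  have hl1 := congrArg List.length hA
  have hl2 := congrArg List.length hB'
  simp only [List.length_append, FreeGroup.invRev_length] at hl1 hl2
  have hpre : P <+: FreeGroup.invRev B := by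
    refine List.prefix_of_prefix_length_le (l₃ := x.toWord) ⟨A, hA⟩ ⟨_, hB'.symm⟩ ?_
    rw [FreeGroup.invRev_length]
    omega
  obtain ⟨m, hm⟩ := hpre
  refine ⟨m, ?_, by rw [hB', ← hm]⟩
  rintro rfl
  have hlm := congrArg List.length hm
  simp only [List.length_append, FreeGroup.invRev_length, List.length_nil] at hlm
  have hPQ : P = Q := (List.prefix_of_prefix_length_le hPZ hQZ (by omega)).eq_of_length (by omega)
  apply hx
  rw [← FreeGroup.mk_toWord (x := x), hB', ← hm, hPQ, List.append_nil, mk_append, mk_invRev,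
    mul_inv_cancel]

omit [DecidableEq α] in
-- `P` is everything that cancels between `X⁻¹` and `Y`, since the words part right after it. The
-- surviving pieces `m` of `X⁻¹` and `n` of `Y` are nonempty, so their meeting letters are precisely
-- those that do not cancel.
theorem isReduced_append_of_split {P X Y m n Q R : List (α × Bool)} (hX : IsReduced X)
    (hY : IsReduced Y) (hm : m ≠ []) (hn : n ≠ []) {A B : List (α × Bool)} (hXA : X = P ++ A)
    (hYB : Y = P ++ B) (h : ∀ a ∈ A.head?, ∀ b ∈ B.head?, a ≠ b)
    (hXm : FreeGroup.invRev X = Q ++ m ++ FreeGroup.invRev P)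
    (hYn : Y = P ++ n ++ R) : IsReduced (m ++ n) := by
  have hX' : X = P ++ (FreeGroup.invRev m ++ FreeGroup.invRev Q) := by
    rw [← FreeGroup.invRev_invRev (L₁ := X), hXm]
    simp [FreeGroup.invRev_append]
  have hA : A = FreeGroup.invRev m ++ FreeGroup.invRev Q := List.append_cancel_left (hXA ▸ hX')
  have hB : B = n ++ R := by
    rw [List.append_assoc] at hYn
    exact List.append_cancel_left (hYB ▸ hYn)
  have hm' : FreeGroup.invRev m ≠ [] := by
    rw [← List.length_pos_iff, FreeGroup.invRev_length, List.length_pos_iff]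
    exact hm
  have := isReduced_invRev_append (A := FreeGroup.invRev m) (B := n)
    (hX.infix ⟨P, FreeGroup.invRev Q, by simp [hX']⟩) (hY.infix ⟨P, R, by simp [hYn]⟩) ?_
  · rwa [FreeGroup.invRev_invRev] at this
  · intro a ha b hb
    refine h a ?_ b ?_
    · rw [hA, List.head?_append_of_ne_nil _ hm']
      exact ha
    · rw [hB, List.head?_append_of_ne_nil _ hn]
      exact hb

omit [DecidableEq α] in
theorem isCyclicallyReduced_four {m₁ m₂ m₃ m₄ : List (α × Bool)} (h₁ : m₁ ≠ []) (h₂ : m₂ ≠ [])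
    (h₃ : m₃ ≠ []) (h₄ : m₄ ≠ []) (h₁₂ : IsReduced (m₁ ++ m₂)) (h₂₃ : IsReduced (m₂ ++ m₃))
    (h₃₄ : IsReduced (m₃ ++ m₄)) (h₄₁ : IsReduced (m₄ ++ m₁)) :
    IsCyclicallyReduced (m₁ ++ m₂ ++ m₃ ++ m₄) := by
  refine isCyclicallyReduced_iff.2 ⟨?_, ?_⟩
  · have h₁₂₃ := h₁₂.append_overlap h₂₃ h₂
    rw [List.append_assoc] at h₁₂₃ ⊢
    rw [List.append_assoc, ← List.append_assoc m₂, ← List.append_assoc m₁]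
    rw [← List.append_assoc] at h₁₂₃
    have := h₁₂₃.append_overlap h₃₄ h₃
    simpa using this
  · intro a ha b hb
    rw [List.getLast?_append_of_ne_nil _ h₄] at ha
    rw [List.append_assoc, List.append_assoc, List.head?_append_of_ne_nil _ h₁] at hb
    exact (List.isChain_append.1 h₄₁).2.2 a ha b hb

/-- The word of `x` begins with `l` and ends with its inverse, so conjugating strips both ends. -/
theorem norm_conj_letter {x : FreeGroup α} {l : α × Bool} (h : x.toWord.head? = some l)
    (h' : x⁻¹.toWord.head? = some l) :
    ((FreeGroup.mk [l])⁻¹ * x * FreeGroup.mk [l]).norm < x.norm := by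
  obtain ⟨K, hK⟩ : ∃ K, x.toWord = l :: K := List.head?_eq_some_iff.1 h
  rw [FreeGroup.toWord_inv, hK] at h'
  rcases List.eq_nil_or_concat K with rfl | ⟨K, p, rfl⟩
  · have := congrArg (Option.map Prod.snd) h'
    simp [FreeGroup.invRev] at this
  · have hp : p = (l.1, !l.2) := by
      have : (p.1, !p.2) = l := by simpa [FreeGroup.invRev] using h'
      rw [← this]
      simp
    have hx : x = FreeGroup.mk [l] * FreeGroup.mk K * (FreeGroup.mk [l])⁻¹ := by
      rw [← FreeGroup.mk_toWord (x := x), hK, List.concat_eq_append, hp, ← mk_invRev, ← mk_append,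
        ← mk_append]
      simp [FreeGroup.invRev]
    have hn : x.norm = K.length + 2 := by
      rw [FreeGroup.norm, hK]
      simp
    have : (FreeGroup.mk [l])⁻¹ * x * FreeGroup.mk [l] = FreeGroup.mk K := by
      rw [hx]
      group
    rw [this, hn]
    have := FreeGroup.norm_mk_le (L₁ := K)
    omega

set_option maxHeartbeats 1000000 in
/-- A pair of elements of minimal length whose commutator is conjugate to a cyclically reduced word
of length four consists of letters. -/
theorem norm_eq_one_of_minimal {u v g : FreeGroup α} {C : List (α × Bool)}
    (hC : IsCyclicallyReduced C) (hC4 : C.length = 4)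
    (hconj : u * v * u⁻¹ * v⁻¹ = g * FreeGroup.mk C * g⁻¹)
    (h1u : u.norm ≤ (u * v).norm) (h1v : v.norm ≤ (u * v).norm)
    (h2u : u.norm ≤ (v * u⁻¹).norm) (h2v : v.norm ≤ (v * u⁻¹).norm)
    (h3u : u.norm ≤ (v * u).norm) (h3v : v.norm ≤ (v * u).norm)
    (h4u : u.norm ≤ (v⁻¹ * u).norm) (h4v : v.norm ≤ (v⁻¹ * u).norm)
    (hl : ∀ l : α × Bool, u.norm + v.norm ≤
      ((FreeGroup.mk [l])⁻¹ * u * FreeGroup.mk [l]).norm +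
      ((FreeGroup.mk [l])⁻¹ * v * FreeGroup.mk [l]).norm) :
    u.norm = 1 ∧ v.norm = 1 := by
  have hne : u * v ≠ v * u := by
    intro h
    have h1 : g * FreeGroup.mk C * g⁻¹ = 1 := by rw [← hconj, h]; group
    have h2 : FreeGroup.mk C = 1 := by simpa using h1
    have := norm_mk_of_isReduced hC.isReduced
    rw [h2, FreeGroup.norm_one] at this
    omega
  have hu : u ≠ 1 := by rintro rfl; simp at hne
  have hv : v ≠ 1 := by rintro rfl; simp at hne
  have hU : u⁻¹.toWord = FreeGroup.invRev u.toWord := FreeGroup.toWord_inv u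
  have hV : v⁻¹.toWord = FreeGroup.invRev v.toWord := FreeGroup.toWord_inv v
  have hUlen : u⁻¹.toWord.length = u.toWord.length := by rw [hU, FreeGroup.invRev_length]
  have hVlen : v⁻¹.toWord.length = v.toWord.length := by rw [hV, FreeGroup.invRev_length]
  -- `P1`, …, `P4` record the cancellation at the four junctions of the cyclic product `u * v * u⁻¹
  -- * v⁻¹`: between `u` and `v`, `v` and `u⁻¹`, `u⁻¹` and `v⁻¹`, and `v⁻¹` and `u`.
  obtain ⟨P1, A1, B1, hA1, hB1, hd1⟩ := exists_lcp u⁻¹.toWord v.toWord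
  obtain ⟨P2, A2, B2, hA2, hB2, hd2⟩ := exists_lcp v⁻¹.toWord u⁻¹.toWord
  obtain ⟨P3, A3, B3, hA3, hB3, hd3⟩ := exists_lcp u.toWord v⁻¹.toWord
  obtain ⟨P4, A4, B4, hA4, hB4, hd4⟩ := exists_lcp v.toWord u.toWord
  have hn1 := norm_inv_mul hA1 hB1 hd1
  have hn2 := norm_inv_mul hA2 hB2 hd2
  have hn3 := norm_inv_mul hA3 hB3 hd3
  have hn4 := norm_inv_mul hA4 hB4 hd4
  rw [inv_inv] at hn1 hn2
  rw [← mul_inv_rev, FreeGroup.norm_inv_eq] at hn3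
  have nu : u.norm = u.toWord.length := rfl
  have nv : v.norm = v.toWord.length := rfl
  have la1 := congrArg List.length hA1
  have la2 := congrArg List.length hA2
  have la3 := congrArg List.length hA3
  have la4 := congrArg List.length hA4
  have lb1 := congrArg List.length hB1
  have lb2 := congrArg List.length hB2
  have lb3 := congrArg List.length hB3
  have lb4 := congrArg List.length hB4
  simp only [List.length_append] at la1 la2 la3 la4 lb1 lb2 lb3 lb4
  -- By minimality no junction cancels more than half of either neighbour, so each of the four
  -- factors keeps a nonempty middle.
  obtain ⟨m1, hm1, e1⟩ := exists_middle (x := u) (Z := v.toWord) (P := P4) (Q := P1) hu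
    ⟨B4, hB4.symm⟩ ⟨A1, by rw [← hU, hA1]⟩ ⟨A4, hA4.symm⟩ ⟨B1, hB1.symm⟩ (by omega) (by omega)
  obtain ⟨m2, hm2, e2⟩ := exists_middle (x := v) (Z := u⁻¹.toWord) (P := P1) (Q := P2) hv
    ⟨B1, hB1.symm⟩ ⟨A2, by rw [← hV, hA2]⟩ ⟨A1, hA1.symm⟩ ⟨B2, hB2.symm⟩ (by omega) (by omega)
  obtain ⟨m3, hm3, e3⟩ := exists_middle (x := u⁻¹) (Z := v⁻¹.toWord) (P := P2) (Q := P3)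
    (inv_ne_one.2 hu) ⟨B2, hB2.symm⟩ ⟨A3, by rw [← FreeGroup.toWord_inv, inv_inv, hA3]⟩
    ⟨A2, hA2.symm⟩ ⟨B3, hB3.symm⟩ (by omega) (by omega)
  obtain ⟨m4, hm4, e4⟩ := exists_middle (x := v⁻¹) (Z := u.toWord) (P := P3) (Q := P4)
    (inv_ne_one.2 hv) ⟨B3, hB3.symm⟩ ⟨A4, by rw [← FreeGroup.toWord_inv, inv_inv, hA4]⟩
    ⟨A3, hA3.symm⟩ ⟨B4, hB4.symm⟩ (by omega) (by omega)
  have r12 : IsReduced (m1 ++ m2) := isReduced_append_of_split isReduced_toWord isReduced_toWord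
    hm1 hm2 hA1 hB1 hd1 (by rw [← FreeGroup.toWord_inv, inv_inv, e1]) e2
  have r23 : IsReduced (m2 ++ m3) := isReduced_append_of_split isReduced_toWord isReduced_toWord
    hm2 hm3 hA2 hB2 hd2 (by rw [← FreeGroup.toWord_inv, inv_inv, e2]) e3
  have r34 : IsReduced (m3 ++ m4) := isReduced_append_of_split isReduced_toWord isReduced_toWord
    hm3 hm4 hA3 hB3 hd3 (by rw [← FreeGroup.toWord_inv, e3]) e4
  have r41 : IsReduced (m4 ++ m1) := isReduced_append_of_split isReduced_toWord isReduced_toWord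
    hm4 hm1 hA4 hB4 hd4 (by rw [← FreeGroup.toWord_inv, e4]) e1
  have hcyc := isCyclicallyReduced_four hm1 hm2 hm3 hm4 r12 r23 r34 r41
  have hword : FreeGroup.mk (m1 ++ m2 ++ m3 ++ m4) =
      ((FreeGroup.mk P4)⁻¹ * g) * FreeGroup.mk C * ((FreeGroup.mk P4)⁻¹ * g)⁻¹ := by
    have : u * v * u⁻¹ * v⁻¹ =
        FreeGroup.mk P4 * FreeGroup.mk (m1 ++ m2 ++ m3 ++ m4) * (FreeGroup.mk P4)⁻¹ := by
      conv_lhs => rw [← FreeGroup.mk_toWord (x := u⁻¹), ← FreeGroup.mk_toWord (x := v⁻¹), e3, e4]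
      conv_lhs => rw [← FreeGroup.mk_toWord (x := u), ← FreeGroup.mk_toWord (x := v), e1, e2]
      simp only [mk_append, mk_invRev]
      group
    rw [hconj] at this
    calc _ = (FreeGroup.mk P4)⁻¹ * (FreeGroup.mk P4 * FreeGroup.mk (m1 ++ m2 ++ m3 ++ m4) *
          (FreeGroup.mk P4)⁻¹) * FreeGroup.mk P4 := by group
      _ = _ := by rw [← this]; group
  -- The four nonempty middles form a cyclically reduced word of length four; hence each is a single
  -- letter, and all lengths are expressed by those of `P1` and `P2`.
  have hlen := length_eq_of_conj hcyc hC hword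
  rw [hC4] at hlen
  have p1 := List.length_pos_iff.2 hm1
  have p2 := List.length_pos_iff.2 hm2
  have p3 := List.length_pos_iff.2 hm3
  have p4 := List.length_pos_iff.2 hm4
  have l1 := congrArg List.length e1
  have l2 := congrArg List.length e2
  have l3 := congrArg List.length e3
  have l4 := congrArg List.length e4
  simp only [List.length_append, FreeGroup.invRev_length] at l1 l2 l3 l4 hlen
  have q1 : P1.length = P3.length := by omega
  have q2 : P2.length = P4.length := by omega
  have s1 : 2 * P1.length ≤ u.toWord.length := by omega
  have s2 : 2 * P2.length ≤ u.toWord.length := by omega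
  have lu : u.toWord.length = P1.length + P2.length + 1 := by omega
  have lv : v.toWord.length = P1.length + P2.length + 1 := by omega
  rw [nu, nv]
  clear hn1 hn2 hn3 hn4 h1u h1v h2u h2v h3u h3v h4u h4v la1 la2 la3 la4 lb1 lb2 lb3 lb4
  clear l1 l2 l3 l4 p1 p2 p3 p4 hlen hcyc hword r12 r23 r34 r41 hconj
  have hhead : ∀ {P X A : List (α × Bool)}, X = P ++ A → P ≠ [] → X.head? = P.head? := by
    intro P X A h hP
    rw [h, List.head?_append_of_ne_nil _ hP]
  have h11 := hhead hA1
  have h12 := hhead hB1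
  have h21 := hhead hA2
  have h22 := hhead hB2
  have h31 := hhead hA3
  have h32 := hhead hB3
  have h41 := hhead hA4
  have h42 := hhead hB4
  simp only [← List.length_pos_iff] at h11 h12 h21 h22 h31 h32 h41 h42
  -- If exactly one kind of cancellation occurs, both words have length two and `u = v` or `u⁻¹ =
  -- v`, so they commute. If both occur, `u`, `v` and their inverses all start with the same letter,
  -- and conjugation by it shortens the pair.
  by_cases z1 : P1.length = 0
  · by_cases z2 : P2.length = 0
    · omega
    · exfalso
      have lu : u.toWord.length = 2 := by omega
      have lv : v.toWord.length = 2 := by omega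
      obtain ⟨p, q, hpq⟩ := List.length_eq_two.1 lu
      obtain ⟨r, s, hrs⟩ := List.length_eq_two.1 lv
      have k1 := (h41 (by omega)).trans (h42 (by omega)).symm
      have k2 := (h21 (by omega)).trans (h22 (by omega)).symm
      rw [hpq, hrs] at k1
      rw [hU, hV, hpq, hrs] at k2
      have k1' : r = p := by simpa using k1
      have k2' : s.1 = q.1 ∧ s.2 = q.2 := by simpa [FreeGroup.invRev] using k2
      have : u = v := by
        rw [← FreeGroup.toWord_inj, hpq, hrs, k1', Prod.ext k2'.1 k2'.2]
      exact hne (by rw [this])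
  · by_cases z2 : P2.length = 0
    · exfalso
      have lu : u.toWord.length = 2 := by omega
      have lv : v.toWord.length = 2 := by omega
      obtain ⟨p, q, hpq⟩ := List.length_eq_two.1 lu
      obtain ⟨r, s, hrs⟩ := List.length_eq_two.1 lv
      have k1 := (h11 (by omega)).trans (h12 (by omega)).symm
      have k2 := (h31 (by omega)).trans (h32 (by omega)).symm
      rw [hU, hpq, hrs] at k1
      rw [hV, hpq, hrs] at k2
      have k1' : (q.1, !q.2) = r := by simpa [FreeGroup.invRev] using k1
      have k2' : p = (s.1, !s.2) := by simpa [FreeGroup.invRev] using k2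
      have : u⁻¹ = v := by
        rw [← FreeGroup.toWord_inj, hU, hpq, hrs, ← k1', k2']
        simp [FreeGroup.invRev]
      exact hne (by rw [← this]; simp)
    · exfalso
      have k1 := (h11 (by omega)).trans (h12 (by omega)).symm
      have k2 := (h21 (by omega)).trans (h22 (by omega)).symm
      have k3 := (h41 (by omega)).trans (h42 (by omega)).symm
      obtain ⟨l, K, hlK⟩ := List.exists_cons_of_length_pos (l := u.toWord) (by omega)
      have e1 : u.toWord.head? = some l := by rw [hlK]; rfl
      rw [e1] at k3
      rw [k3] at k1
      rw [k1] at k2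
      have := norm_conj_letter e1 k1
      have := norm_conj_letter k3 k2
      have := hl l
      omega

end FreeWord
end OneHoledTorus
end

noncomputable section
namespace OneHoledTorus

/-! ### Commuting elements of free groups -/

theorem FreeGroup.subsingleton_of_comm {ι : Type*} (h : ∀ p q : FreeGroup ι, p * q = q * p) :
    Subsingleton ι := by
  classical
  refine ⟨fun i j => ?_⟩
  by_contra hij
  have := congrArg FreeGroup.toWord (h (FreeGroup.of i) (FreeGroup.of j))
  simp [FreeGroup.toWord_mul, FreeGroup.reduce.cons, hij, Ne.symm hij] at this

theorem IsFreeGroup.isCyclic_of_comm {G : Type*} [Group G] [IsFreeGroup G]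
    (h : ∀ p q : G, p * q = q * p) : IsCyclic G := by
  have hs : Subsingleton (IsFreeGroup.Generators G) := FreeGroup.subsingleton_of_comm fun p q =>
    (IsFreeGroup.mulEquiv G).injective (by rw [map_mul, map_mul, h])
  have : IsCyclic (FreeGroup (IsFreeGroup.Generators G)) := by
    rcases isEmpty_or_nonempty (IsFreeGroup.Generators G) with h0 | ⟨⟨i⟩⟩
    · infer_instance
    · have := uniqueOfSubsingleton i
      infer_instance
  exact isCyclic_of_surjective (IsFreeGroup.mulEquiv G) (IsFreeGroup.mulEquiv G).surjective

/-- The subgroup generated by the two elements is commutative, and it is free by Nielsen–Schreier,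
so it is cyclic. -/
theorem FreeGroup.exists_zpow_of_commute {α : Type*} {g c : FreeGroup α} (h : Commute g c) :
    ∃ (k : FreeGroup α) (m n : ℤ), g = k ^ m ∧ c = k ^ n := by
  have hcomm : ∀ p ∈ ({g, c} : Set (FreeGroup α)), ∀ q ∈ ({g, c} : Set (FreeGroup α)),
      p * q = q * p := by
    rintro p (rfl | rfl) q (rfl | rfl)
    exacts [rfl, h, h.symm, rfl]
  have := Subgroup.isMulCommutative_closure hcomm
  have hc : IsCyclic (Subgroup.closure ({g, c} : Set (FreeGroup α))) :=
    IsFreeGroup.isCyclic_of_comm fun p q => mul_comm' p q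
  obtain ⟨⟨k, hk⟩, hgen⟩ := hc.exists_generator
  obtain ⟨m, hm⟩ := hgen ⟨g, Subgroup.subset_closure (by simp)⟩
  obtain ⟨n, hn⟩ := hgen ⟨c, Subgroup.subset_closure (by simp)⟩
  exact ⟨k, m, n, by simpa using (congrArg Subtype.val hm).symm,
    by simpa using (congrArg Subtype.val hn).symm⟩

/-! ### The Heisenberg group -/

/-- The integral Heisenberg group. -/
@[ext] structure Heisenberg where
  /-- the first abelian coordinate -/
  fst : ℤ
  /-- the second abelian coordinate -/
  snd : ℤ
  /-- the central coordinate -/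
  center : ℤ

namespace Heisenberg

instance : Group Heisenberg where
  mul p q := ⟨p.fst + q.fst, p.snd + q.snd, p.center + q.center + p.fst * q.snd⟩
  one := ⟨0, 0, 0⟩
  inv p := ⟨-p.fst, -p.snd, -p.center + p.fst * p.snd⟩
  mul_assoc p q r := by
    ext
    · exact add_assoc _ _ _
    · exact add_assoc _ _ _
    · change p.center + q.center + p.fst * q.snd + r.center + (p.fst + q.fst) * r.snd =
        p.center + (q.center + r.center + q.fst * r.snd) + p.fst * (q.snd + r.snd)
      ring
  one_mul p := by
    ext
    · exact zero_add _
    · exact zero_add _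
    · change 0 + p.center + 0 * p.snd = p.center
      ring
  mul_one p := by
    ext
    · exact add_zero _
    · exact add_zero _
    · change p.center + 0 + p.fst * 0 = p.center
      ring
  inv_mul_cancel p := by
    ext
    · exact neg_add_cancel _
    · exact neg_add_cancel _
    · change -p.center + p.fst * p.snd + p.center + -p.fst * p.snd = 0
      ring

@[simp] theorem mul_fst (p q : Heisenberg) : (p * q).fst = p.fst + q.fst := rfl
@[simp] theorem mul_snd (p q : Heisenberg) : (p * q).snd = p.snd + q.snd := rfl
@[simp] theorem mul_center (p q : Heisenberg) :
    (p * q).center = p.center + q.center + p.fst * q.snd := rfl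
@[simp] theorem one_fst : (1 : Heisenberg).fst = 0 := rfl
@[simp] theorem one_snd : (1 : Heisenberg).snd = 0 := rfl
@[simp] theorem one_center : (1 : Heisenberg).center = 0 := rfl
@[simp] theorem inv_fst (p : Heisenberg) : (p⁻¹).fst = -p.fst := rfl
@[simp] theorem inv_snd (p : Heisenberg) : (p⁻¹).snd = -p.snd := rfl
@[simp] theorem inv_center (p : Heisenberg) : (p⁻¹).center = -p.center + p.fst * p.snd := rfl

/-- The first abelian coordinate as a homomorphism. -/
def fstHom : Heisenberg →* Multiplicative ℤ where
  toFun p := Multiplicative.ofAdd p.fst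
  map_one' := rfl
  map_mul' _ _ := rfl

/-- The second abelian coordinate as a homomorphism. -/
def sndHom : Heisenberg →* Multiplicative ℤ where
  toFun p := Multiplicative.ofAdd p.snd
  map_one' := rfl
  map_mul' _ _ := rfl

theorem zpow_fst (p : Heisenberg) (n : ℤ) : (p ^ n).fst = n * p.fst := by
  have := map_zpow fstHom p n
  have := congrArg Multiplicative.toAdd this
  simpa [fstHom] using this

theorem zpow_snd (p : Heisenberg) (n : ℤ) : (p ^ n).snd = n * p.snd := by
  have := map_zpow sndHom p n
  have := congrArg Multiplicative.toAdd this
  simpa [sndHom] using this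

theorem zpow_center (p : Heisenberg) (h : p.fst = 0) (n : ℤ) : (p ^ n).center = n * p.center := by
  induction n using Int.induction_on with
  | zero => simp
  | succ n ih =>
    rw [zpow_add_one, mul_center, ih, zpow_fst, h]
    ring
  | pred n ih =>
    rw [zpow_sub_one, mul_center, ih, zpow_fst, inv_center, h]
    ring

end Heisenberg

/-! ### The free group of rank two -/

/-- The free group of rank two. -/
abbrev F₂ : Type := FreeGroup Bool

/-- The first generator. -/
def genA : F₂ := FreeGroup.of false

/-- The second generator. -/
def genB : F₂ := FreeGroup.of true

/-- The commutator that represents the boundary. -/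
def bdry : F₂ := genB * genA⁻¹ * genB⁻¹ * genA

/-- The map to the Heisenberg group. -/
def heis : F₂ →* Heisenberg := FreeGroup.lift fun i => if i then ⟨0, 1, 0⟩ else ⟨1, 0, 0⟩

theorem heis_genA : heis genA = ⟨1, 0, 0⟩ := by simp [heis, genA]

theorem heis_genB : heis genB = ⟨0, 1, 0⟩ := by simp [heis, genB]

theorem heis_bdry : heis bdry = ⟨0, 0, 1⟩ := by
  simp only [bdry, map_mul, map_inv, heis_genA, heis_genB]
  ext <;> simp

theorem F₂.hom_ext {M : Type*} [Monoid M] {f g : F₂ →* M} (ha : f genA = g genA)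
    (hb : f genB = g genB) : f = g :=
  FreeGroup.ext_hom _ _ fun i => by cases i; exacts [ha, hb]

/-- The boundary word is not a proper power: it maps to `(0, 0, 1)` in the Heisenberg group, and if
it is an `n`-th power then `n` divides its central coordinate `1`. That coordinate is additive in
powers only once the first coordinate of the root is known to vanish. -/
theorem exists_zpow_of_commute_bdry {g : F₂} (h : Commute g bdry) : ∃ k : ℤ, g = bdry ^ k := by
  obtain ⟨k, m, n, hg, hc⟩ := FreeGroup.exists_zpow_of_commute h
  have h1 := congrArg heis hc
  rw [map_zpow, heis_bdry] at h1
  have hf := congrArg Heisenberg.fst h1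
  have hz := congrArg Heisenberg.center h1
  have hn : n ≠ 0 := by rintro rfl; simp at hz
  rw [Heisenberg.zpow_fst] at hf
  have hf0 : (heis k).fst = 0 := by simpa [hn] using hf.symm
  rw [Heisenberg.zpow_center _ hf0] at hz
  have hn1 : n = 1 ∨ n = -1 := Int.isUnit_iff.1 (IsUnit.of_mul_eq_one _ hz.symm)
  rcases hn1 with rfl | rfl
  · exact ⟨m, by rw [hc, hg, zpow_one]⟩
  · exact ⟨-m, by rw [hc, hg]; simp⟩

theorem exists_zpow_of_commute_genA {g : F₂} (h : Commute g genA) : ∃ k : ℤ, g = genA ^ k := by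
  obtain ⟨k, m, n, hg, hc⟩ := FreeGroup.exists_zpow_of_commute h
  have h1 := congrArg Heisenberg.fst (congrArg heis hc)
  rw [map_zpow, heis_genA, Heisenberg.zpow_fst] at h1
  have hn1 : n = 1 ∨ n = -1 := Int.isUnit_iff.1 (IsUnit.of_mul_eq_one _ h1.symm)
  rcases hn1 with rfl | rfl
  · exact ⟨m, by rw [hc, hg, zpow_one]⟩
  · exact ⟨-m, by rw [hc, hg]; simp⟩

theorem exists_zpow_of_commute_genB {g : F₂} (h : Commute g genB) : ∃ k : ℤ, g = genB ^ k := by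
  obtain ⟨k, m, n, hg, hc⟩ := FreeGroup.exists_zpow_of_commute h
  have h1 := congrArg Heisenberg.snd (congrArg heis hc)
  rw [map_zpow, heis_genB, Heisenberg.zpow_snd] at h1
  have hn1 : n = 1 ∨ n = -1 := Int.isUnit_iff.1 (IsUnit.of_mul_eq_one _ h1.symm)
  rcases hn1 with rfl | rfl
  · exact ⟨m, by rw [hc, hg, zpow_one]⟩
  · exact ⟨-m, by rw [hc, hg]; simp⟩

/-! ### Endomorphisms fixing the boundary word -/

/-- Conjugation as an endomorphism. -/
def conjHom (g : F₂) : F₂ →* F₂ := (MulAut.conj g).toMonoidHom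

@[simp] theorem conjHom_apply (g t : F₂) : conjHom g t = g * t * g⁻¹ := rfl

/-- An action of a group on the free group of rank two by endomorphisms, in which two elements act
as the Dehn twists. -/
structure IsTwistAction {M : Type*} [Group M] (Ψ : M → F₂ →* F₂) (x y : M) : Prop where
  act_one : Ψ 1 = MonoidHom.id F₂
  act_mul : ∀ g h, Ψ (g * h) = (Ψ g).comp (Ψ h)
  x_a : Ψ x genA = genA
  x_b : Ψ x genB = genB * genA
  y_a : Ψ y genA = genB⁻¹ * genA
  y_b : Ψ y genB = genB

/-! ### Relations between the twists -/

namespace IsTwistAction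

variable {M : Type*} [Group M] {Ψ : M → F₂ →* F₂} {x y : M} (H : IsTwistAction Ψ x y)
include H

theorem map_mul_apply (g h : M) (t : F₂) : Ψ (g * h) t = Ψ g (Ψ h t) := by
  rw [H.act_mul]; rfl

theorem map_inv_apply (g : M) (t : F₂) : Ψ g⁻¹ (Ψ g t) = t := by
  rw [← H.map_mul_apply, inv_mul_cancel, H.act_one]; rfl

theorem xinv_a : Ψ x⁻¹ genA = genA := by
  conv_lhs => rw [← H.x_a, H.map_inv_apply]

theorem xinv_b : Ψ x⁻¹ genB = genB * genA⁻¹ := by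
  have := H.map_inv_apply x genB
  rwa [H.x_b, map_mul, H.xinv_a, ← eq_mul_inv_iff_mul_eq] at this

theorem yinv_b : Ψ y⁻¹ genB = genB := by
  conv_lhs => rw [← H.y_b, H.map_inv_apply]

theorem yinv_a : Ψ y⁻¹ genA = genB * genA := by
  have := H.map_inv_apply y genA
  rwa [H.y_a, map_mul, map_inv, H.yinv_b, inv_mul_eq_iff_eq_mul] at this

theorem braid : Ψ (x * y * x) = Ψ (y * x * y) := by
  refine F₂.hom_ext ?_ ?_
  · simp [H.map_mul_apply, H.x_a, H.x_b, H.y_a, H.y_b, mul_assoc]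
  · simp [H.map_mul_apply, H.x_a, H.x_b, H.y_a, H.y_b, mul_assoc]

/-- Together with `sq_b` this is the hyperelliptic involution, up to the boundary word; applying it
twice leaves conjugation by the boundary word. -/
theorem sq_a : Ψ ((x * y) ^ 3) genA = genA⁻¹ * bdry := by
  simp [pow_succ, H.map_mul_apply, H.x_a, H.x_b, H.y_a, H.y_b, bdry, mul_assoc]

theorem sq_b : Ψ ((x * y) ^ 3) genB = genB⁻¹ * bdry := by
  simp [pow_succ, H.map_mul_apply, H.x_a, H.x_b, H.y_a, H.y_b, bdry, mul_assoc]

theorem x_bdry : Ψ x bdry = bdry := by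
  simp [H.x_a, H.x_b, bdry, mul_assoc]

theorem y_bdry : Ψ y bdry = bdry := by
  simp [H.y_a, H.y_b, bdry, mul_assoc]

theorem map_bdry {w : M} (hw : w ∈ Subgroup.closure {x, y}) : Ψ w bdry = bdry := by
  induction hw using Subgroup.closure_induction with
  | mem g hg =>
    rcases hg with rfl | rfl
    exacts [H.x_bdry, H.y_bdry]
  | one => rw [H.act_one]; rfl
  | mul g h _ _ h1 h2 => rw [H.map_mul_apply, h2, h1]
  | inv g _ h1 => conv_lhs => rw [← h1, H.map_inv_apply]

theorem boundary (t : F₂) : Ψ ((x * y) ^ 6) t = bdry⁻¹ * t * bdry := by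
  have hc : Ψ ((x * y) ^ 3) bdry = bdry := H.map_bdry (pow_mem (mul_mem
    (Subgroup.subset_closure (by simp)) (Subgroup.subset_closure (by simp))) 3)
  have : Ψ ((x * y) ^ 6) = conjHom bdry⁻¹ := by
    refine F₂.hom_ext ?_ ?_
    · rw [show 6 = 3 + 3 from rfl, pow_add, H.map_mul_apply, H.sq_a, map_mul, hc, map_inv, H.sq_a]
      simp [mul_assoc]
    · rw [show 6 = 3 + 3 from rfl, pow_add, H.map_mul_apply, H.sq_b, map_mul, hc, map_inv, H.sq_b]
      simp [mul_assoc]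
  rw [this]
  simp

theorem boundary_zpow (k : ℤ) (t : F₂) : Ψ (((x * y) ^ 6) ^ k) t = (bdry ^ k)⁻¹ * t * bdry ^ k := by
  have h0 : Ψ ((x * y) ^ 6) bdry = bdry := by rw [H.boundary]; simp
  induction k using Int.induction_on generalizing t with
  | zero => simp [H.act_one]
  | succ n ih => rw [zpow_add_one, H.map_mul_apply, H.boundary, ih, zpow_add_one]; group
  | pred n ih =>
    have : Ψ ((x * y) ^ 6)⁻¹ t = bdry * t * bdry⁻¹ := by
      have := H.map_inv_apply ((x * y) ^ 6) (bdry * t * bdry⁻¹)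
      rw [H.boundary] at this
      rw [← this]
      congr 1
      group
    rw [zpow_sub_one, H.map_mul_apply, this, ih, zpow_sub_one]
    group

/-- The pairs obtained from the images of the generators by twists and conjugations. -/
def Reach (Ψ : M → F₂ →* F₂) (x y : M) (f : F₂ →* F₂) (p : F₂ × F₂) : Prop :=
  ∃ w ∈ Subgroup.closure {x, y}, ∃ g : F₂,
    p.1 = g * f (Ψ w genA) * g⁻¹ ∧ p.2 = g * f (Ψ w genB) * g⁻¹

/-! ### Nielsen reduction by twists and conjugations -/

variable {f : F₂ →* F₂} {U V : F₂}

omit H in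
theorem Reach.conj (h : Reach Ψ x y f (U, V)) (k : F₂) :
    Reach Ψ x y f (k * U * k⁻¹, k * V * k⁻¹) := by
  obtain ⟨w, hw, g, hU, hV⟩ := h
  simp only at hU hV
  refine ⟨w, hw, k * g, ?_, ?_⟩
  · rw [hU]; group
  · rw [hV]; group

/-- A reachable pair is the image of the generators under `θ`, a conjugate of `f ∘ Ψ w`.
Precomposing with `Ψ z` replaces `w` by `w * z`, so twists act on reachable pairs as Nielsen moves.
-/
theorem Reach.mul (h : Reach Ψ x y f (U, V)) {z : M} (hz : z ∈ Subgroup.closure {x, y})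
    (θ : F₂ →* F₂) (hθa : θ genA = U) (hθb : θ genB = V) :
    Reach Ψ x y f (θ (Ψ z genA), θ (Ψ z genB)) := by
  obtain ⟨w, hw, g, hU, hV⟩ := h
  have : θ = (conjHom g).comp (f.comp (Ψ w)) := by
    refine F₂.hom_ext ?_ ?_
    · rw [hθa]; simpa using hU
    · rw [hθb]; simpa using hV
  refine ⟨w * z, mul_mem hw hz, g, ?_, ?_⟩ <;> rw [this, H.map_mul_apply] <;> simp

theorem Reach.moves (h : Reach Ψ x y f (U, V)) :
    Reach Ψ x y f (U, V * U) ∧ Reach Ψ x y f (U, V * U⁻¹) ∧ Reach Ψ x y f (V⁻¹ * U, V) ∧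
      Reach Ψ x y f (V * U, V) := by
  let θ : F₂ →* F₂ := FreeGroup.lift fun i => if i then V else U
  have ha : θ genA = U := by simp [θ, genA]
  have hb : θ genB = V := by simp [θ, genB]
  have hx : x ∈ Subgroup.closure {x, y} := Subgroup.subset_closure (by simp)
  have hy : y ∈ Subgroup.closure {x, y} := Subgroup.subset_closure (by simp)
  have h1 := Reach.mul H h hx θ ha hb
  have h2 := Reach.mul H h (inv_mem hx) θ ha hb
  have h3 := Reach.mul H h hy θ ha hb
  have h4 := Reach.mul H h (inv_mem hy) θ ha hb
  rw [H.x_a, H.x_b, map_mul, ha, hb] at h1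
  rw [H.xinv_a, H.xinv_b, map_mul, map_inv, ha, hb] at h2
  rw [H.y_a, H.y_b, map_mul, map_inv, ha, hb] at h3
  rw [H.yinv_a, H.yinv_b, map_mul, ha, hb] at h4
  exact ⟨h1, h2, h3, h4⟩

/-- The quarter turn of the holed torus, needed because the reduction may stop at any of the four
rotations of the standard pair. -/
theorem Reach.rotate (h : Reach Ψ x y f (U, V)) : Reach Ψ x y f (V⁻¹, U) := by
  have h1 := (Reach.moves H h).2.2.1
  have h2 := (Reach.moves H h1).1
  rw [mul_inv_cancel_left] at h2
  have h3 := (Reach.moves H h2).2.2.1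
  have h4 := h3.conj U
  convert h4 using 2 <;> group

omit H in
theorem Reach.commutator (h : Reach Ψ x y f (U, V)) (H : IsTwistAction Ψ x y)
    (hf : f bdry = bdry) : ∃ g, V * U⁻¹ * V⁻¹ * U = g * bdry * g⁻¹ := by
  obtain ⟨w, hw, g, hU, hV⟩ := h
  refine ⟨g, ?_⟩
  simp only at hU hV
  rw [hU, hV]
  have h1 := congrArg f (H.map_bdry hw)
  rw [hf] at h1
  conv_rhs => rw [← h1]
  simp only [bdry, map_mul, map_inv]
  group

theorem exists_minimal_reach (f : F₂ →* F₂) (hf : f bdry = bdry) :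
    ∃ U V, Reach Ψ x y f (U, V) ∧ U.norm = 1 ∧ V.norm = 1 := by
  have h0 : ∃ p, Reach Ψ x y f p := ⟨(f genA, f genB), 1, one_mem _, 1, by simp [H.act_one], by simp [H.act_one]⟩
  obtain ⟨⟨U, V⟩, hR, hmin⟩ := (measure fun p : F₂ × F₂ => p.1.norm + p.2.norm).wf.has_min
    {p | Reach Ψ x y f p} h0
  have hmin' : ∀ U' V', Reach Ψ x y f (U', V') → U.norm + V.norm ≤ U'.norm + V'.norm :=
    fun U' V' h => not_lt.1 (hmin (U', V') h)
  refine ⟨U, V, hR, ?_⟩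
  obtain ⟨m1, m2, m3, m4⟩ := Reach.moves H hR
  have n1 := hmin' _ _ m1
  have n2 := hmin' _ _ m2
  have n3 := hmin' _ _ m3
  have n4 := hmin' _ _ m4
  -- A conjugation moves the new factor to the other side, which supplies the inequalities for the
  -- remaining products.
  have n5 : U.norm + V.norm ≤ U.norm + (U * V).norm := by
    have := hmin' _ _ (m1.conj U)
    convert this using 3 <;> group
  have n6 : U.norm + V.norm ≤ U.norm + (U⁻¹ * V).norm := by
    have := hmin' _ _ (m2.conj U⁻¹)
    convert this using 3 <;> group
  have n7 : U.norm + V.norm ≤ (U * V⁻¹).norm + V.norm := by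
    have := hmin' _ _ (m3.conj V)
    convert this using 3 <;> group
  have n8 : U.norm + V.norm ≤ (U * V).norm + V.norm := by
    have := hmin' _ _ (m4.conj V⁻¹)
    convert this using 3 <;> group
  obtain ⟨g, hg⟩ := hR.commutator H hf
  have e1 : (U⁻¹ * V⁻¹).norm = (V * U).norm := by rw [← mul_inv_rev, FreeGroup.norm_inv_eq]
  have e2 : (V * U⁻¹).norm = (U * V⁻¹).norm := by
    rw [← FreeGroup.norm_inv_eq (x := V * U⁻¹)]
    simp
  have e3 : (U⁻¹ * V).norm = (V⁻¹ * U).norm := by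
    rw [← FreeGroup.norm_inv_eq (x := U⁻¹ * V)]
    simp
  have hbd : bdry = FreeGroup.mk [(true, true), (false, false), (true, false), (false, true)] := by
    simp [bdry, genA, genB, FreeGroup.of, FreeGroup.invRev]
  -- `bdry` is the commutator of `genB` and `genA⁻¹`, which explains the pair `V`, `U⁻¹`.
  have := FreeWord.norm_eq_one_of_minimal (u := V) (v := U⁻¹) (g := g)
    (C := [(true, true), (false, false), (true, false), (false, true)])
    (by simp [FreeGroup.isCyclicallyReduced_iff, FreeGroup.IsReduced]) rfl
    (by rw [← hbd, ← hg, inv_inv])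
    (by omega) (by rw [FreeGroup.norm_inv_eq]; omega) (by omega)
    (by rw [FreeGroup.norm_inv_eq]; omega) (by omega)
    (by rw [FreeGroup.norm_inv_eq]; omega) (by rw [inv_inv]; omega)
    (by rw [inv_inv, FreeGroup.norm_inv_eq]; omega)
    (fun l => by
      have := hmin' _ _ (hR.conj (FreeGroup.mk [l])⁻¹)
      rw [inv_inv] at this
      have e4 : ((FreeGroup.mk [l])⁻¹ * U⁻¹ * FreeGroup.mk [l]).norm =
          ((FreeGroup.mk [l])⁻¹ * U * FreeGroup.mk [l]).norm := by
        rw [← FreeGroup.norm_inv_eq]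
        congr 1
        group
      rw [FreeGroup.norm_inv_eq, e4]
      omega)
  rw [FreeGroup.norm_inv_eq] at this
  exact this.symm

omit H in
theorem eq_gen_of_norm_eq_one {u : F₂} (h : u.norm = 1) :
    u = genA ∨ u = genA⁻¹ ∨ u = genB ∨ u = genB⁻¹ := by
  obtain ⟨l, hl⟩ := List.length_eq_one_iff.1 h
  rw [← FreeGroup.mk_toWord (x := u), hl]
  obtain ⟨i, e⟩ := l
  cases i <;> cases e <;> simp [genA, genB, FreeGroup.of, FreeGroup.invRev]

/-- The central Heisenberg coordinate of the commutator is the determinant of the pair in the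
abelianization. Among the sixteen pairs of letters it equals `1` only for the four rotations of
`(genA, genB)`, which quarter turns carry back to the standard pair. -/
theorem reach_gens (f : F₂ →* F₂) (hf : f bdry = bdry) : Reach Ψ x y f (genA, genB) := by
  obtain ⟨U, V, hR, hU, hV⟩ := H.exists_minimal_reach f hf
  obtain ⟨g, hg⟩ := hR.commutator H hf
  have hz : (heis (V * U⁻¹ * V⁻¹ * U)).center = 1 := by
    rw [hg, map_mul, map_mul, map_inv, heis_bdry]
    simp only [Heisenberg.mul_center, Heisenberg.mul_fst, Heisenberg.inv_center,
      Heisenberg.inv_snd]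
    ring
  have h1 := Reach.rotate H hR
  have h2 := Reach.rotate H h1
  have h3 := Reach.rotate H h2
  rcases eq_gen_of_norm_eq_one hU with rfl | rfl | rfl | rfl <;>
  rcases eq_gen_of_norm_eq_one hV with rfl | rfl | rfl | rfl <;>
  first
  | (exfalso; simp [heis_genA, heis_genB] at hz; done)
  | simpa using hR
  | simpa using h1
  | simpa using h2
  | simpa using h3

/-- Every endomorphism of the free group that fixes the boundary word is a product of twists. -/
theorem exists_eq (f : F₂ →* F₂) (hf : f bdry = bdry) :
    ∃ w ∈ Subgroup.closure {x, y}, Ψ w = f := by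
  obtain ⟨w, hw, g, ha, hb⟩ := H.reach_gens f hf
  simp only at ha hb
  have hcomp : f.comp (Ψ w) = conjHom g⁻¹ := by
    refine F₂.hom_ext ?_ ?_
    · conv_rhs => rw [ha]
      simp [mul_assoc]
    · conv_rhs => rw [hb]
      simp [mul_assoc]
  -- `f ∘ Ψ w` is an inner automorphism fixing the boundary word, hence conjugation by a power of
  -- that word, and this is a power of the boundary twist `(x * y) ^ 6`.
  have hfix : conjHom g⁻¹ bdry = bdry := by
    rw [← hcomp, MonoidHom.comp_apply, H.map_bdry hw, hf]
  have hcomm : Commute g bdry := by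
    have h : g⁻¹ * bdry * g = bdry := by simpa using hfix
    rw [mul_assoc, inv_mul_eq_iff_eq_mul] at h
    exact h.symm
  obtain ⟨k, rfl⟩ := exists_zpow_of_commute_bdry hcomm
  refine ⟨((x * y) ^ 6) ^ k * w⁻¹, mul_mem (zpow_mem (pow_mem (mul_mem
    (Subgroup.subset_closure (by simp)) (Subgroup.subset_closure (by simp))) 6) k) (inv_mem hw), ?_⟩
  refine MonoidHom.ext fun t => ?_
  have h1 := DFunLike.congr_fun hcomp (Ψ w⁻¹ t)
  rw [MonoidHom.comp_apply, ← H.map_mul_apply, mul_inv_cancel, H.act_one] at h1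
  rw [H.map_mul_apply, H.boundary_zpow]
  refine Eq.trans ?_ h1.symm
  simp

end IsTwistAction
end OneHoledTorus
end

noncomputable section
namespace OneHoledTorus

/-! ### Word lengths -/

/-- A letter as an element of the free group. -/
def letter (l : Bool × Bool) : F₂ := FreeGroup.mk [l]

/-- The inverse letter. -/
def bar (l : Bool × Bool) : Bool × Bool := (l.1, !l.2)

theorem letter_bar (l : Bool × Bool) : letter (bar l) = (letter l)⁻¹ := by
  simp [letter, bar, FreeGroup.invRev]

theorem letter_inv_mul_norm_of_head {l : Bool × Bool} {w : F₂} (h : w.toWord.head? = some l) :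
    ((letter l)⁻¹ * w).norm + 1 = w.norm := by
  obtain ⟨K, hK⟩ := List.head?_eq_some_iff.1 h
  have hr : FreeGroup.IsReduced (l :: K) := hK ▸ FreeGroup.isReduced_toWord
  have hw : w = letter l * FreeGroup.mk K := by
    rw [← FreeGroup.mk_toWord (x := w), hK, letter, FreeGroup.mul_mk]
    rfl
  rw [hw, inv_mul_cancel_left, ← hw, FreeWord.norm_mk_of_isReduced (hr.infix ⟨[l], [], by simp⟩),
    FreeGroup.norm, hK, List.length_cons]

theorem letter_inv_mul_norm_of_ne {l : Bool × Bool} {w : F₂} (h : w.toWord.head? ≠ some l) :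
    ((letter l)⁻¹ * w).norm = w.norm + 1 := by
  have hl : (letter l).toWord = [] ++ [l] := by
    simp [letter, FreeGroup.toWord_mk]
  have := FreeWord.norm_inv_mul (x := letter l) (y := w) (P := []) (A := [l]) (B := w.toWord) hl
    (by simp) (by
      intro a ha b hb hab
      apply h
      rw [Option.mem_def.1 hb, ← hab]
      simpa [eq_comm] using ha)
  rw [this, FreeGroup.norm]
  simp [add_comm]

/-- The distance in the Cayley tree. -/
def wdist (g h : F₂) : ℝ := ((g⁻¹ * h).norm : ℝ)

theorem wdist_mul_left (k g h : F₂) : wdist (k * g) (k * h) = wdist g h := by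
  unfold wdist
  congr 2
  group

theorem wdist_self (g : F₂) : wdist g g = 0 := by simp [wdist]

theorem wdist_step (g h : F₂) (l : Bool × Bool) :
    ((g⁻¹ * h).toWord.head? = some l ∧ wdist (g * letter l) h = wdist g h - 1) ∨
      ((g⁻¹ * h).toWord.head? ≠ some l ∧ wdist (g * letter l) h = wdist g h + 1) := by
  unfold wdist
  have e : (g * letter l)⁻¹ * h = (letter l)⁻¹ * (g⁻¹ * h) := by group
  rw [e]
  by_cases hh : (g⁻¹ * h).toWord.head? = some l
  · refine Or.inl ⟨hh, ?_⟩
    rw [← letter_inv_mul_norm_of_head hh]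
    push_cast
    ring
  · refine Or.inr ⟨hh, ?_⟩
    rw [letter_inv_mul_norm_of_ne hh]
    push_cast
    ring

/-- Half the derivative of the squared distance to `h` along the edge from `g` in direction `l`,
shifted so that the barycentre sits where it is `0`. -/
def slope (g : F₂) (l : Bool × Bool) (h : F₂) : ℝ :=
  wdist g h * (wdist g h - wdist (g * letter l) h)

/-- The slope is the distance `d` to `h` if `l` points towards `h` and `-d` otherwise; crossing the
edge reverses the sign and changes `d` by one. -/
theorem slope_add_reverse (g : F₂) (l : Bool × Bool) (h : F₂) :
    slope g l h + slope (g * letter l) (bar l) h = 1 := by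
  unfold slope
  rw [letter_bar, mul_inv_cancel_right]
  rcases wdist_step g h l with ⟨-, e⟩ | ⟨-, e⟩ <;> rw [e] <;> ring

/-- At most one direction at a vertex leads towards `h`, and all slopes there have the same absolute
value. -/
theorem slope_add_le (g : F₂) {l m : Bool × Bool} (hlm : l ≠ m) (h : F₂) :
    slope g l h + slope g m h ≤ 0 := by
  have h0 : 0 ≤ wdist g h := Nat.cast_nonneg _
  unfold slope
  rcases wdist_step g h l with ⟨a, e⟩ | ⟨-, e⟩ <;> rcases wdist_step g h m with ⟨a', e'⟩ | ⟨-, e'⟩ <;>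
    rw [e, e']
  · exact absurd (Option.some_injective _ (a.symm.trans a')) hlm
  all_goals nlinarith

theorem slope_mul_left (k g : F₂) (l : Bool × Bool) (h : F₂) :
    slope (k * g) l (k * h) = slope g l h := by
  unfold slope
  rw [wdist_mul_left, mul_assoc, wdist_mul_left]

theorem slope_self (g : F₂) (l : Bool × Bool) : slope g l g = 0 := by
  simp [slope, wdist_self]

theorem slope_next (g : F₂) (l : Bool × Bool) : slope g l (g * letter l) = 1 := by
  have := slope_add_reverse g l (g * letter l)
  rwa [slope_self, add_zero] at this

/-! ### The Cayley tree -/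

/-- The point at distance `s` on the edge from `g` in direction `l`, in barycentric coordinates. -/
def edgePoint (g : F₂) (l : Bool × Bool) (s : ℝ) : F₂ → ℝ := fun k =>
  (if k = g then 1 - s else 0) + if k = g * letter l then s else 0

/-- The Cayley tree of the free group, in barycentric coordinates. -/
structure Tree where
  /-- The barycentric coordinates. -/
  toFun : F₂ → ℝ
  mem : ∃ g l s, s ∈ Set.Icc (0 : ℝ) 1 ∧ toFun = edgePoint g l s

instance : TopologicalSpace Tree := .induced Tree.toFun inferInstance

theorem letter_ne_one (l : Bool × Bool) : letter l ≠ 1 := by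
  intro h
  have := congrArg FreeGroup.norm h
  simp [letter, FreeGroup.norm, FreeGroup.toWord_mk] at this

theorem mul_letter_ne (g : F₂) (l : Bool × Bool) : g * letter l ≠ g := by
  simpa using letter_ne_one l

theorem edgePoint_reverse (g : F₂) (l : Bool × Bool) (s : ℝ) :
    edgePoint g l s = edgePoint (g * letter l) (bar l) (1 - s) := by
  funext k
  simp only [edgePoint, letter_bar, mul_inv_cancel_right, sub_sub_cancel]
  ring

theorem edgePoint_self (g : F₂) (l : Bool × Bool) (s : ℝ) : edgePoint g l s g = 1 - s := by
  simp [edgePoint, (mul_letter_ne g l).symm]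

theorem edgePoint_next (g : F₂) (l : Bool × Bool) (s : ℝ) :
    edgePoint g l s (g * letter l) = s := by
  simp [edgePoint, mul_letter_ne g l]

theorem edgePoint_ne {g k : F₂} {l : Bool × Bool} {s : ℝ} (h : k ≠ g) (h' : k ≠ g * letter l) :
    edgePoint g l s k = 0 := by
  simp [edgePoint, h, h']

theorem edgePoint_zero (g : F₂) (l m : Bool × Bool) : edgePoint g l 0 = edgePoint g m 0 := by
  funext k
  simp [edgePoint]

/-- Cut off to the unit interval. -/
def clamp (r : ℝ) : ℝ := max 0 (min 1 r)

theorem clamp_of_nonpos {r : ℝ} (h : r ≤ 0) : clamp r = 0 := by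
  unfold clamp
  rw [min_eq_right (by linarith), max_eq_left h]

theorem clamp_of_one_le {r : ℝ} (h : 1 ≤ r) : clamp r = 1 := by
  unfold clamp
  rw [min_eq_left h, max_eq_right (by norm_num)]

theorem clamp_of_mem {r : ℝ} (h : r ∈ Set.Icc (0 : ℝ) 1) : clamp r = r := by
  unfold clamp
  rw [min_eq_right h.2, max_eq_right h.1]

theorem clamp_mem (r : ℝ) : clamp r ∈ Set.Icc (0 : ℝ) 1 :=
  ⟨le_max_left _ _, max_le (by norm_num) (min_le_left _ _)⟩

theorem clamp_one_sub (r : ℝ) : clamp (1 - r) = 1 - clamp r := by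
  rcases le_total r 0 with h | h
  · rw [clamp_of_nonpos h, clamp_of_one_le (by linarith), sub_zero]
  · rcases le_total r 1 with h' | h'
    · rw [clamp_of_mem ⟨h, h'⟩, clamp_of_mem ⟨by linarith, by linarith⟩]
    · rw [clamp_of_one_le h', clamp_of_nonpos (by linarith), sub_self]

theorem continuous_clamp : Continuous clamp := by
  unfold clamp
  fun_prop

/-- A system of slopes on the oriented edges that is convex along the tree. -/
structure IsConvexSlope (B : F₂ → Bool × Bool → ℝ) : Prop where
  reverse : ∀ g l, B g l + B (g * letter l) (bar l) = 1
  add_le : ∀ g l m, l ≠ m → B g l + B g m ≤ 0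

/-- The point of the tree determined by a system of slopes. -/
def slopePoint (B : F₂ → Bool × Bool → ℝ) : F₂ → ℝ := fun g => 1 - ∑ l, clamp (B g l)

/-! ### The minimum point of a convex system of slopes -/

namespace IsConvexSlope

variable {B : F₂ → Bool × Bool → ℝ} (hB : IsConvexSlope B)
include hB

omit hB in
theorem sum_clamp {g : F₂} {l : Bool × Bool} (h : ∀ m, m ≠ l → B g m ≤ 0) :
    ∑ m, clamp (B g m) = clamp (B g l) :=
  Finset.sum_eq_single l (fun m _ hm => clamp_of_nonpos (h m hm)) (by simp)

theorem others_nonpos {g : F₂} {l : Bool × Bool} (h : 0 ≤ B g l) (m : Bool × Bool) (hm : m ≠ l) :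
    B g m ≤ 0 := by
  linarith [hB.add_le g m l hm]

theorem next_nonneg {g : F₂} {l : Bool × Bool} (h : B g l ≤ 1) : 0 ≤ B (g * letter l) (bar l) := by
  linarith [hB.reverse g l]

theorem next_ge_one {g : F₂} {l : Bool × Bool} (h : B g l ≤ 0) : 1 ≤ B (g * letter l) (bar l) := by
  linarith [hB.reverse g l]

/-- A nonnegative slope backwards makes all other slopes at that vertex nonpositive, so after one
more step the slope backwards is at least `1`. Vertices off the edge `l` thus point back with full
weight and get coordinate zero in `slopePoint`. -/
theorem path {g : F₂} {l : Bool × Bool} (h1 : B g l ≤ 1) (h0 : ∀ m, m ≠ l → B g m ≤ 0)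
    (L : List (Bool × Bool)) : ∀ p, FreeGroup.IsReduced (L ++ [p]) →
      0 ≤ B (g * FreeGroup.mk (L ++ [p])) (bar p) ∧
        (L ++ [p] ≠ [l] → 1 ≤ B (g * FreeGroup.mk (L ++ [p])) (bar p)) := by
  have hmk : ∀ (K : List (Bool × Bool)) p,
      g * FreeGroup.mk (K ++ [p]) = g * FreeGroup.mk K * letter p := by
    intro K p
    rw [letter, mul_assoc, FreeGroup.mul_mk]
  induction L using List.reverseRecOn with
  | nil =>
    intro p _
    have e : g * FreeGroup.mk ([] ++ [p]) = g * letter p := rfl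
    rw [e]
    by_cases hp : p = l
    · subst hp
      exact ⟨hB.next_nonneg h1, fun h => absurd rfl h⟩
    · have := hB.next_ge_one (h0 p hp)
      exact ⟨by linarith, fun _ => this⟩
  | append_singleton L q ih =>
    intro p hp
    have hq := (ih q (hp.infix ⟨[], [p], by simp⟩)).1
    have hpq : p ≠ bar q := by
      rintro rfl
      have := hp.infix (L₁ := [q, bar q]) ⟨L, [], by simp⟩
      simp [FreeGroup.IsReduced, bar] at this
    have := hB.next_ge_one (hB.others_nonpos hq p hpq)
    rw [hmk]
    exact ⟨by linarith, fun _ => this⟩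

theorem slopePoint_eq {g : F₂} {l : Bool × Bool} (h1 : B g l ≤ 1) (h0 : ∀ m, m ≠ l → B g m ≤ 0) :
    slopePoint B = edgePoint g l (clamp (B g l)) := by
  funext k
  by_cases hk : k = g
  · subst hk
    rw [edgePoint_self, slopePoint, sum_clamp h0]
  by_cases hk' : k = g * letter l
  · subst hk'
    have := hB.next_nonneg h1
    rw [edgePoint_next, slopePoint, sum_clamp (hB.others_nonpos this),
      show B (g * letter l) (bar l) = 1 - B g l by linarith [hB.reverse g l], clamp_one_sub]
    ring
  rw [edgePoint_ne hk hk', slopePoint]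
  have hw : (g⁻¹ * k).toWord ≠ [] := by
    rw [Ne, FreeGroup.toWord_eq_nil_iff, inv_mul_eq_one]
    exact Ne.symm hk
  obtain ⟨L, p, hLp⟩ := (List.eq_nil_or_concat _).resolve_left hw
  rw [List.concat_eq_append] at hLp
  have hkL : g * FreeGroup.mk (L ++ [p]) = k := by
    rw [← hLp, FreeGroup.mk_toWord, mul_inv_cancel_left]
  have h := (hB.path h1 h0 L p (hLp ▸ FreeGroup.isReduced_toWord)).2 (by
    intro e
    apply hk'
    rw [← hkL, e, letter])
  rw [hkL] at h
  rw [sum_clamp (hB.others_nonpos (by linarith)), clamp_of_one_le h, sub_self]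

/-- Walk in directions of slope greater than `1 / 2`. As the two slopes of an edge sum to `1`, the
walk never turns back, and convexity lowers the slope by at least one at each step, so it stops. -/
theorem exists_good : ∃ g, ∀ l, B g l ≤ 1 / 2 := by
  by_contra! hcon
  have key : ∀ (n : ℕ) g l, B g l ≤ n → B g l ≤ 1 / 2 := by
    intro n
    induction n with
    | zero => intro g l h; push_cast at h; linarith
    | succ n ih =>
      intro g l h
      by_contra! hlt
      obtain ⟨m, hm⟩ := hcon (g * letter l)
      have h1 := hB.reverse g l
      have hne : m ≠ bar l := by rintro rfl; linarith
      have h2 := hB.add_le (g * letter l) m (bar l) hne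
      have := ih (g * letter l) m (by push_cast at h; linarith)
      linarith
  obtain ⟨m, hm⟩ := hcon 1
  obtain ⟨n, hn⟩ := exists_nat_ge (B 1 m)
  linarith [key n 1 m hn]

theorem slopePoint_mem : ∃ g l s, s ∈ Set.Icc (0 : ℝ) 1 ∧ slopePoint B = edgePoint g l s := by
  obtain ⟨g, hg⟩ := hB.exists_good
  by_cases h : ∃ l, 0 < B g l
  · obtain ⟨l, hl⟩ := h
    exact ⟨g, l, _, clamp_mem _, hB.slopePoint_eq (by linarith [hg l]) (hB.others_nonpos hl.le)⟩
  · push Not at h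
    exact ⟨g, (false, false), _, clamp_mem _,
      hB.slopePoint_eq (by linarith [hg (false, false)]) fun m _ => h m⟩

end IsConvexSlope

/-! ### Topology, group action and geodesics of the tree -/

namespace Tree

instance : CoeFun Tree fun _ => F₂ → ℝ := ⟨Tree.toFun⟩

theorem ext {β γ : Tree} (h : ∀ k, β k = γ k) : β = γ := by
  cases β
  cases γ
  congr
  exact funext h

theorem continuous_coord (k : F₂) : Continuous fun β : Tree => β k :=
  (continuous_apply k).comp continuous_induced_dom

theorem continuous_of_coord {X : Type*} [TopologicalSpace X] {f : X → Tree}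
    (h : ∀ k, Continuous fun x => f x k) : Continuous f :=
  continuous_induced_rng.2 (continuous_pi h)

/-- A point on an edge. -/
def edge (g : F₂) (l : Bool × Bool) (s : ℝ) (hs : s ∈ Set.Icc (0 : ℝ) 1) : Tree :=
  ⟨edgePoint g l s, g, l, s, hs, rfl⟩

theorem exists_edge (β : Tree) : ∃ g l s hs, β = edge g l s hs := by
  obtain ⟨_, g, l, s, hs, rfl⟩ := β
  exact ⟨g, l, s, hs, rfl⟩

theorem edge_reverse (g : F₂) (l : Bool × Bool) (s : ℝ) (hs : s ∈ Set.Icc (0 : ℝ) 1) :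
    edge g l s hs = edge (g * letter l) (bar l) (1 - s) ⟨by linarith [hs.2], by linarith [hs.1]⟩ :=
  ext fun k => congrFun (edgePoint_reverse g l s) k

instance : MulAction F₂ Tree where
  smul g β := ⟨fun k => β (g⁻¹ * k), by
    obtain ⟨_, h, l, s, hs, rfl⟩ := β
    refine ⟨g * h, l, s, hs, ?_⟩
    funext k
    simp only [edgePoint, inv_mul_eq_iff_eq_mul, mul_assoc]⟩
  one_smul β := ext fun k => congrArg β.toFun (by simp)
  mul_smul g h β := ext fun k => congrArg β.toFun (by group)

theorem smul_coord (g : F₂) (β : Tree) (k : F₂) : (g • β) k = β (g⁻¹ * k) := rfl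

theorem smul_edge (g h : F₂) (l : Bool × Bool) (s : ℝ) (hs : s ∈ Set.Icc (0 : ℝ) 1) :
    g • edge h l s hs = edge (g * h) l s hs := by
  refine ext fun k => ?_
  rw [smul_coord]
  simp only [edge, edgePoint, inv_mul_eq_iff_eq_mul, mul_assoc]

instance : ContinuousConstSMul F₂ Tree :=
  ⟨fun g => continuous_of_coord fun k => continuous_coord (g⁻¹ * k)⟩

/-- The vertices adjacent or equal to `g`. -/
def star (g : F₂) : Finset F₂ := insert g (Finset.univ.image fun l => g * letter l)

theorem self_mem_star (g : F₂) : g ∈ star g := Finset.mem_insert_self _ _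

theorem next_mem_star (g : F₂) (l : Bool × Bool) : g * letter l ∈ star g :=
  Finset.mem_insert_of_mem (Finset.mem_image_of_mem _ (Finset.mem_univ l))

theorem prev_mem_star (g : F₂) (l : Bool × Bool) : g ∈ star (g * letter l) := by
  have := next_mem_star (g * letter l) (bar l)
  rwa [letter_bar, mul_inv_cancel_right] at this

theorem eq_zero_of_notMem_star {β : Tree} {g k : F₂} (hg : β g ≠ 0) (hk : k ∉ star g) : β k = 0 := by
  obtain ⟨h, l, s, hs, rfl⟩ := β.exists_edge
  by_contra hk0
  have hg' : g = h ∨ g = h * letter l := by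
    by_contra! hne
    exact hg (edgePoint_ne hne.1 hne.2)
  have hk' : k = h ∨ k = h * letter l := by
    by_contra! hne
    exact hk0 (edgePoint_ne hne.1 hne.2)
  rcases hg' with rfl | rfl <;> rcases hk' with rfl | rfl
  exacts [hk (self_mem_star _), hk (next_mem_star _ _), hk (prev_mem_star _ _),
    hk (self_mem_star _)]

/-- The affine extension of a function on the vertices. -/
def eval (φ : F₂ → ℝ) (β : Tree) : ℝ := ∑ᶠ k, β k * φ k

theorem eval_eq_sum {φ : F₂ → ℝ} {β : Tree} {g : F₂} (hg : β g ≠ 0) :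
    eval φ β = ∑ k ∈ star g, β k * φ k := by
  refine finsum_eq_sum_of_support_subset _ fun k hk => ?_
  by_contra h
  exact hk (by change β k * φ k = 0; rw [eq_zero_of_notMem_star hg h, zero_mul])

theorem eval_edge (φ : F₂ → ℝ) (g : F₂) (l : Bool × Bool) (s : ℝ) (hs : s ∈ Set.Icc (0 : ℝ) 1) :
    eval φ (edge g l s hs) = (1 - s) * φ g + s * φ (g * letter l) := by
  have : eval φ (edge g l s hs) = ∑ k ∈ {g, g * letter l}, edgePoint g l s k * φ k := by
    refine finsum_eq_sum_of_support_subset _ fun k hk => ?_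
    by_contra h
    have h' : k ≠ g ∧ k ≠ g * letter l := by simpa using h
    exact hk (by
      change edgePoint g l s k * φ k = 0
      rw [edgePoint_ne h'.1 h'.2, zero_mul])
  rw [this, Finset.sum_pair (mul_letter_ne g l).symm, edgePoint_self, edgePoint_next]

theorem exists_coord_ne_zero (β : Tree) : ∃ g, β g ≠ 0 := by
  obtain ⟨g, l, s, hs, rfl⟩ := β.exists_edge
  by_cases h : s = 0
  · exact ⟨g, by change edgePoint g l s g ≠ 0; rw [edgePoint_self, h]; norm_num⟩
  · exact ⟨g * letter l, by change edgePoint g l s _ ≠ 0; rwa [edgePoint_next]⟩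

/-- Near a point with nonzero coordinate at `g`, all points are supported on the star of `g`; there
the evaluation is one fixed finite sum. -/
theorem continuous_eval (φ : F₂ → ℝ) : Continuous (eval φ) := by
  rw [continuous_iff_continuousAt]
  intro β
  obtain ⟨g, hg⟩ := β.exists_coord_ne_zero
  have h1 : ContinuousAt (fun γ : Tree => ∑ k ∈ star g, γ k * φ k) β :=
    (continuous_finsetSum _ fun k _ => (continuous_coord k).mul continuous_const).continuousAt
  refine h1.congr ?_
  filter_upwards [(continuous_coord g).continuousAt.eventually_ne hg] with γ hγ
  exact (eval_eq_sum hγ).symm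

/-- The slopes of the squared distance to a point of the tree. -/
def slopes (β : Tree) (g : F₂) (l : Bool × Bool) : ℝ := eval (slope g l) β

theorem isConvexSlope_slopes (β : Tree) : IsConvexSlope β.slopes := by
  obtain ⟨h, m, s, hs, rfl⟩ := β.exists_edge
  constructor
  · intro g l
    simp only [slopes, eval_edge]
    have h1 := slope_add_reverse g l h
    have h2 := slope_add_reverse g l (h * letter m)
    linear_combination (1 - s) * h1 + s * h2
  · intro g l l' hl
    simp only [slopes, eval_edge]
    have h1 := slope_add_le g hl h
    have h2 := slope_add_le g hl (h * letter m)
    nlinarith [hs.1, hs.2]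

/-- On the edge containing `β` the slope is exactly the parameter of `β`, so the minimum point of
its own slopes is `β`. -/
theorem slopePoint_slopes (β : Tree) : slopePoint β.slopes = β.toFun := by
  obtain ⟨g, l, s, hs, rfl⟩ := β.exists_edge
  have h : (edge g l s hs).slopes g l = s := by
    simp [slopes, eval_edge, slope_self, slope_next]
  rw [(isConvexSlope_slopes _).slopePoint_eq (g := g) (l := l) (by rw [h]; exact hs.2)
    ((isConvexSlope_slopes _).others_nonpos (by rw [h]; exact hs.1)), h, clamp_of_mem hs]
  rfl

theorem slopes_smul (k : F₂) (β : Tree) (g : F₂) (l : Bool × Bool) :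
    (k • β).slopes (k * g) l = β.slopes g l := by
  obtain ⟨h, m, s, hs, rfl⟩ := β.exists_edge
  rw [smul_edge]
  simp only [slopes, eval_edge]
  rw [slope_mul_left, mul_assoc k h, slope_mul_left]

theorem isConvexSlope_combine {B C : F₂ → Bool × Bool → ℝ} (hB : IsConvexSlope B)
    (hC : IsConvexSlope C) {t : ℝ} (ht : t ∈ Set.Icc (0 : ℝ) 1) :
    IsConvexSlope fun g l => (1 - t) * B g l + t * C g l := by
  constructor
  · intro g l
    linear_combination (1 - t) * hB.reverse g l + t * hC.reverse g l
  · intro g l m h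
    nlinarith [hB.add_le g l m h, hC.add_le g l m h, ht.1, ht.2]

/-- The point that divides the geodesic from `β` to `γ` in the ratio `t`. -/
def geodesic (t : unitInterval) (β γ : Tree) : Tree :=
  -- Averaging slopes instead of points stays inside the tree: the average is again convex, and its
  -- minimum point depends continuously and equivariantly on the data.
  ⟨slopePoint fun g l => (1 - (t : ℝ)) * β.slopes g l + t * γ.slopes g l,
    (isConvexSlope_combine β.isConvexSlope_slopes γ.isConvexSlope_slopes t.2).slopePoint_mem⟩

theorem continuous_geodesic :
    Continuous fun q : unitInterval × Tree × Tree => geodesic q.1 q.2.1 q.2.2 := by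
  refine continuous_of_coord fun k => ?_
  have h := fun l => continuous_eval (slope k l)
  have := continuous_clamp
  change Continuous fun q : unitInterval × Tree × Tree => 1 - ∑ l, clamp
    ((1 - (q.1 : ℝ)) * eval (slope k l) q.2.1 + q.1 * eval (slope k l) q.2.2)
  refine continuous_const.sub (continuous_finsetSum _ fun l _ => ?_)
  have := h l
  fun_prop

theorem geodesic_zero (β γ : Tree) : geodesic 0 β γ = β := by
  refine ext fun k => ?_
  rw [← slopePoint_slopes β]
  simp [geodesic]

theorem geodesic_one (β γ : Tree) : geodesic 1 β γ = γ := by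
  refine ext fun k => ?_
  conv_rhs => rw [← slopePoint_slopes γ]
  simp [geodesic]

theorem geodesic_self (t : unitInterval) (β : Tree) : geodesic t β β = β := by
  refine ext fun k => ?_
  conv_rhs => rw [← slopePoint_slopes β]
  have : (fun g l => (1 - (t : ℝ)) * β.slopes g l + t * β.slopes g l) = β.slopes := by
    funext g l
    ring
  simp only [geodesic, this]

theorem geodesic_smul (k : F₂) (t : unitInterval) (β γ : Tree) :
    geodesic t (k • β) (k • γ) = k • geodesic t β γ := by
  refine ext fun g => ?_
  rw [smul_coord]
  simp only [geodesic, slopePoint]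
  have h : ∀ (δ : Tree) l, (k • δ).slopes g l = δ.slopes (k⁻¹ * g) l := by
    intro δ l
    rw [← slopes_smul k δ, mul_inv_cancel_left]
  simp only [h]

instance : Nonempty Tree := ⟨edge 1 (false, false) 0 ⟨le_rfl, zero_le_one⟩⟩

attribute [irreducible] geodesic

/-- Contraction of the tree to a point. -/
def contraction (β : Tree) :
    (ContinuousMap.id Tree).Homotopy (ContinuousMap.const Tree β) where
  toFun q := geodesic q.1 q.2 β
  continuous_toFun := continuous_geodesic.comp
    (continuous_fst.prodMk (continuous_snd.prodMk continuous_const))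
  map_zero_left γ := geodesic_zero γ β
  map_one_left γ := geodesic_one γ β

instance : ContractibleSpace Tree :=
  (contractible_iff_id_nullhomotopic Tree).2 ⟨Classical.arbitrary Tree, ⟨contraction _⟩⟩

end Tree
end OneHoledTorus
end

noncomputable section
namespace OneHoledTorus

/-! ### Radial scaling -/

/-- The sup norm in the plane. -/
def supNorm (w : ℂ) : ℝ := max |w.re| |w.im|

theorem supNorm_le_norm (w : ℂ) : supNorm w ≤ ‖w‖ :=
  max_le (Complex.abs_re_le_norm w) (Complex.abs_im_le_norm w)

theorem norm_le_two_mul_supNorm (w : ℂ) : ‖w‖ ≤ 2 * supNorm w := by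
  have := Complex.norm_le_abs_re_add_abs_im w
  have h1 : |w.re| ≤ supNorm w := le_max_left _ _
  have h2 : |w.im| ≤ supNorm w := le_max_right _ _
  linarith

theorem supNorm_mul (k : ℝ) (w : ℂ) : supNorm (k * w) = |k| * supNorm w := by
  simp [supNorm, abs_mul, mul_max_of_nonneg]

theorem supNorm_toComplex (p : Torus) : supNorm (toComplex p) = ‖p‖ := by
  rw [Prod.norm_def, norm_eq_abs_coord, norm_eq_abs_coord]
  rfl

theorem norm_le_half (p : Torus) : ‖p‖ ≤ 1 / 2 := by
  rw [← supNorm_toComplex]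
  exact max_le (abs_le.2 ⟨by have := coord_mem p.1; simpa [toComplex] using by linarith,
    by have := coord_mem p.1; simpa [toComplex] using by linarith⟩)
    (abs_le.2 ⟨by have := coord_mem p.2; simpa [toComplex] using by linarith,
    by have := coord_mem p.2; simpa [toComplex] using by linarith⟩)

theorem norm_coe_circle {r : ℝ} (h : |r| ≤ 1 / 2) : ‖(r : UnitAddCircle)‖ = |r| :=
  (AddCircle.norm_coe_eq_abs_iff 1 one_ne_zero).2 (by simpa using h)

theorem norm_ofComplex {w : ℂ} (h : supNorm w ≤ 1 / 2) : ‖ofComplex w‖ = supNorm w := by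
  rw [Prod.norm_def, ofComplex, norm_coe_circle ((le_max_left _ _).trans h),
    norm_coe_circle ((le_max_right _ _).trans h), supNorm]

theorem radius_ofComplex {w : ℂ} (h : supNorm w ≤ 1 / 2) : radius (ofComplex w) = ‖w‖ := by
  rw [radius, ofComplex, norm_coe_circle ((le_max_left _ _).trans h),
    norm_coe_circle ((le_max_right _ _).trans h), Complex.norm_eq_sqrt_sq_add_sq, sq_abs, sq_abs]

theorem toComplex_ofComplex' {w : ℂ} (h : supNorm w < 1 / 2) : toComplex (ofComplex w) = w :=
  Complex.ext (coord_coe ((le_max_left _ _).trans_lt h)) (coord_coe ((le_max_right _ _).trans_lt h))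

theorem norm_le_radius (p : Torus) : ‖p‖ ≤ radius p := by
  rw [radius_eq, ← supNorm_toComplex]
  exact supNorm_le_norm _

theorem radius_le_two_mul_norm (p : Torus) : radius p ≤ 2 * ‖p‖ := by
  rw [radius_eq, ← supNorm_toComplex]
  exact norm_le_two_mul_supNorm _

/-- Scaling towards or away from the origin in the fundamental square. -/
def scale (k : ℝ) (p : Torus) : Torus := ofComplex (k * toComplex p)

theorem scale_one (p : Torus) : scale 1 p = p := by
  rw [scale, Complex.ofReal_one, one_mul, ofComplex_toComplex]

theorem scale_ofComplex {k : ℝ} {w : ℂ} (h : supNorm w ≤ 1 / 2) (hk : supNorm w = 1 / 2 → k = 1) :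
    scale k (ofComplex w) = ofComplex (k * w) := by
  rcases h.lt_or_eq with h | h
  · rw [scale, toComplex_ofComplex' h]
  · rw [hk h, scale_one, Complex.ofReal_one, one_mul]

theorem continuous_ofComplex : Continuous ofComplex :=
  ((AddCircle.continuous_mk' 1).comp Complex.continuous_re).prodMk
    ((AddCircle.continuous_mk' 1).comp Complex.continuous_im)

theorem ofComplex_add (w z : ℂ) : ofComplex (w + z) = ofComplex w + ofComplex z := by
  simp [ofComplex]

theorem continuousAt_toComplex {p : Torus} (h : ‖p‖ < 1 / 2) : ContinuousAt toComplex p := by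
  have h1 : ContinuousAt (fun q : Torus => coord q.1) p :=
    ContinuousAt.comp (f := Prod.fst)
      (continuousAt_coord ((le_max_left _ _).trans_lt h)) continuousAt_fst
  have h2 : ContinuousAt (fun q : Torus => coord q.2) p :=
    ContinuousAt.comp (f := Prod.snd)
      (continuousAt_coord ((le_max_right _ _).trans_lt h)) continuousAt_snd
  have e : toComplex = fun q : Torus => (coord q.1 : ℂ) + (coord q.2 : ℂ) * Complex.I := by
    funext q
    exact Complex.mk_eq_add_mul_I _ _
  rw [e]
  exact (Complex.continuous_ofReal.continuousAt.comp h1).add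
    ((Complex.continuous_ofReal.continuousAt.comp h2).mul continuousAt_const)

theorem norm_toComplex_le (p : Torus) : ‖toComplex p‖ ≤ 1 := by
  rw [← radius_eq]
  linarith [radius_le_two_mul_norm p, norm_le_half p]

/-- `toComplex` is bounded, and its only possible discontinuities lie on the edge of the square,
where the factor `k` vanishes. -/
theorem continuous_mul_toComplex {X : Type*} [TopologicalSpace X] {k : X → ℝ} {f : X → Torus}
    (hk : Continuous k) (hf : Continuous f) (h : ∀ q, ‖f q‖ = 1 / 2 → k q = 0) :
    Continuous fun q => (k q : ℂ) * toComplex (f q) := by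
  refine continuous_iff_continuousAt.2 fun q => ?_
  rcases (norm_le_half (f q)).lt_or_eq with hq | hq
  · exact (Complex.continuous_ofReal.comp hk).continuousAt.mul
      (ContinuousAt.comp (f := f) (continuousAt_toComplex hq) hf.continuousAt)
  · rw [ContinuousAt, h q hq, Complex.ofReal_zero, zero_mul]
    refine squeeze_zero_norm (a := fun x => |k x|) (fun x => ?_) ?_
    · rw [norm_mul, Complex.norm_real, Real.norm_eq_abs]
      exact mul_le_of_le_one_right (abs_nonneg _) (norm_toComplex_le _)
    · have := hk.abs.tendsto q
      rwa [h q hq, abs_zero] at this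

/-- Write the scaled point as `f` plus the projection of `(k - 1)` times its planar representative;
the correction vanishes where opposite sides of the square are glued. -/
theorem continuous_scale {X : Type*} [TopologicalSpace X] {k : X → ℝ} {f : X → Torus}
    (hk : Continuous k) (hf : Continuous f) (h : ∀ q, ‖f q‖ = 1 / 2 → k q = 1) :
    Continuous fun q => scale (k q) (f q) := by
  have e : (fun q => scale (k q) (f q)) = fun q =>
      f q + ofComplex (((k q - 1 : ℝ) : ℂ) * toComplex (f q)) := by
    funext q
    have h1 : (k q : ℂ) * toComplex (f q) =
        toComplex (f q) + ((k q - 1 : ℝ) : ℂ) * toComplex (f q) := by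
      push_cast
      ring
    rw [scale, h1, ofComplex_add, ofComplex_toComplex]
  rw [e]
  exact hf.add (continuous_ofComplex.comp (continuous_mul_toComplex (hk.sub continuous_const) hf
    fun q hq => by rw [h q hq, sub_self]))

theorem radius_scale {k : ℝ} {p : Torus} (h0 : 0 ≤ k) (h : k * ‖p‖ ≤ 1 / 2) :
    radius (scale k p) = k * radius p := by
  rw [scale, radius_ofComplex (by rwa [supNorm_mul, abs_of_nonneg h0, supNorm_toComplex]),
    norm_mul, Complex.norm_real, Real.norm_of_nonneg h0, radius_eq]

theorem norm_scale {k : ℝ} {p : Torus} (h0 : 0 ≤ k) (h : k * ‖p‖ ≤ 1 / 2) :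
    ‖scale k p‖ = k * ‖p‖ := by
  rw [scale, norm_ofComplex (by rwa [supNorm_mul, abs_of_nonneg h0, supNorm_toComplex]),
    supNorm_mul, abs_of_nonneg h0, supNorm_toComplex]

theorem Surface.norm_pos (p : Surface) : 0 < ‖p.1‖ := by
  linarith [p.2, radius_le_two_mul_norm p.1]

/-- The scaling factor of the deformation retraction onto the boundary of the square. -/
def pushFactor (u : ℝ) (p : Torus) : ℝ := 1 - u + u * (1 / (2 * ‖p‖))

theorem pushFactor_ge_one {u : ℝ} (hu : u ∈ Set.Icc (0 : ℝ) 1) (p : Surface) :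
    1 ≤ pushFactor u p.1 := by
  have hp := p.norm_pos
  have : 1 ≤ 1 / (2 * ‖p.1‖) := by
    rw [le_div_iff₀ (by linarith)]
    linarith [norm_le_half p.1]
  unfold pushFactor
  nlinarith [hu.1, hu.2]

theorem pushFactor_mul_norm (u : ℝ) (p : Surface) :
    pushFactor u p.1 * ‖p.1‖ = (1 - u) * ‖p.1‖ + u * (1 / 2) := by
  have hp := p.norm_pos
  unfold pushFactor
  field_simp

theorem pushFactor_mul_norm_le {u : ℝ} (hu : u ∈ Set.Icc (0 : ℝ) 1) (p : Surface) :
    pushFactor u p.1 * ‖p.1‖ ≤ 1 / 2 := by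
  rw [pushFactor_mul_norm]
  nlinarith [hu.1, hu.2, norm_le_half p.1]

/-- The deformation retraction of the surface onto the boundary of the square. -/
def push (u : unitInterval) (p : Surface) : Surface :=
  ⟨scale (pushFactor u p.1) p.1, by
    have h := pushFactor_ge_one u.2 p
    rw [radius_scale (by linarith) (pushFactor_mul_norm_le u.2 p)]
    nlinarith [p.2]⟩

theorem pushFactor_of_half {u : ℝ} {p : Torus} (h : ‖p‖ = 1 / 2) : pushFactor u p = 1 := by
  rw [pushFactor, h]
  ring

theorem continuous_push : Continuous fun q : unitInterval × Surface => push q.1 q.2 := by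
  refine Continuous.subtype_mk (continuous_scale ?_ (continuous_subtype_val.comp continuous_snd)
    fun q h => pushFactor_of_half h) _
  unfold pushFactor
  have : Continuous fun q : unitInterval × Surface => 1 / (2 * ‖q.2.1‖) :=
    continuous_const.div (by fun_prop) fun q => by have := q.2.norm_pos; positivity
  fun_prop

theorem norm_push (u : unitInterval) (p : Surface) :
    ‖(push u p).1‖ = (1 - u) * ‖p.1‖ + u * (1 / 2) := by
  have h := pushFactor_ge_one u.2 p
  rw [← pushFactor_mul_norm]
  exact norm_scale (by linarith) (pushFactor_mul_norm_le u.2 p)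

theorem push_zero (p : Surface) : push 0 p = p := by
  refine Subtype.ext ?_
  simp [push, pushFactor, scale_one]

theorem push_of_half (u : unitInterval) {p : Surface} (h : ‖p.1‖ = 1 / 2) : push u p = p := by
  refine Subtype.ext ?_
  simp [push, pushFactor_of_half h, scale_one]

/-- The retraction of the surface to the boundary of the square. -/
def retract (p : Surface) : Surface := push 1 p

theorem continuous_retract : Continuous retract :=
  continuous_push.comp (continuous_const.prodMk continuous_id)

theorem norm_retract (p : Surface) : ‖(retract p).1‖ = 1 / 2 := by
  rw [retract, norm_push]
  simp

theorem retract_of_half {p : Surface} (h : ‖p.1‖ = 1 / 2) : retract p = p := push_of_half 1 h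

/-- Points of the surface from points of the square. -/
def ofPlane (w : ℂ) (h : supNorm w ≤ 1 / 2) (h' : 1 / 4 ≤ ‖w‖) : Surface :=
  ⟨ofComplex w, by rwa [radius_ofComplex h]⟩

theorem retract_ofPlane (w : ℂ) (h : supNorm w ≤ 1 / 2) (h' : 1 / 4 ≤ ‖w‖) :
    (retract (ofPlane w h h')).1 = ofComplex ((1 / (2 * supNorm w) : ℝ) * w) := by
  have e : (retract (ofPlane w h h')).1 = scale (1 / (2 * supNorm w)) (ofComplex w) := by
    simp [retract, push, ofPlane, pushFactor, norm_ofComplex h]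
  rw [e, scale_ofComplex h]
  intro h2
  rw [h2]
  norm_num

theorem retract_push (u : unitInterval) (p : Surface) : retract (push u p) = retract p := by
  have h := pushFactor_ge_one u.2 p
  have h2 := pushFactor_mul_norm_le u.2 p
  have h3 : supNorm ((pushFactor u p.1 : ℝ) * toComplex p.1) = pushFactor u p.1 * ‖p.1‖ := by
    rw [supNorm_mul, supNorm_toComplex, abs_of_nonneg (by linarith)]
  have h4 : 1 / 4 ≤ ‖(pushFactor u p.1 : ℝ) * toComplex p.1‖ := by
    rw [norm_mul, Complex.norm_real, Real.norm_of_nonneg (by linarith), ← radius_eq]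
    nlinarith [p.2]
  have e : push u p = ofPlane ((pushFactor u p.1 : ℝ) * toComplex p.1) (h3 ▸ h2) h4 := rfl
  refine Subtype.ext ?_
  rw [e, retract_ofPlane, h3]
  simp only [retract, push, scale, pushFactor]
  congr 1
  rw [← mul_assoc, ← Complex.ofReal_mul]
  congr 2
  have hp := p.norm_pos
  change 1 / (2 * (pushFactor u p.1 * ‖p.1‖)) * pushFactor u p.1 = _
  simp
  field_simp

/-! ### Squeezing the collar -/

/-- The radial profile that collapses the collar of width `1/8`. -/
def squeezeRadius (r : ℝ) : ℝ := min r (max (1 / 4) (2 * r - 1 / 2))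

theorem squeezeRadius_le (r : ℝ) : squeezeRadius r ≤ r := min_le_left _ _

theorem le_squeezeRadius {r : ℝ} (h : 1 / 4 ≤ r) : 1 / 4 ≤ squeezeRadius r :=
  le_min h (le_max_left _ _)

theorem squeezeRadius_of_le {r : ℝ} (h : 1 / 4 ≤ r) (h' : r ≤ 3 / 8) : squeezeRadius r = 1 / 4 := by
  rw [squeezeRadius, max_eq_left (by linarith), min_eq_right h]

theorem squeezeRadius_of_ge {r : ℝ} (h : 1 / 2 ≤ r) : squeezeRadius r = r := by
  rw [squeezeRadius, max_eq_right (by linarith), min_eq_left (by linarith)]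

/-- The homotopy from the identity to the map collapsing the collar to the boundary. -/
def squeeze (u : unitInterval) (p : Surface) : Surface :=
  ⟨scale (1 - u + u * (squeezeRadius (radius p.1) / radius p.1)) p.1, by
    have hp := p.2
    have h0 : (0 : ℝ) ≤ u := u.2.1
    have h1 : (u : ℝ) ≤ 1 := u.2.2
    have h2 := le_squeezeRadius hp
    have h3 := squeezeRadius_le (radius p.1)
    have h4 : 0 ≤ squeezeRadius (radius p.1) / radius p.1 := by positivity
    have h5 : squeezeRadius (radius p.1) / radius p.1 ≤ 1 := by
      rw [div_le_one (by linarith)]; exact h3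
    rw [radius_scale (by nlinarith) (by
      nlinarith [norm_le_half p.1, p.norm_pos, mul_nonneg h0 (sub_nonneg.2 h5)])]
    have h6 : squeezeRadius (radius p.1) / radius p.1 * radius p.1 = squeezeRadius (radius p.1) :=
      div_mul_cancel₀ _ (by linarith)
    nlinarith⟩

theorem continuous_squeeze : Continuous fun q : unitInterval × Surface => squeeze q.1 q.2 := by
  refine Continuous.subtype_mk (continuous_scale ?_ (continuous_subtype_val.comp continuous_snd)
    fun q h => ?_) _
  · have h1 : Continuous fun q : unitInterval × Surface => radius q.2.1 :=
      continuous_radius.comp (continuous_subtype_val.comp continuous_snd)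
    have : Continuous fun q : unitInterval × Surface =>
        squeezeRadius (radius q.2.1) / radius q.2.1 :=
      Continuous.div (by unfold squeezeRadius; fun_prop) h1 fun q => by
        have := q.2.2
        positivity
    fun_prop
  · have h2 : 1 / 2 ≤ radius q.2.1 := h ▸ norm_le_radius _
    rw [squeezeRadius_of_ge h2, div_self (by linarith)]
    ring

theorem squeeze_zero (p : Surface) : squeeze 0 p = p := by
  refine Subtype.ext ?_
  simp [squeeze, scale_one]

theorem squeeze_boundary (u : unitInterval) {p : Surface} (h : p ∈ boundary) : squeeze u p = p := by
  have h' : radius p.1 = 1 / 4 := h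
  refine Subtype.ext ?_
  have : (1 : ℝ) - u + u * (squeezeRadius (radius p.1) / radius p.1) = 1 := by
    rw [squeezeRadius_of_le h'.ge (by linarith), h']
    ring
  simp only [squeeze, this, scale_one]

theorem squeeze_one_mem {p : Surface} (h : radius p.1 ≤ 3 / 8) : squeeze 1 p ∈ boundary := by
  have hp := p.2
  have e : (1 : ℝ) - (1 : unitInterval) + (1 : unitInterval) *
      (squeezeRadius (radius p.1) / radius p.1) = 1 / 4 / radius p.1 := by
    rw [squeezeRadius_of_le hp h]
    simp
  change radius (scale _ p.1) = 1 / 4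
  rw [e, radius_scale (by positivity), div_mul_cancel₀ _ (by linarith)]
  have : 1 / 4 / radius p.1 ≤ 1 := by
    rw [div_le_one (by linarith)]; exact hp
  nlinarith [p.norm_pos, norm_le_half p.1]

/-- The coordinate on the collar, `0` at the boundary and `1` beyond the collar. -/
def collar (p : Surface) : unitInterval := ⟨clamp (8 * radius p.1 - 2), clamp_mem _⟩

theorem continuous_collar : Continuous collar :=
  Continuous.subtype_mk (continuous_clamp.comp (by
    have := continuous_radius
    fun_prop)) _

theorem collar_boundary {p : Surface} (h : p ∈ boundary) : collar p = 0 := by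
  have h' : radius p.1 = 1 / 4 := h
  refine Subtype.ext (clamp_of_nonpos ?_)
  rw [h']
  norm_num

theorem collar_eq_one {p : Surface} (h : 3 / 8 ≤ radius p.1) : collar p = 1 :=
  Subtype.ext (clamp_of_one_le (by linarith))

attribute [irreducible] push squeeze collar

end OneHoledTorus
end

noncomputable section
namespace OneHoledTorus

/-! ### The projection of the tree to the surface -/

/-- The abelianization of the free group, in the plane. -/
def latticePoint (g : F₂) : ℂ := ⟨(heis g).fst, (heis g).snd⟩

theorem latticePoint_mul (g h : F₂) : latticePoint (g * h) = latticePoint g + latticePoint h :=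
  Complex.ext (by simp [latticePoint]) (by simp [latticePoint])

theorem letter_true (i : Bool) : letter (i, true) = FreeGroup.of i := rfl

theorem letter_false (i : Bool) : letter (i, false) = (FreeGroup.of i)⁻¹ := by
  rw [← letter_true, ← letter_bar]
  rfl

theorem latticePoint_genA : latticePoint genA = 1 := by
  simp only [latticePoint, heis_genA]
  exact Complex.ext (by simp) (by simp)

theorem latticePoint_genB : latticePoint genB = Complex.I := by
  simp only [latticePoint, heis_genB]
  exact Complex.ext (by simp) (by simp)

/-- The developing map of the tree to the plane. -/
def develop (β : Tree) : ℂ :=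
  ⟨1 / 2 + Tree.eval (fun g => (latticePoint g).re) β, 1 / 2 + Tree.eval (fun g => (latticePoint g).im) β⟩

theorem develop_edge (g : F₂) (l : Bool × Bool) (s : ℝ) (hs : s ∈ Set.Icc (0 : ℝ) 1) :
    develop (Tree.edge g l s hs) = latticePoint g + (⟨1 / 2, 1 / 2⟩ + s * latticePoint (letter l)) := by
  refine Complex.ext ?_ ?_ <;> simp [develop, Tree.eval_edge, latticePoint_mul] <;> ring

theorem ofComplex_latticePoint (g : F₂) : ofComplex (latticePoint g) = 0 := by
  exact Prod.ext ((AddCircle.coe_eq_zero_iff 1).2 ⟨(heis g).fst, by simp [latticePoint]⟩)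
    ((AddCircle.coe_eq_zero_iff 1).2 ⟨(heis g).snd, by simp [latticePoint]⟩)

theorem continuous_develop : Continuous develop := by
  have e : develop = fun β => ((1 / 2 + Tree.eval (fun g => (latticePoint g).re) β : ℝ) : ℂ) +
      ((1 / 2 + Tree.eval (fun g => (latticePoint g).im) β : ℝ) : ℂ) * Complex.I := by
    funext β
    exact Complex.mk_eq_add_mul_I _ _
  rw [e]
  have h1 := Tree.continuous_eval fun g => (latticePoint g).re
  have h2 := Tree.continuous_eval fun g => (latticePoint g).im
  fun_prop

/-- The point `1/2 + s` of a direction through the corner of the square. -/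
theorem ofComplex_develop_edge (g : F₂) (l : Bool × Bool) (s : ℝ) (hs : s ∈ Set.Icc (0 : ℝ) 1) :
    ofComplex (develop (Tree.edge g l s hs)) = ofComplex (⟨1 / 2, 1 / 2⟩ + s * latticePoint (letter l)) := by
  rw [develop_edge, ofComplex_add, ofComplex_latticePoint, zero_add]

theorem ofComplex_edge_false (s : ℝ) :
    ofComplex (⟨1 / 2, 1 / 2⟩ + s * latticePoint (letter (false, true))) =
      (((1 / 2 + s : ℝ) : UnitAddCircle), ((1 / 2 : ℝ) : UnitAddCircle)) := by
  have : letter (false, true) = genA := rfl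
  rw [this, latticePoint_genA]
  simp [ofComplex]

theorem ofComplex_edge_true (s : ℝ) :
    ofComplex (⟨1 / 2, 1 / 2⟩ + s * latticePoint (letter (true, true))) =
      (((1 / 2 : ℝ) : UnitAddCircle), ((1 / 2 + s : ℝ) : UnitAddCircle)) := by
  have : letter (true, true) = genB := rfl
  rw [this, latticePoint_genB]
  simp [ofComplex]

/-- The two half-open positive edges at the base vertex meet every orbit. The far endpoint is
excluded, being the start of an edge at the next vertex; thus the parameter can be read off in the
circle. -/
theorem Tree.exists_smul_edge (β : Tree) : ∃ (g : F₂) (i : Bool) (s : ℝ) (hs : s ∈ Set.Icc (0 : ℝ) 1), s < 1 ∧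
    β = g • edge 1 (i, true) s hs := by
  have key : ∀ g i s hs, ∃ (g' : F₂) (i' : Bool) (s' : ℝ) (hs' : s' ∈ Set.Icc (0 : ℝ) 1), s' < 1 ∧
      edge g (i, true) s hs = g' • edge 1 (i', true) s' hs' := by
    intro g i s hs
    rcases hs.2.lt_or_eq with h | rfl
    · exact ⟨g, i, s, hs, h, by rw [smul_edge, mul_one]⟩
    · refine ⟨g * letter (i, true), i, 0, ⟨le_rfl, zero_le_one⟩, zero_lt_one, ?_⟩
      refine (edge_reverse _ _ _ _).trans (Eq.trans ?_ (smul_edge _ _ _ _ _).symm)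
      refine ext fun k => ?_
      simp only [edge, sub_self, mul_one]
      exact congrFun (edgePoint_zero _ _ _) k
  obtain ⟨g, ⟨i, _ | _⟩, s, hs, rfl⟩ := β.exists_edge
  · rw [edge_reverse]
    exact key _ _ _ _
  · exact key _ _ _ _

theorem ofComplex_develop_smul (g : F₂) (β : Tree) :
    ofComplex (develop (g • β)) = ofComplex (develop β) := by
  obtain ⟨h, l, s, hs, rfl⟩ := β.exists_edge
  rw [Tree.smul_edge, ofComplex_develop_edge, ofComplex_develop_edge]

theorem norm_coe_half : ‖((1 / 2 : ℝ) : UnitAddCircle)‖ = 1 / 2 := by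
  rw [norm_coe_circle (by norm_num [abs_of_pos])]
  norm_num [abs_of_pos]

theorem norm_ofComplex_develop (β : Tree) : ‖ofComplex (develop β)‖ = 1 / 2 := by
  refine le_antisymm (norm_le_half _) ?_
  obtain ⟨g, i, s, hs, -, rfl⟩ := β.exists_smul_edge
  rw [ofComplex_develop_smul, ofComplex_develop_edge]
  cases i
  · rw [ofComplex_edge_false, Prod.norm_def]
    simp only [norm_coe_half]
    exact le_max_right _ _
  · rw [ofComplex_edge_true, Prod.norm_def]
    simp only [norm_coe_half]
    exact le_max_left _ _

/-- The projection of the tree to the surface. -/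
def proj (β : Tree) : Surface :=
  ⟨ofComplex (develop β), by
    have := norm_le_radius (ofComplex (develop β))
    rw [norm_ofComplex_develop] at this
    linarith⟩

theorem continuous_proj : Continuous proj :=
  (continuous_ofComplex.comp continuous_develop).subtype_mk _

theorem proj_smul (g : F₂) (β : Tree) : proj (g • β) = proj β :=
  Subtype.ext (ofComplex_develop_smul g β)

theorem retract_proj (β : Tree) : retract (proj β) = proj β :=
  retract_of_half (norm_ofComplex_develop β)

theorem coe_half_add_inj {s t : ℝ} (hs : s ∈ Set.Ico (0 : ℝ) 1) (ht : t ∈ Set.Ico (0 : ℝ) 1)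
    (h : ((1 / 2 + s : ℝ) : UnitAddCircle) = ((1 / 2 + t : ℝ) : UnitAddCircle)) : s = t := by
  rw [AddCircle.coe_add, AddCircle.coe_add] at h
  have h := add_left_cancel h
  exact (AddCircle.coe_eq_coe_iff_of_mem_Ico (p := 1) (a := 0) (by simpa using hs)
    (by simpa using ht)).1 h

/-- Translate both points to the half-open edges at the base vertex. There the image in the torus
determines the point: a coincidence between the horizontal and the vertical circle forces both
parameters to be zero, the common vertex. -/
theorem proj_eq_iff {β γ : Tree} : proj β = proj γ ↔ β ∈ MulAction.orbit F₂ γ := by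
  constructor
  · intro h
    obtain ⟨g, i, s, hs, hs1, rfl⟩ := β.exists_smul_edge
    obtain ⟨k, j, t, ht, ht1, rfl⟩ := γ.exists_smul_edge
    suffices Tree.edge 1 (i, true) s hs = Tree.edge 1 (j, true) t ht by
      rw [this]
      exact ⟨g * k⁻¹, by simp [mul_smul]⟩
    rw [proj_smul, proj_smul] at h
    have h' : ofComplex _ = ofComplex _ := congrArg Subtype.val h
    rw [ofComplex_develop_edge, ofComplex_develop_edge] at h'
    have h0 : ((1 / 2 : ℝ) : UnitAddCircle) = ((1 / 2 + 0 : ℝ) : UnitAddCircle) := by rw [add_zero]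
    have z : (0 : ℝ) ∈ Set.Ico (0 : ℝ) 1 := ⟨le_rfl, zero_lt_one⟩
    have mixed : ∀ (i j : Bool) (s t : ℝ) (hs : s ∈ Set.Icc (0 : ℝ) 1) (ht : t ∈ Set.Icc (0 : ℝ) 1),
        s = 0 → t = 0 → Tree.edge 1 (i, true) s hs = Tree.edge 1 (j, true) t ht := by
      rintro i j s t hs ht rfl rfl
      exact Tree.ext fun k => congrFun (edgePoint_zero _ _ _) k
    cases i <;> cases j <;> simp only [ofComplex_edge_false, ofComplex_edge_true, Prod.mk.injEq] at h'
    · have := coe_half_add_inj ⟨hs.1, hs1⟩ ⟨ht.1, ht1⟩ h'.1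
      subst this
      rfl
    · exact mixed _ _ _ _ _ _ (coe_half_add_inj ⟨hs.1, hs1⟩ z (h'.1.trans h0))
        (coe_half_add_inj z ⟨ht.1, ht1⟩ (h0.symm.trans h'.2)).symm
    · exact mixed _ _ _ _ _ _ (coe_half_add_inj ⟨hs.1, hs1⟩ z (h'.2.trans h0))
        (coe_half_add_inj z ⟨ht.1, ht1⟩ (h0.symm.trans h'.1)).symm
    · have := coe_half_add_inj ⟨hs.1, hs1⟩ ⟨ht.1, ht1⟩ h'.2
      subst this
      rfl
  · rintro ⟨g, rfl⟩
    exact proj_smul g γ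

theorem exists_half_add (t : UnitAddCircle) :
    ∃ s ∈ Set.Icc (0 : ℝ) 1, ((1 / 2 + s : ℝ) : UnitAddCircle) = t := by
  have h := coord_mem t
  have h0 : ((1 / 2 + 1 / 2 : ℝ) : UnitAddCircle) = 0 := by
    have : ((1 : ℝ) : UnitAddCircle) = 0 := AddCircle.coe_period 1
    norm_num [this]
  refine ⟨coord t + 1 / 2, ⟨by linarith, by linarith⟩, ?_⟩
  have : (1 / 2 + (coord t + 1 / 2) : ℝ) = (1 / 2 + 1 / 2) + coord t := by ring
  rw [this, AddCircle.coe_add, h0, zero_add, coe_coord]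

theorem eq_half_of_norm {t : UnitAddCircle} (h : ‖t‖ = 1 / 2) : t = ((1 / 2 : ℝ) : UnitAddCircle) := by
  rw [norm_eq_abs_coord] at h
  have h2 := coord_mem t
  have : coord t = -1 / 2 := by
    rcases abs_cases (coord t) with ⟨h3, -⟩ | ⟨h3, -⟩ <;> linarith
  rw [← coe_coord t, this, ← sub_eq_zero, ← AddCircle.coe_sub]
  exact (AddCircle.coe_eq_zero_iff 1).2 ⟨-1, by norm_num⟩

/-- The edges at the base vertex. -/
def baseEdge (q : Bool × unitInterval) : Tree := Tree.edge 1 (q.1, true) q.2 q.2.2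

theorem continuous_baseEdge : Continuous baseEdge := by
  refine Tree.continuous_of_coord fun k => ?_
  refine continuous_prod_of_discrete_left.2 fun i => ?_
  change Continuous fun s : unitInterval => edgePoint 1 (i, true) s k
  unfold edgePoint
  refine Continuous.add ?_ ?_
  · split_ifs <;> fun_prop
  · split_ifs <;> fun_prop

theorem exists_proj_baseEdge {p : Surface} (h : ‖p.1‖ = 1 / 2) : ∃ q, proj (baseEdge q) = p := by
  rw [Prod.norm_def] at h
  rcases max_choice ‖p.1.1‖ ‖p.1.2‖ with h' | h' <;> rw [h'] at h
  · obtain ⟨s, hs, e⟩ := exists_half_add p.1.2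
    refine ⟨(true, ⟨s, hs⟩), Subtype.ext ?_⟩
    change ofComplex (develop (Tree.edge _ _ _ _)) = _
    rw [ofComplex_develop_edge, ofComplex_edge_true, e, ← eq_half_of_norm h]
  · obtain ⟨s, hs, e⟩ := exists_half_add p.1.1
    refine ⟨(false, ⟨s, hs⟩), Subtype.ext ?_⟩
    change ofComplex (develop (Tree.edge _ _ _ _)) = _
    rw [ofComplex_develop_edge, ofComplex_edge_false, e, ← eq_half_of_norm h]

/-! ### Disjoint translates -/

theorem Tree.coord_add_le {β : Tree} {k m : F₂} (h : k ≠ m) : β k + β m ≤ 1 := by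
  obtain ⟨g, l, s, hs, rfl⟩ := β.exists_edge
  change edgePoint g l s k + edgePoint g l s m ≤ 1
  unfold edgePoint
  have h1 := hs.1
  have h2 := hs.2
  split_ifs <;> first | linarith | (exfalso; simp_all)

theorem Tree.eq_or_eq_of_pos {β : Tree} {k m n : F₂} (hk : 0 < β k) (hm : 0 < β m) (hn : 0 < β n)
    (h : k ≠ m) : n = k ∨ n = m := by
  obtain ⟨g, l, s, hs, rfl⟩ := β.exists_edge
  have key : ∀ {a}, 0 < edge g l s hs a → a = g ∨ a = g * letter l := by
    intro a ha
    by_contra! hne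
    exact ha.ne' (edgePoint_ne hne.1 hne.2)
  rcases key hk with rfl | rfl <;> rcases key hm with rfl | rfl <;> rcases key hn with rfl | rfl <;>
    simp_all

theorem letter_mul_self_ne_one (l : Bool × Bool) : letter l * letter l ≠ 1 := by
  intro h
  have := congrArg latticePoint h
  rw [latticePoint_mul] at this
  have hl : latticePoint (letter l) = 0 := by
    have h1 : latticePoint 1 = 0 := Complex.ext (by simp [latticePoint]) (by simp [latticePoint])
    rw [h1] at this
    simpa using this
  have hI : (0 : ℂ) ≠ Complex.I := Complex.I_ne_zero.symm
  obtain ⟨_ | _, _ | _⟩ := l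
  · rw [letter_false] at hl
    have := latticePoint_mul genA genA⁻¹
    have h2 : latticePoint genA⁻¹ = 0 := hl
    have h1 : latticePoint 1 = 0 := Complex.ext (by simp [latticePoint]) (by simp [latticePoint])
    rw [mul_inv_cancel, h2, latticePoint_genA, h1] at this
    simp at this
  · have h2 : latticePoint genA = 0 := hl
    rw [latticePoint_genA] at h2
    simp at h2
  · rw [letter_false] at hl
    have := latticePoint_mul genB genB⁻¹
    have h2 : latticePoint genB⁻¹ = 0 := hl
    have h1 : latticePoint 1 = 0 := Complex.ext (by simp [latticePoint]) (by simp [latticePoint])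
    rw [mul_inv_cancel, h2, latticePoint_genB, h1] at this
    simp [hI] at this
  · have h2 : latticePoint genB = 0 := hl
    rw [latticePoint_genB] at h2
    simp at h2

/-- Close to a vertex, use that two different coordinates cannot both exceed `1 / 2`. Inside an
edge, a nontrivial translation would have to exchange its endpoints, which would make a letter an
involution. -/
theorem Tree.exists_disjoint_nhds (β : Tree) :
    ∃ U ∈ nhds β, ∀ g : F₂, ((g • ·) '' U ∩ U).Nonempty → g = 1 := by
  have vertex : ∀ k, 1 / 2 < β k → ∃ U ∈ nhds β, ∀ g : F₂, ((g • ·) '' U ∩ U).Nonempty → g = 1 := by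
    intro k hk
    refine ⟨{γ | 1 / 2 < γ k}, (isOpen_lt continuous_const (continuous_coord k)).mem_nhds hk, ?_⟩
    rintro g ⟨_, ⟨γ, hγ, rfl⟩, hγ'⟩
    by_contra hg
    have h1 : 1 / 2 < γ k := hγ
    have h2 : 1 / 2 < γ (g⁻¹ * k) := hγ'
    have := coord_add_le (β := γ) (k := k) (m := g⁻¹ * k) (by simpa [eq_comm] using hg)
    linarith
  obtain ⟨h, l, s, hs, rfl⟩ := β.exists_edge
  have e1 : edge h l s hs h = 1 - s := edgePoint_self h l s
  have e2 : edge h l s hs (h * letter l) = s := edgePoint_next h l s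
  rcases lt_or_ge s (1 / 2) with hs' | hs'
  · exact vertex h (by rw [e1]; linarith)
  rcases hs.2.lt_or_eq with hs1 | hs1
  · refine ⟨{γ | 0 < γ h} ∩ {γ | 0 < γ (h * letter l)},
      ((isOpen_lt continuous_const (continuous_coord _)).inter
        (isOpen_lt continuous_const (continuous_coord _))).mem_nhds
          ⟨by rw [Set.mem_ofPred_eq, e1]; linarith, by rw [Set.mem_ofPred_eq, e2]; linarith⟩, ?_⟩
    rintro g ⟨_, ⟨γ, ⟨hγ, hγ'⟩, rfl⟩, hk, hk'⟩
    have h1 : 0 < γ (g⁻¹ * h) := hk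
    have h2 : 0 < γ (g⁻¹ * (h * letter l)) := hk'
    rcases eq_or_eq_of_pos hγ hγ' h1 (mul_letter_ne h l).symm with h3 | h3
    · simpa using h3
    rcases eq_or_eq_of_pos hγ hγ' h2 (mul_letter_ne h l).symm with h4 | h4
    · rw [← mul_assoc, h3, mul_assoc] at h4
      exact absurd (mul_eq_left.1 h4) (letter_mul_self_ne_one l)
    · simpa using h4
  · exact vertex (h * letter l) (by rw [e2]; linarith)

/-! ### The universal cover of the surface -/

/-- The universal cover, the pullback of the tree along the retraction. -/
def Cover : Type := {q : Surface × Tree // retract q.1 = proj q.2}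

instance : TopologicalSpace Cover := instTopologicalSpaceSubtype

namespace Cover

/-- The covering map. -/
def pr (e : Cover) : Surface := e.1.1

/-- The projection to the tree. -/
def height (e : Cover) : Tree := e.1.2

theorem continuous_pr : Continuous pr := continuous_fst.comp continuous_subtype_val

theorem continuous_height : Continuous height := continuous_snd.comp continuous_subtype_val

theorem ext {e e' : Cover} (h : pr e = pr e') (h' : height e = height e') : e = e' :=
  Subtype.ext (Prod.ext h h')

theorem retract_pr (e : Cover) : retract (pr e) = proj (height e) := e.2

/-- The constructor. -/
def mk (p : Surface) (β : Tree) (h : retract p = proj β) : Cover := ⟨(p, β), h⟩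

instance : MulAction F₂ Cover where
  smul g e := mk (pr e) (g • height e) (by rw [proj_smul, retract_pr])
  one_smul e := ext rfl (one_smul _ _)
  mul_smul g h e := ext rfl (mul_smul _ _ _)

theorem pr_smul (g : F₂) (e : Cover) : pr (g • e) = pr e := rfl

theorem height_smul (g : F₂) (e : Cover) : height (g • e) = g • height e := rfl

theorem continuous_mk {X : Type*} [TopologicalSpace X] {f : X → Surface} {b : X → Tree}
    (hf : Continuous f) (hb : Continuous b) (h : ∀ x, retract (f x) = proj (b x)) :
    Continuous fun x => mk (f x) (b x) (h x) :=
  Continuous.subtype_mk (hf.prodMk hb) h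

theorem continuous_smul (g : F₂) : Continuous fun e : Cover => g • e :=
  continuous_mk continuous_pr ((continuous_const_smul g).comp continuous_height) fun e =>
    (retract_pr e).trans (proj_smul _ _).symm

instance : CompactSpace Surface :=
  isCompact_iff_compactSpace.1 (isClosed_le continuous_const continuous_radius).isCompact

/-- The part of the cover over the two closed edges at the base vertex is the image of a compact
space that maps onto the surface, so the composite is closed and hence a quotient map. -/
theorem isQuotientMap_pr : Topology.IsQuotientMap pr := by
  let K : Type := {q : Surface × (Bool × unitInterval) // retract q.1 = proj (baseEdge q.2)}
  have hK : IsClosed {q : Surface × (Bool × unitInterval) | retract q.1 = proj (baseEdge q.2)} :=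
    isClosed_eq (continuous_retract.comp continuous_fst)
      (continuous_proj.comp (continuous_baseEdge.comp continuous_snd))
  have : CompactSpace K := isCompact_iff_compactSpace.1 hK.isCompact
  let j : K → Cover := fun q => mk q.1.1 (baseEdge q.1.2) q.2
  have hj : Continuous j := continuous_mk (continuous_fst.comp continuous_subtype_val)
    (continuous_baseEdge.comp (continuous_snd.comp continuous_subtype_val)) _
  have hs : Function.Surjective (pr ∘ j) := by
    intro p
    obtain ⟨q, hq⟩ := exists_proj_baseEdge (norm_retract p)
    exact ⟨⟨(p, q), hq.symm⟩, rfl⟩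
  have hc : Continuous (pr ∘ j) := continuous_pr.comp hj
  exact Topology.IsQuotientMap.of_comp hj continuous_pr (hc.isClosedMap.isQuotientMap hc hs)

theorem isQuotientCoveringMap_pr : IsQuotientCoveringMap pr F₂ where
  toIsQuotientMap := isQuotientMap_pr
  continuous_const_smul := continuous_smul
  apply_eq_iff_mem_orbit {e e'} := by
    constructor
    · intro h
      obtain ⟨g, hg⟩ := proj_eq_iff.1 ((retract_pr e).symm.trans ((congrArg retract h).trans (retract_pr e')))
      exact ⟨g, ext h.symm hg⟩
    · rintro ⟨g, rfl⟩
      rfl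
  disjoint e := by
    obtain ⟨U, hU, h⟩ := (height e).exists_disjoint_nhds
    refine ⟨height ⁻¹' U, continuous_height.continuousAt hU, fun g hg => h g ?_⟩
    obtain ⟨_, ⟨e', he', rfl⟩, he''⟩ := hg
    exact ⟨_, ⟨_, he', rfl⟩, he''⟩

theorem isCoveringMap_pr : IsCoveringMap pr := isQuotientCoveringMap_pr.isCoveringMap

/-- The cover deformation retracts to the tree. -/
def homotopyEquivTree : ContinuousMap.HomotopyEquiv Cover Tree where
  toFun := ⟨height, continuous_height⟩
  invFun := ⟨fun β => mk (proj β) β (retract_proj β),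
    continuous_mk continuous_proj continuous_id _⟩
  left_inv := by
    refine ContinuousMap.Homotopic.symm ⟨⟨⟨fun q => mk (push q.1 (pr q.2)) (height q.2)
      ((retract_push _ _).trans (retract_pr _)), ?_⟩, ?_, ?_⟩⟩
    · exact continuous_mk (continuous_push.comp (continuous_fst.prodMk (continuous_pr.comp continuous_snd)))
        (continuous_height.comp continuous_snd) _
    · intro e
      exact ext (push_zero _) rfl
    · intro e
      exact ext (retract_pr e) rfl
  right_inv := ContinuousMap.Homotopic.refl _

instance : SimplyConnectedSpace Cover := by
  have : SimplyConnectedSpace Tree := inferInstance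
  exact homotopyEquivTree.simplyConnectedSpace

end Cover
end OneHoledTorus
end

noncomputable section
namespace OneHoledTorus

/-! ### Polar coordinates -/

/-- The unit complex number of angle `θ`. -/
def cis (θ : ℝ) : ℂ := Complex.exp (θ * Complex.I)

theorem norm_cis (θ : ℝ) : ‖cis θ‖ = 1 := Complex.norm_exp_ofReal_mul_I θ

theorem continuous_cis : Continuous cis := by
  unfold cis
  fun_prop

theorem half_le_supNorm_cis (θ : ℝ) : 1 / 2 ≤ supNorm (cis θ) := by
  have := norm_le_two_mul_supNorm (cis θ)
  rw [norm_cis] at this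
  linarith

theorem continuous_supNorm : Continuous supNorm := by
  unfold supNorm
  fun_prop

/-- The distance to the origin along the ray of angle `θ`, from the boundary circle to the edge of
the square. -/
def rayRadius (s θ : ℝ) : ℝ := (1 - s) / 4 + s * (1 / (2 * supNorm (cis θ)))

theorem quarter_le_rayRadius {s : ℝ} (hs : s ∈ Set.Icc (0 : ℝ) 1) (θ : ℝ) : 1 / 4 ≤ rayRadius s θ := by
  have h := half_le_supNorm_cis θ
  have h1 : supNorm (cis θ) ≤ 1 := norm_cis θ ▸ supNorm_le_norm _
  have : 1 / 2 ≤ 1 / (2 * supNorm (cis θ)) := by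
    rw [le_div_iff₀ (by linarith)]
    linarith
  unfold rayRadius
  nlinarith [hs.1, hs.2]

theorem rayRadius_mul_supNorm_le {s : ℝ} (hs : s ∈ Set.Icc (0 : ℝ) 1) (θ : ℝ) :
    rayRadius s θ * supNorm (cis θ) ≤ 1 / 2 := by
  have h := half_le_supNorm_cis θ
  have h1 : supNorm (cis θ) ≤ 1 := norm_cis θ ▸ supNorm_le_norm _
  have : rayRadius s θ * supNorm (cis θ) = (1 - s) / 4 * supNorm (cis θ) + s * (1 / 2) := by
    unfold rayRadius
    field_simp
  rw [this]
  nlinarith [hs.1, hs.2]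

/-- Polar coordinates on the surface. -/
def polar (q : unitInterval × ℝ) : Surface :=
  ofPlane (rayRadius q.1 q.2 * cis q.2) (by
    have := quarter_le_rayRadius q.1.2 q.2
    rw [supNorm_mul, abs_of_nonneg (by linarith)]
    exact rayRadius_mul_supNorm_le q.1.2 q.2) (by
    have := quarter_le_rayRadius q.1.2 q.2
    rwa [norm_mul, norm_cis, mul_one, Complex.norm_real, Real.norm_of_nonneg (by linarith)])

theorem continuous_polar : Continuous polar := by
  refine Continuous.subtype_mk (continuous_ofComplex.comp (Continuous.mul ?_ ?_)) _
  · refine Complex.continuous_ofReal.comp ?_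
    have h : Continuous fun q : unitInterval × ℝ => supNorm (cis q.2) :=
      continuous_supNorm.comp (continuous_cis.comp continuous_snd)
    have : Continuous fun q : unitInterval × ℝ => 1 / (2 * supNorm (cis q.2)) :=
      continuous_const.div (by fun_prop) fun q => by
        have := half_le_supNorm_cis q.2
        positivity
    unfold rayRadius
    fun_prop
  · exact continuous_cis.comp continuous_snd

theorem polar_surjective (p : Surface) : ∃ s, ∃ θ ∈ Set.Icc (-π) π, polar (s, θ) = p := by
  set z := toComplex p.1 with hz
  have hp : 1 / 4 ≤ ‖z‖ := by rw [hz, ← radius_eq]; exact p.2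
  set θ := Complex.arg z with hθ
  have hzθ : (‖z‖ : ℂ) * cis θ = z := Complex.norm_mul_exp_arg_mul_I z
  have hN : ‖z‖ * supNorm (cis θ) ≤ 1 / 2 := by
    have : supNorm z = ‖z‖ * supNorm (cis θ) := by
      conv_lhs => rw [← hzθ]
      rw [supNorm_mul, abs_of_nonneg (norm_nonneg _)]
    rw [← this, hz, supNorm_toComplex]
    exact norm_le_half _
  have h := half_le_supNorm_cis θ
  have h1 : supNorm (cis θ) ≤ 1 := norm_cis θ ▸ supNorm_le_norm _
  have h2 : 1 / 2 ≤ 1 / (2 * supNorm (cis θ)) := by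
    rw [le_div_iff₀ (by linarith)]
    linarith
  have h3 : ‖z‖ ≤ 1 / (2 * supNorm (cis θ)) := by
    rw [le_div_iff₀ (by linarith)]
    linarith
  set R := 1 / (2 * supNorm (cis θ)) with hR
  refine ⟨⟨(‖z‖ - 1 / 4) / (R - 1 / 4), div_nonneg (by linarith) (by linarith),
    (div_le_one (by linarith)).2 (by linarith)⟩, θ,
    ⟨(Complex.neg_pi_lt_arg z).le, Complex.arg_le_pi z⟩, Subtype.ext ?_⟩
  have : rayRadius ((‖z‖ - 1 / 4) / (R - 1 / 4)) θ = ‖z‖ := by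
    have h4 : (‖z‖ - 1 / 4) / (R - 1 / 4) * (R - 1 / 4) = ‖z‖ - 1 / 4 :=
      div_mul_cancel₀ _ (by linarith)
    unfold rayRadius
    rw [← hR]
    linear_combination h4
  change ofComplex ((rayRadius ((‖z‖ - 1 / 4) / (R - 1 / 4)) θ : ℝ) * cis θ) = p.1
  rw [this, hzθ, hz, ofComplex_toComplex]

/-- This serves to make the surface, and then its cover, locally path connected, as the existence of
lifts to the cover requires. -/
theorem isQuotientMap_polar : Topology.IsQuotientMap polar := by
  let j : unitInterval × Set.Icc (-π) π → unitInterval × ℝ := fun q => (q.1, q.2)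
  have hj : Continuous j := by fun_prop
  have hc : Continuous (polar ∘ j) := continuous_polar.comp hj
  refine Topology.IsQuotientMap.of_comp hj continuous_polar (hc.isClosedMap.isQuotientMap hc ?_)
  intro p
  obtain ⟨s, θ, hθ, h⟩ := polar_surjective p
  exact ⟨(s, ⟨θ, hθ⟩), h⟩

instance : LocallyPathConnectedSpace Surface := by
  have : LocallyPathConnectedSpace unitInterval := (convex_Icc (0 : ℝ) 1).locallyPathConnectedSpace
  exact isQuotientMap_polar.locallyPathConnectedSpace

theorem _root_.IsLocalHomeomorph.locallyPathConnectedSpace {X Y : Type*} [TopologicalSpace X]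
    [TopologicalSpace Y] [LocallyPathConnectedSpace Y] {f : X → Y} (hf : IsLocalHomeomorph f) :
    LocallyPathConnectedSpace X := by
  choose e he _ using hf
  let _ : ChartedSpace Y X :=
    { atlas := Set.range e
      chartAt := e
      mem_chart_source := he
      chart_mem_atlas := fun x => ⟨x, rfl⟩ }
  exact ChartedSpace.locallyPathConnectedSpace Y X

namespace Cover

instance : LocallyPathConnectedSpace Cover := isCoveringMap_pr.isLocalHomeomorph.locallyPathConnectedSpace

instance : PreconnectedSpace Cover := inferInstance

/-! ### Lifts of homeomorphisms -/

/-- The base point of the cover, on the middle of the right edge of the square. -/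
def base : Cover :=
  mk basePoint (Tree.edge 1 (true, true) (1 / 2) (by constructor <;> norm_num)) (by
    refine Subtype.ext ?_
    have h4 : supNorm ((1 / 4 : ℝ) : ℂ) = 1 / 4 := by
      simp only [supNorm, Complex.ofReal_re, Complex.ofReal_im, abs_zero]
      norm_num [abs_of_pos]
    have h : basePoint = ofPlane ((1 / 4 : ℝ) : ℂ) (by rw [h4]; norm_num)
        (by rw [Complex.norm_real]; norm_num) :=
      Subtype.ext (Prod.ext (by simp [ofPlane, ofComplex, basePoint])
        (by simp [ofPlane, ofComplex, basePoint]))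
    rw [h, retract_ofPlane, h4]
    refine Eq.trans ?_ ((ofComplex_develop_edge _ _ _ _).trans (ofComplex_edge_true _)).symm
    have : ((1 : ℝ) : UnitAddCircle) = 0 := AddCircle.coe_period 1
    refine Prod.ext ?_ ?_
    · simp only [ofComplex, ← Complex.ofReal_mul, Complex.ofReal_re]
      norm_num
    · simp only [ofComplex, ← Complex.ofReal_mul, Complex.ofReal_im]
      norm_num [this])

theorem pr_base : pr base = basePoint := rfl

theorem smul_base_injective {g h : F₂} (e : g • base = h • base) : g = h :=
  have := isQuotientCoveringMap_pr.isCancelSMul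
  IsCancelSMul.right_cancel _ _ _ e

theorem exists_smul_eq {e e' : Cover} (h : pr e = pr e') : ∃ g : F₂, g • e' = e :=
  isQuotientCoveringMap_pr.apply_eq_iff_mem_orbit.1 h

theorem eq_of_lifts {A : Type*} [TopologicalSpace A] [PreconnectedSpace A] {F G : A → Cover}
    (hF : Continuous F) (hG : Continuous G) (h : ∀ a, pr (F a) = pr (G a)) (a : A) (ha : F a = G a) :
    F = G :=
  isCoveringMap_pr.eq_of_comp_eq hF hG (funext h) a ha

theorem exists_lift (f : HomeoFixingBoundary) :
    ∃ F : C(Cover, Cover), F base = base ∧ ∀ e, pr (F e) = toMap f (pr e) := by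
  obtain ⟨F, ⟨h, h'⟩, -⟩ := isCoveringMap_pr.existsUnique_continuousMap_lifts
    ((toMap f).comp ⟨pr, continuous_pr⟩) base base (toMap_basePoint f).symm
  exact ⟨F, h, congrFun h'⟩

/-- The lift of a homeomorphism to the universal cover, fixing the base point. -/
def lift (f : HomeoFixingBoundary) : C(Cover, Cover) := (exists_lift f).choose

theorem lift_base (f : HomeoFixingBoundary) : lift f base = base := (exists_lift f).choose_spec.1

theorem pr_lift (f : HomeoFixingBoundary) (e : Cover) : pr (lift f e) = toMap f (pr e) :=
  (exists_lift f).choose_spec.2 e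

theorem exists_act (f : HomeoFixingBoundary) (g : F₂) : ∃ h : F₂, h • base = lift f (g • base) :=
  exists_smul_eq (by rw [pr_lift, pr_smul, pr_base, toMap_basePoint])

/-- The action on the deck transformations. -/
def actFun (f : HomeoFixingBoundary) (g : F₂) : F₂ := (exists_act f g).choose

theorem actFun_smul_base (f : HomeoFixingBoundary) (g : F₂) :
    actFun f g • base = lift f (g • base) := (exists_act f g).choose_spec

/-- Both sides lift the same map and agree at the base point. -/
theorem lift_smul' (f : HomeoFixingBoundary) (g : F₂) (e : Cover) :
    lift f (g • e) = actFun f g • lift f e :=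
  congrFun (eq_of_lifts (F := fun e => lift f (g • e)) (G := fun e => actFun f g • lift f e)
    ((lift f).continuous.comp (continuous_smul g)) ((continuous_smul _).comp (lift f).continuous)
    (fun e => by rw [pr_lift, pr_smul, pr_smul, pr_lift]) base
    (by rw [← actFun_smul_base, lift_base])) e

/-- The action of a homeomorphism on the group of deck transformations. -/
def act (f : HomeoFixingBoundary) : F₂ →* F₂ :=
  MonoidHom.mk' (actFun f) fun g h => smul_base_injective (by
    rw [actFun_smul_base, mul_smul, lift_smul', ← actFun_smul_base, mul_smul])

theorem lift_smul (f : HomeoFixingBoundary) (g : F₂) (e : Cover) :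
    lift f (g • e) = act f g • lift f e := lift_smul' f g e

theorem act_smul_base (f : HomeoFixingBoundary) (g : F₂) : act f g • base = lift f (g • base) :=
  actFun_smul_base f g

theorem lift_one : lift 1 = ContinuousMap.id Cover :=
  ContinuousMap.ext (congrFun (eq_of_lifts (lift 1).continuous continuous_id
    (fun e => by rw [pr_lift]; rfl) base (lift_base 1)))

theorem lift_mul (f g : HomeoFixingBoundary) : lift (f * g) = (lift f).comp (lift g) :=
  ContinuousMap.ext (congrFun (eq_of_lifts (lift (f * g)).continuous
    ((lift f).comp (lift g)).continuous
    (fun e => by rw [ContinuousMap.comp_apply, pr_lift, pr_lift, pr_lift]; rfl) base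
    (by rw [ContinuousMap.comp_apply, lift_base, lift_base, lift_base])))

theorem act_one : act 1 = MonoidHom.id F₂ :=
  MonoidHom.ext fun g => smul_base_injective (by rw [act_smul_base, lift_one]; rfl)

theorem act_mul (f g : HomeoFixingBoundary) : act (f * g) = (act f).comp (act g) :=
  MonoidHom.ext fun h => smul_base_injective (by
    rw [act_smul_base, lift_mul, ContinuousMap.comp_apply, ← act_smul_base, ← act_smul_base]
    rfl)

/-- A homotopy of maps of the surface, lifted to the cover. -/
theorem exists_lift_homotopy (H : C(unitInterval × Surface, Surface)) (f : HomeoFixingBoundary)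
    (hf : ∀ p, H (0, p) = toMap f p) :
    ∃ G : C(unitInterval × Cover, Cover), (∀ t e, pr (G (t, e)) = H (t, pr e)) ∧
      ∀ e, G (0, e) = lift f e := by
  have h0 : ∀ e, (H.comp ((ContinuousMap.id unitInterval).prodMap ⟨pr, continuous_pr⟩)) (0, e) =
      pr (lift f e) := fun e => by
    rw [pr_lift, ← hf]
    rfl
  exact ⟨isCoveringMap_pr.liftHomotopy _ (lift f) h0,
    fun t e => congrFun (isCoveringMap_pr.liftHomotopy_lifts _ (lift f) h0) (t, e),
    fun e => isCoveringMap_pr.liftHomotopy_zero _ (lift f) h0 e⟩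

/-- The lifted homotopy stands still on the fibre of the base point, since that point lies on the
boundary. Its end is therefore the lift of `g` that fixes the base point, and both lifts agree on
the fibre. -/
theorem act_congr {f g : HomeoFixingBoundary} (h : (toMap f).HomotopicRel (toMap g) boundary) :
    act f = act g := by
  obtain ⟨H⟩ := h
  obtain ⟨G, hG, hG0⟩ := exists_lift_homotopy H.toContinuousMap f fun p => H.apply_zero p
  have const : ∀ (k : F₂) t, G (t, k • base) = G (0, k • base) := by
    intro k t
    refine congrFun (eq_of_lifts (F := fun t => G (t, k • base)) (G := fun _ => G (0, k • base))
      (by fun_prop) (by fun_prop) (fun t => ?_) 0 rfl) t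
    rw [hG, hG]
    exact (H.eq_fst t basePoint_mem).trans (H.eq_fst 0 basePoint_mem).symm
  have h1 : ∀ e, G (1, e) = lift g e := by
    refine congrFun (eq_of_lifts (F := fun e => G (1, e)) (by fun_prop) (lift g).continuous
      (fun e => ?_) base ?_)
    · rw [hG, pr_lift]
      exact H.apply_one _
    · have := const 1 1
      rw [one_smul] at this
      rw [this, hG0, lift_base, lift_base]
  refine MonoidHom.ext fun k => smul_base_injective ?_
  rw [act_smul_base, act_smul_base, ← hG0, ← h1, const k 1]

end Cover

theorem homotopicRel_of_inv_mul_mem {f g : HomeoFixingBoundary} (h : f⁻¹ * g ∈ HomotopicToId) :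
    (toMap f).HomotopicRel (toMap g) boundary := by
  obtain ⟨F⟩ := h
  refine ContinuousMap.HomotopicRel.symm ⟨(F.compContinuousMap (toMap f)).cast ?_ ?_⟩
  · exact ContinuousMap.ext fun p => f.1.apply_symm_apply (g.1 p)
  · exact ContinuousMap.comp_id _

/-- The action of a mapping class on the free group. -/
def mcgAct (φ : MCG) : F₂ →* F₂ :=
  Quotient.liftOn' φ Cover.act fun _ _ h =>
    Cover.act_congr (homotopicRel_of_inv_mul_mem (QuotientGroup.leftRel_apply.mp h))

theorem mcgAct_one : mcgAct 1 = MonoidHom.id F₂ := Cover.act_one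

theorem mcgAct_mul (φ ψ : MCG) : mcgAct (φ * ψ) = (mcgAct φ).comp (mcgAct ψ) := by
  obtain ⟨f, rfl⟩ := QuotientGroup.mk_surjective φ
  obtain ⟨g, rfl⟩ := QuotientGroup.mk_surjective ψ
  exact Cover.act_mul f g

end OneHoledTorus
end

noncomputable section
namespace OneHoledTorus

/-! ### The boundary circle -/

theorem supNorm_circle_le (θ : ℝ) : supNorm ((1 / 4 : ℝ) * cis θ) ≤ 1 / 2 := by
  have h1 : supNorm (cis θ) ≤ 1 := norm_cis θ ▸ supNorm_le_norm _
  rw [supNorm_mul, abs_of_pos (by norm_num)]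
  linarith

theorem norm_circle (θ : ℝ) : ‖((1 / 4 : ℝ) : ℂ) * cis θ‖ = 1 / 4 := by
  rw [norm_mul, norm_cis, mul_one, Complex.norm_real, Real.norm_of_nonneg (by norm_num)]

/-- The point of the boundary circle of angle `θ`. -/
def circ (θ : ℝ) : Surface :=
  ofPlane ((1 / 4 : ℝ) * cis θ) (supNorm_circle_le θ) (norm_circle θ).ge

theorem continuous_circ : Continuous circ :=
  Continuous.subtype_mk (continuous_ofComplex.comp (continuous_const.mul continuous_cis)) _

theorem circ_mem (θ : ℝ) : circ θ ∈ boundary := by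
  change radius (ofComplex _) = 1 / 4
  rw [radius_ofComplex (supNorm_circle_le θ), norm_circle]

theorem exists_circ {p : Surface} (hp : p ∈ boundary) : ∃ θ, circ θ = p := by
  have h : ‖toComplex p.1‖ = 1 / 4 := by rw [← radius_eq]; exact hp
  refine ⟨Complex.arg (toComplex p.1), Subtype.ext ?_⟩
  change ofComplex ((1 / 4 : ℝ) * cis _) = p.1
  have : (‖toComplex p.1‖ : ℂ) * cis (Complex.arg (toComplex p.1)) = toComplex p.1 :=
    Complex.norm_mul_exp_arg_mul_I _
  rw [h] at this
  rw [this, ofComplex_toComplex]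

theorem circ_zero : circ 0 = basePoint := by
  refine Subtype.ext (Prod.ext ?_ ?_) <;> simp [circ, ofPlane, ofComplex, cis, basePoint]

namespace Cover

theorem exists_ring : ∃ F : C(ℝ, Cover), F 0 = base ∧ ∀ θ, pr (F θ) = circ θ := by
  obtain ⟨F, ⟨h, h'⟩, -⟩ := isCoveringMap_pr.existsUnique_continuousMap_lifts
    ⟨circ, continuous_circ⟩ 0 base circ_zero.symm
  exact ⟨F, h, congrFun h'⟩

/-- The lift of the boundary circle through the base point. -/
def ring : C(ℝ, Cover) := exists_ring.choose

theorem ring_zero : ring 0 = base := exists_ring.choose_spec.1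

theorem pr_ring (θ : ℝ) : pr (ring θ) = circ θ := exists_ring.choose_spec.2 θ

theorem lift_ring (f : HomeoFixingBoundary) (θ : ℝ) : lift f (ring θ) = ring θ :=
  congrFun (eq_of_lifts (F := fun θ => lift f (ring θ)) (by fun_prop) ring.continuous
    (fun θ => by rw [pr_lift, pr_ring]; exact f.2 _ (circ_mem θ)) 0
    (by rw [ring_zero, lift_base])) θ

/-- The preimage of the boundary consists of the translates of one lifted line, which every lift
fixes; a trivial action carries this over to all translates. -/
theorem lift_of_mem_boundary {f : HomeoFixingBoundary} (hf : act f = MonoidHom.id F₂) {e : Cover}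
    (he : pr e ∈ boundary) : lift f e = e := by
  obtain ⟨θ, hθ⟩ := exists_circ he
  obtain ⟨g, rfl⟩ := exists_smul_eq (e := e) (e' := ring θ) (by rw [pr_ring, hθ])
  rw [lift_smul, lift_ring, hf]
  rfl

/-! ### Homeomorphisms acting trivially -/

/-- Join the tree coordinate of `lift f e` to that of `e` by a geodesic. As `lift f` commutes with
deck transformations, the family is equivariant and descends; over the boundary both ends coincide
and the geodesic is constant. -/
theorem exists_retract_homotopy {f : HomeoFixingBoundary} (hf : act f = MonoidHom.id F₂) :
    ∃ Φ : C(unitInterval × Surface, Surface), (∀ p, Φ (0, p) = retract (toMap f p)) ∧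
      (∀ p, Φ (1, p) = retract p) ∧ ∀ t, ∀ p ∈ boundary, Φ (t, p) = retract p := by
  let φ : C(unitInterval × Cover, Surface) :=
    ⟨fun q => proj (Tree.geodesic q.1 (height (lift f q.2)) (height q.2)),
      continuous_proj.comp (Tree.continuous_geodesic.comp (continuous_fst.prodMk
        ((continuous_height.comp ((lift f).continuous.comp continuous_snd)).prodMk
          (continuous_height.comp continuous_snd))))⟩
  let P : C(unitInterval × Cover, unitInterval × Surface) :=
    (ContinuousMap.id unitInterval).prodMap ⟨pr, continuous_pr⟩
  have hP : Topology.IsQuotientMap P :=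
    (IsOpenQuotientMap.id.prodMap isQuotientCoveringMap_pr.isOpenQuotientMap).isQuotientMap
  have hφ : Function.FactorsThrough φ P := by
    rintro ⟨t, e⟩ ⟨t', e'⟩ h
    obtain ⟨rfl, h2⟩ := Prod.mk.inj h
    obtain ⟨g, rfl⟩ := exists_smul_eq h2
    change proj (Tree.geodesic t (height (lift f (g • e'))) (height (g • e'))) = _
    rw [lift_smul, hf, height_smul, height_smul]
    exact (congrArg proj (Tree.geodesic_smul g t _ _)).trans (proj_smul _ _)
  have key : ∀ t e, hP.lift φ hφ (t, pr e) =
      proj (Tree.geodesic t (height (lift f e)) (height e)) := fun t e =>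
    DFunLike.congr_fun (Topology.IsQuotientMap.lift_comp hP φ hφ) (t, e)
  have hs := isQuotientCoveringMap_pr.surjective
  refine ⟨hP.lift φ hφ, fun p => ?_, fun p => ?_, fun t p hp => ?_⟩
  · obtain ⟨e, rfl⟩ := hs p
    rw [key, Tree.geodesic_zero, ← retract_pr, pr_lift]
  · obtain ⟨e, rfl⟩ := hs p
    rw [key, Tree.geodesic_one, ← retract_pr]
  · obtain ⟨e, rfl⟩ := hs p
    rw [key, lift_of_mem_boundary hf hp, Tree.geodesic_self, ← retract_pr]

end Cover

/-- Two maps are related by a homotopy that moves boundary points along their radii, all in the same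
way. -/
def RadiallyHomotopic (f g : C(Surface, Surface)) (a b : unitInterval) : Prop :=
  ∃ (K : f.Homotopy g) (τ : Path a b), ∀ t, ∀ p ∈ boundary, K (t, p) = push (τ t) p

theorem RadiallyHomotopic.trans {f g h : C(Surface, Surface)} {a b c : unitInterval}
    (H : RadiallyHomotopic f g a b) (H' : RadiallyHomotopic g h b c) : RadiallyHomotopic f h a c := by
  obtain ⟨K, τ, hK⟩ := H
  obtain ⟨K', τ', hK'⟩ := H'
  refine ⟨K.trans K', τ.trans τ', fun t p hp => ?_⟩
  rw [ContinuousMap.Homotopy.trans_apply, Path.trans_apply]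
  split_ifs
  · exact hK _ p hp
  · exact hK' _ p hp

/-- The retraction as a continuous map. -/
def retractMap : C(Surface, Surface) := ⟨retract, continuous_retract⟩

/-- Pushing the values of a map out to the boundary of the square. -/
def pushHomotopy (f : C(Surface, Surface)) : f.Homotopy (retractMap.comp f) where
  toFun q := push q.1 (f q.2)
  continuous_toFun :=
    continuous_push.comp (continuous_fst.prodMk (f.continuous.comp continuous_snd))
  map_zero_left p := push_zero (f p)
  map_one_left _ := rfl

theorem radiallyHomotopic_retract {f : C(Surface, Surface)} (hf : ∀ p ∈ boundary, f p = p) :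
    RadiallyHomotopic f (retractMap.comp f) 0 1 := by
  refine ⟨pushHomotopy f, ⟨ContinuousMap.id _, rfl, rfl⟩, fun t p hp => ?_⟩
  change push t (f p) = push t p
  rw [hf p hp]

theorem RadiallyHomotopic.symm {f g : C(Surface, Surface)} {a b : unitInterval}
    (H : RadiallyHomotopic f g a b) : RadiallyHomotopic g f b a := by
  obtain ⟨K, τ, hK⟩ := H
  exact ⟨K.symm, τ.symm, fun t p hp => hK _ p hp⟩

/-- Push the values of `f` out to the square, deform there, and pull back in. Boundary points only
travel out and back along their own radii. -/
theorem radiallyHomotopic_id {f : HomeoFixingBoundary} (hf : Cover.act f = MonoidHom.id F₂) :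
    RadiallyHomotopic (toMap f) (ContinuousMap.id Surface) 0 0 := by
  obtain ⟨Φ, h0, h1, hb⟩ := Cover.exists_retract_homotopy hf
  have B : RadiallyHomotopic (retractMap.comp (toMap f))
      (retractMap.comp (ContinuousMap.id Surface)) 1 1 :=
    ⟨⟨Φ, h0, h1⟩, Path.refl 1, fun t p hp => hb t p hp⟩
  exact ((radiallyHomotopic_retract fun p hp => f.2 p hp).trans B).trans
    (radiallyHomotopic_retract fun p _ => rfl).symm

/-- The map collapsing the collar to the boundary. -/
def squeezeMap : C(Surface, Surface) :=
  ⟨squeeze 1, continuous_squeeze.comp (continuous_const.prodMk continuous_id)⟩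

theorem squeezeMap_mem {p : Surface} (h : radius p.1 ≤ 3 / 8) : squeezeMap p ∈ boundary :=
  squeeze_one_mem h

theorem squeezeMap_boundary {p : Surface} (hp : p ∈ boundary) : squeezeMap p = p :=
  squeeze_boundary 1 hp

theorem homotopicRel_squeezeMap : (ContinuousMap.id Surface).HomotopicRel squeezeMap boundary :=
  ⟨{ toFun := fun q => squeeze q.1 q.2
     continuous_toFun := continuous_squeeze
     map_zero_left := squeeze_zero
     map_one_left := fun _ => rfl
     prop' := fun t _ hp => squeeze_boundary t hp }⟩

/-- A radial homotopy precomposed with the collapse of the collar, straightened over the collar. -/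
def straighten (K : C(unitInterval × Surface, Surface)) (τ : C(unitInterval, unitInterval))
    (q : unitInterval × Surface) : Surface :=
  if 3 / 8 ≤ radius q.2.1 then K (q.1, squeezeMap q.2)
    else push (min (τ q.1) (collar q.2)) (squeezeMap q.2)

/-- Over the collar the squeezed point lies on the boundary, where `K` is a push by `τ`. Capping
this push by `collar` freezes the boundary and changes nothing at radius `3 / 8`, so the two
branches agree there. -/
theorem continuous_straighten {K : C(unitInterval × Surface, Surface)}
    {τ : C(unitInterval, unitInterval)} (hK : ∀ t, ∀ p ∈ boundary, K (t, p) = push (τ t) p) :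
    Continuous (straighten K τ) := by
  refine Continuous.if_le ?_ ?_ continuous_const
    (continuous_radius.comp (continuous_subtype_val.comp continuous_snd)) fun q hq => ?_
  · exact K.continuous.comp (continuous_fst.prodMk (squeezeMap.continuous.comp continuous_snd))
  · exact continuous_push.comp (((τ.continuous.comp continuous_fst).min
      (continuous_collar.comp continuous_snd)).prodMk (squeezeMap.continuous.comp continuous_snd))
  · rw [hK _ _ (squeezeMap_mem hq.ge), collar_eq_one hq.le, min_eq_left unitInterval.le_one']

theorem RadiallyHomotopic.homotopicRel {f g : C(Surface, Surface)} (hf : ∀ p ∈ boundary, f p = p)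
    (hg : ∀ p ∈ boundary, g p = p) (H : RadiallyHomotopic f g 0 0) :
    (f.comp squeezeMap).HomotopicRel (g.comp squeezeMap) boundary := by
  obtain ⟨K, τ, hK⟩ := H
  refine ⟨{ toFun := straighten K.toContinuousMap τ.toContinuousMap
            continuous_toFun := continuous_straighten hK
            map_zero_left := fun p => ?_
            map_one_left := fun p => ?_
            prop' := fun t p hp => ?_ }⟩
  · change (if 3 / 8 ≤ radius p.1 then K (0, squeezeMap p)
      else push (min (τ 0) (collar p)) (squeezeMap p)) = f (squeezeMap p)
    split_ifs with h
    · exact K.apply_zero _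
    · rw [τ.source, min_eq_left unitInterval.nonneg', push_zero,
        hf _ (squeezeMap_mem (not_le.1 h).le)]
  · change (if 3 / 8 ≤ radius p.1 then K (1, squeezeMap p)
      else push (min (τ 1) (collar p)) (squeezeMap p)) = g (squeezeMap p)
    split_ifs with h
    · exact K.apply_one _
    · rw [τ.target, min_eq_left unitInterval.nonneg', push_zero,
        hg _ (squeezeMap_mem (not_le.1 h).le)]
  · have hp' : radius p.1 = 1 / 4 := hp
    change (if 3 / 8 ≤ radius p.1 then K (t, squeezeMap p)
      else push (min (τ t) (collar p)) (squeezeMap p)) = f (squeezeMap p)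
    rw [if_neg (by rw [hp']; norm_num), collar_boundary hp,
      min_eq_right unitInterval.nonneg', push_zero, squeezeMap_boundary hp, hf p hp]

theorem homotopicToId_of_act_eq {f : HomeoFixingBoundary} (hf : Cover.act f = MonoidHom.id F₂) :
    f ∈ HomotopicToId := by
  have D : (toMap f).HomotopicRel ((toMap f).comp squeezeMap) boundary := by
    have := homotopicRel_squeezeMap.comp_continuousMap (toMap f)
    rwa [ContinuousMap.comp_id] at this
  have E := (radiallyHomotopic_id hf).homotopicRel (fun p hp => f.2 p hp) fun p _ => rfl
  rw [ContinuousMap.id_comp] at E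
  exact (D.trans E).trans homotopicRel_squeezeMap.symm

theorem mcgAct_injective : Function.Injective mcgAct := by
  intro φ ψ h
  obtain ⟨f, rfl⟩ := QuotientGroup.mk_surjective φ
  obtain ⟨g, rfl⟩ := QuotientGroup.mk_surjective ψ
  refine QuotientGroup.eq.2 (homotopicToId_of_act_eq ?_)
  have h' : Cover.act f = Cover.act g := h
  rw [Cover.act_mul, ← h', ← Cover.act_mul, inv_mul_cancel, Cover.act_one]

end OneHoledTorus
end

noncomputable section
namespace OneHoledTorus

/-! ### Points of edges with clamped parameter -/

/-- The point of an edge with the given parameter, cut off to the unit interval. -/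
def Tree.at (g : F₂) (l : Bool × Bool) (s : ℝ) : Tree := Tree.edge g l (clamp s) (clamp_mem s)

theorem Tree.at_eq_edge (g : F₂) (l : Bool × Bool) {s : ℝ} (hs : s ∈ Set.Icc (0 : ℝ) 1) :
    Tree.at g l s = Tree.edge g l s hs := by
  simp only [Tree.at, clamp_of_mem hs]

theorem Tree.continuous_at (g : F₂) (l : Bool × Bool) : Continuous (Tree.at g l) := by
  refine Tree.continuous_of_coord fun k => ?_
  change Continuous fun s => edgePoint g l (clamp s) k
  have := continuous_clamp
  unfold edgePoint
  refine Continuous.add ?_ ?_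
  · split_ifs <;> fun_prop
  · split_ifs <;> fun_prop

theorem Tree.smul_at (g h : F₂) (l : Bool × Bool) (s : ℝ) : g • Tree.at h l s = Tree.at (g * h) l s :=
  Tree.smul_edge _ _ _ _ _

theorem Tree.at_zero (g : F₂) (l m : Bool × Bool) : Tree.at g l 0 = Tree.at g m 0 := by
  rw [Tree.at_eq_edge g l ⟨le_rfl, zero_le_one⟩, Tree.at_eq_edge g m ⟨le_rfl, zero_le_one⟩]
  exact Tree.ext fun k => congrFun (edgePoint_zero g l m) k

theorem Tree.at_one (g : F₂) (l m : Bool × Bool) : Tree.at g l 1 = Tree.at (g * letter l) m 0 := by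
  rw [Tree.at_zero _ m (bar l), Tree.at_eq_edge g l ⟨zero_le_one, le_rfl⟩,
    Tree.at_eq_edge _ _ ⟨le_rfl, zero_le_one⟩]
  refine (Tree.edge_reverse _ _ _ _).trans ?_
  congr 1
  exact sub_self _

theorem proj_at_false (g : F₂) {s : ℝ} (hs : s ∈ Set.Icc (0 : ℝ) 1) :
    (proj (Tree.at g (false, true) s)).1 =
      (((1 / 2 + s : ℝ) : UnitAddCircle), ((1 / 2 : ℝ) : UnitAddCircle)) := by
  rw [Tree.at_eq_edge _ _ hs]
  exact (ofComplex_develop_edge _ _ _ _).trans (ofComplex_edge_false s)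

theorem proj_at_true (g : F₂) {s : ℝ} (hs : s ∈ Set.Icc (0 : ℝ) 1) :
    (proj (Tree.at g (true, true) s)).1 =
      (((1 / 2 : ℝ) : UnitAddCircle), ((1 / 2 + s : ℝ) : UnitAddCircle)) := by
  rw [Tree.at_eq_edge _ _ hs]
  exact (ofComplex_develop_edge _ _ _ _).trans (ofComplex_edge_true s)

/-! ### The retraction in the four sectors -/

theorem coe_div_two_abs {r : ℝ} (hr : r ≠ 0) :
    ((1 / (2 * |r|) * r : ℝ) : UnitAddCircle) = ((1 / 2 : ℝ) : UnitAddCircle) := by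
  rcases abs_choice r with h | h <;> rw [h]
  · congr 1
    field_simp
  · have : 1 / (2 * -r) * r = 1 / 2 - 1 := by
      field_simp
      norm_num
    rw [this, AddCircle.coe_sub, AddCircle.coe_period, sub_zero]

theorem coe_half_add_half_add (r : ℝ) :
    ((1 / 2 + (1 / 2 + r) : ℝ) : UnitAddCircle) = (r : UnitAddCircle) := by
  have : (1 / 2 + (1 / 2 + r) : ℝ) = r + 1 := by ring
  rw [this, AddCircle.coe_add, AddCircle.coe_period, add_zero]

theorem half_add_div_mem {a b : ℝ} (hb : b ≠ 0) (h : |a| ≤ |b|) :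
    1 / 2 + a / (2 * |b|) ∈ Set.Icc (0 : ℝ) 1 := by
  have hb' : 0 < |b| := abs_pos.2 hb
  have h1 := abs_le.1 h
  have h2 : a / (2 * |b|) ≤ 1 / 2 := by
    rw [div_le_iff₀ (by linarith)]
    linarith
  have h3 : -(1 / 2) ≤ a / (2 * |b|) := by
    rw [le_div_iff₀ (by linarith)]
    linarith
  constructor <;> linarith

/-- In the left and right sectors the ray through `w` leaves the square on a vertical side, with
height determined by `w.im / |w.re|`. Any `g` will do, as `proj` is invariant under translation. -/
theorem retract_eq_proj_true (g : F₂) {w : ℂ} (h : supNorm w ≤ 1 / 2) (h' : 1 / 4 ≤ ‖w‖)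
    (h0 : w.re ≠ 0) (hw : |w.im| ≤ |w.re|) :
    retract (ofPlane w h h') = proj (Tree.at g (true, true) (1 / 2 + w.im / (2 * |w.re|))) := by
  refine Subtype.ext ?_
  rw [retract_ofPlane, proj_at_true g (half_add_div_mem h0 hw), supNorm, max_eq_left hw]
  refine Prod.ext ?_ ?_
  · simp only [ofComplex, Complex.re_ofReal_mul]
    exact coe_div_two_abs h0
  · simp only [ofComplex, Complex.im_ofReal_mul]
    rw [coe_half_add_half_add]
    congr 1
    ring

theorem retract_eq_proj_false (g : F₂) {w : ℂ} (h : supNorm w ≤ 1 / 2) (h' : 1 / 4 ≤ ‖w‖)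
    (h0 : w.im ≠ 0) (hw : |w.re| ≤ |w.im|) :
    retract (ofPlane w h h') = proj (Tree.at g (false, true) (1 / 2 + w.re / (2 * |w.im|))) := by
  refine Subtype.ext ?_
  rw [retract_ofPlane, proj_at_false g (half_add_div_mem h0 hw), supNorm, max_eq_right hw]
  refine Prod.ext ?_ ?_
  · simp only [ofComplex, Complex.re_ofReal_mul]
    rw [coe_half_add_half_add]
    congr 1
    ring
  · simp only [ofComplex, Complex.im_ofReal_mul]
    exact coe_div_two_abs h0

theorem circle_re (θ : ℝ) : (((1 / 4 : ℝ) : ℂ) * cis θ).re = 1 / 4 * Real.cos θ := by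
  rw [Complex.re_ofReal_mul, cis, Complex.exp_ofReal_mul_I_re]

theorem circle_im (θ : ℝ) : (((1 / 4 : ℝ) : ℂ) * cis θ).im = 1 / 4 * Real.sin θ := by
  rw [Complex.im_ofReal_mul, cis, Complex.exp_ofReal_mul_I_im]

theorem quarter_mul_div (a b : ℝ) : 1 / 4 * a / (2 * |1 / 4 * b|) = a / (2 * |b|) := by
  rw [abs_mul, abs_of_pos (by norm_num : (0 : ℝ) < 1 / 4),
    show 2 * (1 / 4 * |b|) = 1 / 4 * (2 * |b|) by ring, mul_div_mul_left _ _ (by norm_num)]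

theorem retract_circ_true (g : F₂) {θ : ℝ} (h : |Real.sin θ| ≤ |Real.cos θ|) :
    retract (circ θ) =
      proj (Tree.at g (true, true) (1 / 2 + Real.sin θ / (2 * |Real.cos θ|))) := by
  have h0 : Real.cos θ ≠ 0 := by
    intro e
    have h1 := Real.sin_sq_add_cos_sq θ
    rw [e, abs_zero, abs_nonpos_iff] at h
    rw [e, h] at h1
    norm_num at h1
  have := retract_eq_proj_true g (supNorm_circle_le θ) (norm_circle θ).ge
    (by rw [circle_re]; exact mul_ne_zero (by norm_num) h0)
    (by rw [circle_re, circle_im, abs_mul, abs_mul]; gcongr)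
  rwa [circle_re, circle_im, quarter_mul_div] at this

theorem retract_circ_false (g : F₂) {θ : ℝ} (h : |Real.cos θ| ≤ |Real.sin θ|) :
    retract (circ θ) =
      proj (Tree.at g (false, true) (1 / 2 + Real.cos θ / (2 * |Real.sin θ|))) := by
  have h0 : Real.sin θ ≠ 0 := by
    intro e
    have h1 := Real.sin_sq_add_cos_sq θ
    rw [e, abs_zero, abs_nonpos_iff] at h
    rw [e, h] at h1
    norm_num at h1
  have := retract_eq_proj_false g (supNorm_circle_le θ) (norm_circle θ).ge
    (by rw [circle_im]; exact mul_ne_zero (by norm_num) h0)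
    (by rw [circle_re, circle_im, abs_mul, abs_mul]; gcongr)
  rwa [circle_re, circle_im, quarter_mul_div] at this

theorem abs_sin_le_abs_cos {θ : ℝ} (h : 0 ≤ Real.cos (2 * θ)) : |Real.sin θ| ≤ |Real.cos θ| := by
  rw [Real.cos_two_mul] at h
  rw [← sq_le_sq]
  linarith [Real.sin_sq_add_cos_sq θ]

theorem abs_cos_le_abs_sin {θ : ℝ} (h : Real.cos (2 * θ) ≤ 0) : |Real.cos θ| ≤ |Real.sin θ| := by
  rw [Real.cos_two_mul] at h
  rw [← sq_le_sq]
  linarith [Real.sin_sq_add_cos_sq θ]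

namespace Cover

/-- By uniqueness of lifts, a continuous path in the tree with the right projection and the right
start is the tree coordinate of the lifted boundary; this continues it from one sector to the next.
-/
theorem height_ring_of_lift {s t : ℝ} (hst : s ≤ t) {b : ℝ → Tree}
    (hb : ContinuousOn b (Set.Icc s t)) (h : ∀ θ ∈ Set.Icc s t, retract (circ θ) = proj (b θ))
    (h0 : height (ring s) = b s) {θ : ℝ} (hθ : θ ∈ Set.Icc s t) : height (ring θ) = b θ := by
  have : PreconnectedSpace (Set.Icc s t) := Subtype.preconnectedSpace isPreconnected_Icc
  have key := eq_of_lifts (F := fun a : Set.Icc s t => ring a)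
    (G := fun a : Set.Icc s t => mk (circ a) (b a) (h a a.2)) (by fun_prop)
    (continuous_mk (continuous_circ.comp continuous_subtype_val) (continuousOn_iff_continuous_domRestrict.1 hb) _)
    (fun a => pr_ring a) ⟨s, le_rfl, hst⟩ (ext (pr_ring s) h0)
  exact congrArg height (congrFun key ⟨θ, hθ⟩)

theorem height_ring_true (g : F₂) {s t : ℝ} (hst : s ≤ t)
    (h : ∀ θ ∈ Set.Icc s t, 0 ≤ Real.cos (2 * θ))
    (h0 : height (ring s) = Tree.at g (true, true) (1 / 2 + Real.sin s / (2 * |Real.cos s|)))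
    {θ : ℝ} (hθ : θ ∈ Set.Icc s t) :
    height (ring θ) = Tree.at g (true, true) (1 / 2 + Real.sin θ / (2 * |Real.cos θ|)) := by
  refine height_ring_of_lift hst (b := fun θ => Tree.at g (true, true) (1 / 2 + Real.sin θ / (2 * |Real.cos θ|)))
    ?_ (fun θ hθ => retract_circ_true g (abs_sin_le_abs_cos (h θ hθ))) h0 hθ
  refine (Tree.continuous_at _ _).comp_continuousOn (continuousOn_const.add
    (Real.continuous_sin.continuousOn.div (by fun_prop) fun θ hθ => ?_))
  intro e
  have h1 := h θ hθ
  have h2 : Real.cos θ = 0 := by simpa using e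
  rw [Real.cos_two_mul, h2] at h1
  norm_num at h1

theorem height_ring_false (g : F₂) {s t : ℝ} (hst : s ≤ t)
    (h : ∀ θ ∈ Set.Icc s t, Real.cos (2 * θ) ≤ 0)
    (h0 : height (ring s) = Tree.at g (false, true) (1 / 2 + Real.cos s / (2 * |Real.sin s|)))
    {θ : ℝ} (hθ : θ ∈ Set.Icc s t) :
    height (ring θ) = Tree.at g (false, true) (1 / 2 + Real.cos θ / (2 * |Real.sin θ|)) := by
  refine height_ring_of_lift hst (b := fun θ => Tree.at g (false, true) (1 / 2 + Real.cos θ / (2 * |Real.sin θ|)))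
    ?_ (fun θ hθ => retract_circ_false g (abs_cos_le_abs_sin (h θ hθ))) h0 hθ
  refine (Tree.continuous_at _ _).comp_continuousOn (continuousOn_const.add
    (Real.continuous_cos.continuousOn.div (by fun_prop) fun θ hθ => ?_))
  intro e
  have h1 := h θ hθ
  have h2 : Real.sin θ = 0 := by simpa using e
  rw [Real.cos_two_mul, Real.cos_sq', h2] at h1
  norm_num at h1

theorem height_base : height base = Tree.at 1 (true, true) (1 / 2) :=
  (Tree.at_eq_edge 1 (true, true) (s := 1 / 2) (by constructor <;> norm_num)).symm

theorem half_add_of_eq {a b : ℝ} (hb : b ≠ 0) (h : a = |b|) : 1 / 2 + a / (2 * |b|) = 1 := by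
  have : |b| ≠ 0 := by simpa using hb
  rw [h]
  field_simp
  norm_num

theorem half_add_of_eq_neg {a b : ℝ} (hb : b ≠ 0) (h : a = -|b|) : 1 / 2 + a / (2 * |b|) = 0 := by
  have : |b| ≠ 0 := by simpa using hb
  rw [h]
  field_simp
  norm_num

theorem sqrt_two_div_two_pos : 0 < √2 / 2 := by positivity

theorem cos_three : Real.cos (3 * π / 4) = -(√2 / 2) := by
  rw [show 3 * π / 4 = π - π / 4 by ring, Real.cos_pi_sub, Real.cos_pi_div_four]

theorem sin_three : Real.sin (3 * π / 4) = √2 / 2 := by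
  rw [show 3 * π / 4 = π - π / 4 by ring, Real.sin_pi_sub, Real.sin_pi_div_four]

theorem cos_five : Real.cos (5 * π / 4) = -(√2 / 2) := by
  rw [show 5 * π / 4 = π / 4 + π by ring, Real.cos_add_pi, Real.cos_pi_div_four]

theorem sin_five : Real.sin (5 * π / 4) = -(√2 / 2) := by
  rw [show 5 * π / 4 = π / 4 + π by ring, Real.sin_add_pi, Real.sin_pi_div_four]

theorem cos_seven : Real.cos (7 * π / 4) = √2 / 2 := by
  rw [show 7 * π / 4 = 2 * π - π / 4 by ring, Real.cos_two_pi_sub, Real.cos_pi_div_four]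

theorem sin_seven : Real.sin (7 * π / 4) = -(√2 / 2) := by
  rw [show 7 * π / 4 = 2 * π - π / 4 by ring, Real.sin_two_pi_sub, Real.sin_pi_div_four]

theorem cos_two_mul_nonneg {k : ℕ} {θ : ℝ} (h : θ ∈ Set.Icc (k * π - π / 4) (k * π + π / 4)) :
    0 ≤ Real.cos (2 * θ) := by
  have e : Real.cos (2 * θ) = Real.cos (2 * θ - k * (2 * π)) := (Real.cos_sub_nat_mul_two_pi _ _).symm
  rw [e]
  exact Real.cos_nonneg_of_neg_pi_div_two_le_of_le (by linarith [h.1]) (by linarith [h.2])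

theorem cos_two_mul_nonpos {k : ℕ} {θ : ℝ} (h : θ ∈ Set.Icc (k * π + π / 4) (k * π + 3 * π / 4)) :
    Real.cos (2 * θ) ≤ 0 := by
  have e : Real.cos (2 * θ) = Real.cos (2 * θ - k * (2 * π)) := (Real.cos_sub_nat_mul_two_pi _ _).symm
  rw [e]
  exact Real.cos_nonpos_of_pi_div_two_le_of_le (by linarith [h.1]) (by linarith [h.2])

/-- First of five sectors, counterclockwise from the middle of the right side. The tree path follows
the right side up, the top leftwards, the left side down and the bottom rightwards, which spells
`genB * genA⁻¹ * genB⁻¹ * genA`, that is `bdry`. -/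
theorem height_ring_right {θ : ℝ} (h : θ ∈ Set.Icc 0 (π / 4)) :
    height (ring θ) = Tree.at 1 (true, true) (1 / 2 + Real.sin θ / (2 * |Real.cos θ|)) := by
  have := Real.pi_pos
  refine height_ring_true 1 (s := 0) (t := π / 4) (by linarith) (fun θ hθ => ?_) ?_ h
  · exact cos_two_mul_nonneg (k := 0) ⟨by push_cast; linarith [hθ.1], by push_cast; linarith [hθ.2]⟩
  · rw [ring_zero, height_base, Real.sin_zero, zero_div, add_zero]

theorem height_ring_top {θ : ℝ} (h : θ ∈ Set.Icc (π / 4) (3 * π / 4)) :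
    height (ring θ) =
      Tree.at (genB * genA⁻¹) (false, true) (1 / 2 + Real.cos θ / (2 * |Real.sin θ|)) := by
  have hp := Real.pi_pos
  have h2 := sqrt_two_div_two_pos
  refine height_ring_false _ (s := π / 4) (t := 3 * π / 4) (by linarith) (fun θ hθ => ?_) ?_ h
  · exact cos_two_mul_nonpos (k := 0) ⟨by push_cast; linarith [hθ.1], by push_cast; linarith [hθ.2]⟩
  · rw [height_ring_right ⟨by linarith, le_rfl⟩, Real.sin_pi_div_four, Real.cos_pi_div_four,
      half_add_of_eq h2.ne' (abs_of_pos h2).symm, Tree.at_one _ _ (true, true),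
      Tree.at_one _ _ (true, true), one_mul]
    congr 1
    exact (inv_mul_cancel_right _ _).symm

theorem height_ring_left {θ : ℝ} (h : θ ∈ Set.Icc (3 * π / 4) (5 * π / 4)) :
    height (ring θ) = Tree.at (genB * genA⁻¹ * genB⁻¹) (true, true)
      (1 / 2 + Real.sin θ / (2 * |Real.cos θ|)) := by
  have hp := Real.pi_pos
  have h2 := sqrt_two_div_two_pos
  refine height_ring_true _ (s := 3 * π / 4) (t := 5 * π / 4) (by linarith) (fun θ hθ => ?_) ?_ h
  · exact cos_two_mul_nonneg (k := 1) ⟨by push_cast; linarith [hθ.1], by push_cast; linarith [hθ.2]⟩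
  · rw [height_ring_top ⟨by linarith, le_rfl⟩, sin_three, cos_three,
      half_add_of_eq_neg h2.ne' (by rw [abs_of_pos h2]),
      half_add_of_eq (neg_ne_zero.2 h2.ne') (by rw [abs_neg, abs_of_pos h2]),
      Tree.at_one _ _ (false, true)]
    congr 1
    exact (inv_mul_cancel_right _ _).symm

theorem height_ring_bottom {θ : ℝ} (h : θ ∈ Set.Icc (5 * π / 4) (7 * π / 4)) :
    height (ring θ) = Tree.at (genB * genA⁻¹ * genB⁻¹) (false, true)
      (1 / 2 + Real.cos θ / (2 * |Real.sin θ|)) := by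
  have hp := Real.pi_pos
  have h2 := sqrt_two_div_two_pos
  refine height_ring_false _ (s := 5 * π / 4) (t := 7 * π / 4) (by linarith) (fun θ hθ => ?_) ?_ h
  · exact cos_two_mul_nonpos (k := 1) ⟨by push_cast; linarith [hθ.1], by push_cast; linarith [hθ.2]⟩
  · rw [height_ring_left ⟨by linarith, le_rfl⟩, sin_five, cos_five,
      half_add_of_eq_neg (neg_ne_zero.2 h2.ne') (by rw [abs_neg, abs_of_pos h2])]
    exact Tree.at_zero _ _ _

theorem height_ring_last {θ : ℝ} (h : θ ∈ Set.Icc (7 * π / 4) (2 * π)) :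
    height (ring θ) = Tree.at bdry (true, true) (1 / 2 + Real.sin θ / (2 * |Real.cos θ|)) := by
  have hp := Real.pi_pos
  have h2 := sqrt_two_div_two_pos
  refine height_ring_true _ (s := 7 * π / 4) (t := 2 * π) (by linarith) (fun θ hθ => ?_) ?_ h
  · exact cos_two_mul_nonneg (k := 2) ⟨by push_cast; linarith [hθ.1], by push_cast; linarith [hθ.2]⟩
  · rw [height_ring_bottom ⟨by linarith, le_rfl⟩, sin_seven, cos_seven,
      half_add_of_eq (neg_ne_zero.2 h2.ne') (by rw [abs_neg, abs_of_pos h2]),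
      half_add_of_eq_neg h2.ne' (by rw [abs_of_pos h2])]
    exact Tree.at_one _ _ _

theorem height_ring_pi_div_two :
    height (ring (π / 2)) = Tree.at (genB * genA⁻¹) (false, true) (1 / 2) := by
  have hp := Real.pi_pos
  rw [height_ring_top ⟨by linarith, by linarith⟩, Real.cos_pi_div_two, zero_div, add_zero]

theorem height_ring_pi :
    height (ring π) = Tree.at (genB * genA⁻¹ * genB⁻¹) (true, true) (1 / 2) := by
  have hp := Real.pi_pos
  rw [height_ring_left ⟨by linarith, by linarith⟩, Real.sin_pi, zero_div, add_zero]

theorem height_ring_three_pi_div_two :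
    height (ring (3 * π / 2)) = Tree.at (genB * genA⁻¹ * genB⁻¹) (false, true) (1 / 2) := by
  have hp := Real.pi_pos
  have : Real.cos (3 * π / 2) = 0 := by
    rw [show 3 * π / 2 = π / 2 + π by ring, Real.cos_add_pi, Real.cos_pi_div_two, neg_zero]
  rw [height_ring_bottom ⟨by linarith, by linarith⟩, this, zero_div, add_zero]

theorem circ_add_two_pi (θ : ℝ) : circ (θ + 2 * π) = circ θ := by
  have : cis (θ + 2 * π) = cis θ := by
    unfold cis
    push_cast
    rw [add_mul, Complex.exp_add, Complex.exp_two_pi_mul_I, mul_one]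
  simp only [circ, this]

theorem ring_two_pi : ring (2 * π) = bdry • base := by
  have hp := Real.pi_pos
  refine ext ?_ ?_
  · rw [pr_ring, pr_smul, pr_base, ← circ_zero, ← circ_add_two_pi 0, zero_add]
  · rw [height_ring_last ⟨by linarith, le_rfl⟩, Real.sin_two_pi, zero_div, add_zero, height_smul,
      height_base, Tree.smul_at, mul_one]

theorem ring_add_two_pi (θ : ℝ) : ring (θ + 2 * π) = bdry • ring θ :=
  congrFun (eq_of_lifts (F := fun θ => ring (θ + 2 * π)) (G := fun θ => bdry • ring θ)
    (by fun_prop) ((continuous_smul _).comp ring.continuous)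
    (fun θ => by rw [pr_ring, pr_smul, pr_ring, circ_add_two_pi]) 0
    (by rw [zero_add, ring_zero, ring_two_pi])) θ

/-- Every lift fixes the lifted boundary line pointwise, and one turn along it is the translation by
`bdry`. -/
theorem act_bdry (f : HomeoFixingBoundary) : act f bdry = bdry :=
  smul_base_injective (by rw [act_smul_base, ← ring_two_pi, lift_ring])

end Cover
end OneHoledTorus
end

noncomputable section
namespace OneHoledTorus
namespace Cover

/-! ### Crossing arcs fixed by the twists -/

theorem lift_eq_of_path {A : Type*} [TopologicalSpace A] [PreconnectedSpace A]
    (f : HomeoFixingBoundary) {Γ : A → Cover} (hΓ : Continuous Γ)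
    (h : ∀ a, toMap f (pr (Γ a)) = pr (Γ a)) (a₀ : A) (h0 : lift f (Γ a₀) = Γ a₀) (a : A) :
    lift f (Γ a) = Γ a :=
  congrFun (eq_of_lifts (F := fun a => lift f (Γ a)) ((lift f).continuous.comp hΓ) hΓ
    (fun a => by rw [pr_lift, h]) a₀ h0) a

theorem act_eq_of_lift_eq {f : HomeoFixingBoundary} {g : F₂} {e : Cover} (h : lift f e = e)
    (h' : lift f (g • e) = g • e) : act f g = g := by
  rw [lift_smul, h] at h'
  have := isQuotientCoveringMap_pr.isCancelSMul
  exact IsCancelSMul.right_cancel _ _ _ h'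

theorem quarter_le_norm_coe {u : ℝ} (hu : u ∈ Set.Icc (1 / 4 : ℝ) (3 / 4)) :
    1 / 4 ≤ ‖(u : UnitAddCircle)‖ := by
  rcases le_total u (1 / 2) with h | h
  · rw [norm_coe_circle (by rw [abs_of_nonneg (by linarith [hu.1])]; exact h),
      abs_of_nonneg (by linarith [hu.1])]
    exact hu.1
  · have e : (u : UnitAddCircle) = ((u - 1 : ℝ) : UnitAddCircle) := by
      rw [AddCircle.coe_sub, AddCircle.coe_period, sub_zero]
    have h1 : |u - 1| = 1 - u := by rw [abs_of_nonpos (by linarith [hu.2])]; ring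
    rw [e, norm_coe_circle (by rw [h1]; linarith), h1]
    linarith [hu.2]

theorem coord_zero : coord 0 = 0 := by
  have := coord_coe (r := 0) (by norm_num)
  simpa using this

/-- The arc crossing the right edge of the square, joining opposite points of the boundary. -/
def horizontalArc (u : Set.Icc (1 / 4 : ℝ) (3 / 4)) : Surface :=
  ⟨((u : ℝ), 0), (quarter_le_norm_coe u.2).trans
    (norm_fst_le_radius (((u : ℝ) : UnitAddCircle), (0 : UnitAddCircle)))⟩

/-- The arc crossing the top edge of the square, joining opposite points of the boundary. -/
def verticalArc (u : Set.Icc (1 / 4 : ℝ) (3 / 4)) : Surface :=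
  ⟨(0, (u : ℝ)), (quarter_le_norm_coe u.2).trans
    (norm_snd_le_radius ((0 : UnitAddCircle), ((u : ℝ) : UnitAddCircle)))⟩

theorem eq_ofPlane (p : Surface) : p = ofPlane (toComplex p.1)
    (by rw [supNorm_toComplex]; exact norm_le_half _) (by rw [← radius_eq]; exact p.2) :=
  Subtype.ext (ofComplex_toComplex _).symm

theorem coord_ne_zero {t : UnitAddCircle} (h : 1 / 4 ≤ ‖t‖) : coord t ≠ 0 := by
  intro e
  rw [norm_eq_abs_coord, e, abs_zero] at h
  norm_num at h

theorem retract_horizontalArc (g : F₂) (u : Set.Icc (1 / 4 : ℝ) (3 / 4)) :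
    retract (horizontalArc u) = proj (Tree.at g (true, true) (1 / 2)) := by
  have hc : (toComplex (horizontalArc u).1).im = 0 := coord_zero
  have hc' : (toComplex (horizontalArc u).1).re ≠ 0 := coord_ne_zero (quarter_le_norm_coe u.2)
  rw [eq_ofPlane (horizontalArc u), retract_eq_proj_true g _ _ hc'
    (by rw [hc, abs_zero]; exact abs_nonneg _), hc, zero_div, add_zero]

theorem retract_verticalArc (g : F₂) (u : Set.Icc (1 / 4 : ℝ) (3 / 4)) :
    retract (verticalArc u) = proj (Tree.at g (false, true) (1 / 2)) := by
  have hc : (toComplex (verticalArc u).1).re = 0 := coord_zero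
  have hc' : (toComplex (verticalArc u).1).im ≠ 0 := coord_ne_zero (quarter_le_norm_coe u.2)
  rw [eq_ofPlane (verticalArc u), retract_eq_proj_false g _ _ hc'
    (by rw [hc, abs_zero]; exact abs_nonneg _), hc, zero_div, add_zero]

theorem circ_pi : circ π = horizontalArc ⟨3 / 4, by norm_num, le_rfl⟩ := by
  refine Subtype.ext (Prod.ext ?_ ?_)
  · change ((((1 / 4 : ℝ) : ℂ) * cis π).re : UnitAddCircle) = ((3 / 4 : ℝ) : UnitAddCircle)
    rw [circle_re, Real.cos_pi, show (3 / 4 : ℝ) = 1 / 4 * -1 + 1 by norm_num, AddCircle.coe_add,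
      AddCircle.coe_period, add_zero]
  · change ((((1 / 4 : ℝ) : ℂ) * cis π).im : UnitAddCircle) = 0
    rw [circle_im, Real.sin_pi, mul_zero, AddCircle.coe_zero]

theorem circ_pi_div_two : circ (π / 2) = verticalArc ⟨1 / 4, le_rfl, by norm_num⟩ := by
  refine Subtype.ext (Prod.ext ?_ ?_)
  · change ((((1 / 4 : ℝ) : ℂ) * cis (π / 2)).re : UnitAddCircle) = 0
    rw [circle_re, Real.cos_pi_div_two, mul_zero, AddCircle.coe_zero]
  · change ((((1 / 4 : ℝ) : ℂ) * cis (π / 2)).im : UnitAddCircle) = ((1 / 4 : ℝ) : UnitAddCircle)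
    rw [circle_im, Real.sin_pi_div_two, mul_one]

theorem circ_three_pi_div_two : circ (3 * π / 2) = verticalArc ⟨3 / 4, by norm_num, le_rfl⟩ := by
  have h : 3 * π / 2 = π / 2 + π := by ring
  refine Subtype.ext (Prod.ext ?_ ?_)
  · change ((((1 / 4 : ℝ) : ℂ) * cis (3 * π / 2)).re : UnitAddCircle) = 0
    rw [circle_re, h, Real.cos_add_pi, Real.cos_pi_div_two, neg_zero, mul_zero, AddCircle.coe_zero]
  · change ((((1 / 4 : ℝ) : ℂ) * cis (3 * π / 2)).im : UnitAddCircle) =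
      ((3 / 4 : ℝ) : UnitAddCircle)
    rw [circle_im, h, Real.sin_add_pi, Real.sin_pi_div_two,
      show (3 / 4 : ℝ) = 1 / 4 * -1 + 1 by norm_num, AddCircle.coe_add, AddCircle.coe_period, add_zero]

theorem continuous_horizontalArc : Continuous horizontalArc :=
  Continuous.subtype_mk (((AddCircle.continuous_mk' 1).comp continuous_subtype_val).prodMk
    continuous_const) _

theorem continuous_verticalArc : Continuous verticalArc :=
  Continuous.subtype_mk (continuous_const.prodMk
    ((AddCircle.continuous_mk' 1).comp continuous_subtype_val)) _

instance : PreconnectedSpace (Set.Icc (1 / 4 : ℝ) (3 / 4)) :=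
  Subtype.preconnectedSpace isPreconnected_Icc

/-- The lift of the arc starting at the base point is fixed, so its far end is fixed; a translate of
that end by `genB * genA⁻¹ * genB⁻¹` lies on the fixed boundary line. Hence this element is fixed,
and comparison with `bdry` isolates `genA`. -/
theorem act_genA_of_fix {f : HomeoFixingBoundary} (h : ∀ u, toMap f (horizontalArc u) = horizontalArc u) :
    act f genA = genA := by
  let Γ := fun u => mk (horizontalArc u) (Tree.at 1 (true, true) (1 / 2)) (retract_horizontalArc 1 u)
  have e0 : Γ ⟨1 / 4, le_rfl, by norm_num⟩ = base := ext rfl height_base.symm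
  have e1 : ring π = (genB * genA⁻¹ * genB⁻¹) • Γ ⟨3 / 4, by norm_num, le_rfl⟩ := by
    refine ext ((pr_ring π).trans circ_pi) ?_
    rw [height_ring_pi, height_smul]
    change _ = (genB * genA⁻¹ * genB⁻¹) • Tree.at 1 (true, true) (1 / 2)
    rw [Tree.smul_at, mul_one]
  have hΓ : Continuous Γ := continuous_mk continuous_horizontalArc continuous_const _
  have h1 := lift_eq_of_path f hΓ h _ (by rw [e0, lift_base]) ⟨3 / 4, by norm_num, le_rfl⟩
  have h2 : act f (genB * genA⁻¹ * genB⁻¹) = genB * genA⁻¹ * genB⁻¹ :=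
    act_eq_of_lift_eq h1 (by rw [← e1, lift_ring])
  have h3 := act_bdry f
  rw [bdry, map_mul, h2] at h3
  exact mul_left_cancel h3

/-- Here the lifted arc joins the boundary line at angle `π / 2` to a translate of it at angle `3 *
π / 2`; the translating element is fixed, and its product with `bdry` is `genB`. -/
theorem act_genB_of_fix {f : HomeoFixingBoundary} (h : ∀ u, toMap f (verticalArc u) = verticalArc u) :
    act f genB = genB := by
  let Γ := fun u => mk (verticalArc u) (Tree.at (genB * genA⁻¹) (false, true) (1 / 2))
    (retract_verticalArc _ u)
  have e0 : Γ ⟨1 / 4, le_rfl, by norm_num⟩ = ring (π / 2) :=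
    ext (((pr_ring _).trans circ_pi_div_two).symm) height_ring_pi_div_two.symm
  have e1 : Γ ⟨3 / 4, by norm_num, le_rfl⟩ =
      (genB * genA⁻¹ * genB * genA * genB⁻¹) • ring (3 * π / 2) := by
    refine ext ((pr_ring _).trans circ_three_pi_div_two).symm ?_
    rw [height_smul, height_ring_three_pi_div_two, Tree.smul_at]
    change Tree.at (genB * genA⁻¹) (false, true) (1 / 2) = _
    congr 1
    group
  have hΓ : Continuous Γ := continuous_mk continuous_verticalArc continuous_const _
  have h1 := lift_eq_of_path f hΓ h _ (by rw [e0, lift_ring]) ⟨3 / 4, by norm_num, le_rfl⟩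
  have h2 : act f (genB * genA⁻¹ * genB * genA * genB⁻¹) = genB * genA⁻¹ * genB * genA * genB⁻¹ :=
    act_eq_of_lift_eq (lift_ring f _) (by rw [← e1, h1])
  have h3 := act_bdry f
  have h4 : (genB * genA⁻¹ * genB * genA * genB⁻¹) * bdry = genB := by
    rw [bdry]
    group
  rw [← h4, map_mul, h2, h3]

/-! ### The developing map of the cover -/

/-- The displacement from a point of the surface to its retraction, in the plane. -/
def displacement (p : Surface) : ℂ := ((1 / (2 * ‖p.1‖) - 1 : ℝ) : ℂ) * toComplex p.1

theorem continuous_displacement : Continuous displacement := by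
  refine continuous_mul_toComplex ?_ continuous_subtype_val fun p hp => ?_
  · exact (continuous_const.div (by fun_prop) fun p => by have := p.norm_pos; positivity).sub
      continuous_const
  · rw [hp]
    norm_num

/-- The developing map of the cover to the plane. -/
def dev (e : Cover) : ℂ := develop (height e) - displacement (pr e)

theorem continuous_dev : Continuous dev :=
  (continuous_develop.comp continuous_height).sub (continuous_displacement.comp continuous_pr)

theorem ofComplex_dev (e : Cover) : ofComplex (dev e) = (pr e).1 := by
  have h1 : ofComplex (develop (height e)) = (retract (pr e)).1 := by rw [retract_pr]; rfl
  have h2 : (retract (pr e)).1 = ofComplex (toComplex (pr e).1 + displacement (pr e)) := by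
    rw [displacement]
    conv_lhs => rw [eq_ofPlane (pr e)]
    rw [retract_ofPlane, supNorm_toComplex]
    congr 1
    push_cast
    ring
  have h3 : ofComplex (dev e) + ofComplex (displacement (pr e)) =
      (pr e).1 + ofComplex (displacement (pr e)) := by
    rw [← ofComplex_add, dev, sub_add_cancel, h1, h2, ofComplex_add, ofComplex_toComplex]
  exact add_right_cancel h3

theorem dev_smul (g : F₂) (e : Cover) : dev (g • e) = latticePoint g + dev e := by
  have : develop (g • height e) = latticePoint g + develop (height e) := by
    obtain ⟨h, l, s, hs, he⟩ := (height e).exists_edge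
    rw [he, Tree.smul_edge, develop_edge, develop_edge, latticePoint_mul]
    ring
  rw [dev, dev, height_smul, this, pr_smul]
  ring

/-- Such a function takes integer values on a connected space. -/
theorem eq_of_coe_eq_zero {q : Cover → ℝ} (hq : Continuous q)
    (h : ∀ e, (q e : UnitAddCircle) = 0) (e e' : Cover) : q e = q e' := by
  refine isPreconnected_univ.constant_of_mapsTo (T := Set.range ((↑) : ℤ → ℝ))
    Int.isClosedEmbedding_coe_real.isInducing.isDiscrete_range hq.continuousOn (fun e _ => ?_) (Set.mem_univ e) (Set.mem_univ e')
  obtain ⟨n, hn⟩ := (AddCircle.coe_eq_zero_iff 1).1 (h e)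
  exact ⟨n, by simpa using hn⟩

/-! ### The action of the twists -/

/-- The difference of the shift and the identity of the circle, as a real function. -/
def shiftPart : UnitAddCircle → ℝ := AddCircle.liftIco 1 0 fun t => ramp t - t

theorem continuous_shiftPart : Continuous shiftPart := by
  refine AddCircle.liftIco_continuous ?_ ?_
  · norm_num [ramp]
  · unfold ramp
    fun_prop

theorem shift_eq (t : UnitAddCircle) : shift t = t + (shiftPart t : UnitAddCircle) := by
  have h := (AddCircle.equivIco 1 0 t).2
  have e : ((AddCircle.equivIco 1 0 t : ℝ) : UnitAddCircle) = t :=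
    (AddCircle.equivIco 1 0).symm_apply_apply t
  rw [← e, shift, shiftPart, AddCircle.liftIco_coe_apply h, AddCircle.liftIco_coe_apply h,
    ← AddCircle.coe_add]
  congr 1
  ring

/-- The homeomorphism representing `x`. -/
def twistX : HomeoFixingBoundary :=
  restrict shearX (radius_iff _ shearX_fix) fun p hp => shearX_fix p hp.le

/-- The homeomorphism representing `y`. -/
def twistY : HomeoFixingBoundary :=
  restrict shearY (radius_iff _ shearY_fix) fun p hp => shearY_fix p hp.le

theorem toMap_twistX (p : Surface) : (toMap twistX p).1 = (p.1.1 + shift p.1.2, p.1.2) := rfl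

theorem toMap_twistY (p : Surface) : (toMap twistY p).1 = (p.1.1, p.1.2 - shift p.1.1) := rfl

theorem coe_dev_re (e : Cover) : ((dev e).re : UnitAddCircle) = (pr e).1.1 :=
  congrArg Prod.fst (ofComplex_dev e)

theorem coe_dev_im (e : Cover) : ((dev e).im : UnitAddCircle) = (pr e).1.2 :=
  congrArg Prod.snd (ofComplex_dev e)

/-- In plane coordinates the lift of the shear is the linear shear plus a deck-invariant function,
up to an integer that must be constant. Comparing the points `g • base` and `base` leaves the linear
part on the lattice. -/
theorem fst_act_twistX (g : F₂) :
    (heis (act twistX g)).fst = (heis g).fst + (heis g).snd := by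
  let q : Cover → ℝ := fun e =>
    (dev (lift twistX e)).re - (dev e).re - (dev e).im - shiftPart (pr e).1.2
  have hq : Continuous q := by
    have h1 := continuous_dev
    have h2 := continuous_shiftPart.comp (continuous_snd.comp (continuous_subtype_val.comp continuous_pr))
    have h3 := h1.comp (lift twistX).continuous
    exact (((Complex.continuous_re.comp h3).sub (Complex.continuous_re.comp h1)).sub
      (Complex.continuous_im.comp h1)).sub h2
  have h0 : ∀ e, (q e : UnitAddCircle) = 0 := by
    intro e
    simp only [q, AddCircle.coe_sub, coe_dev_re, coe_dev_im, pr_lift, toMap_twistX, shift_eq]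
    abel
  have h := eq_of_coe_eq_zero hq h0 (g • base) base
  simp only [q, lift_smul, lift_base, dev_smul, pr_smul, Complex.add_re, Complex.add_im] at h
  have h' : (latticePoint (act twistX g)).re = (latticePoint g).re + (latticePoint g).im := by
    linarith
  have h'' : ((heis (act twistX g)).fst : ℝ) = ((heis g).fst : ℝ) + ((heis g).snd : ℝ) := h'
  exact_mod_cast h''

theorem snd_act_twistY (g : F₂) :
    (heis (act twistY g)).snd = (heis g).snd - (heis g).fst := by
  let q : Cover → ℝ := fun e =>
    (dev (lift twistY e)).im - (dev e).im + (dev e).re + shiftPart (pr e).1.1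
  have hq : Continuous q := by
    have h1 := continuous_dev
    have h2 := continuous_shiftPart.comp (continuous_fst.comp (continuous_subtype_val.comp continuous_pr))
    have h3 := h1.comp (lift twistY).continuous
    exact (((Complex.continuous_im.comp h3).sub (Complex.continuous_im.comp h1)).add
      (Complex.continuous_re.comp h1)).add h2
  have h0 : ∀ e, (q e : UnitAddCircle) = 0 := by
    intro e
    simp only [q, AddCircle.coe_sub, AddCircle.coe_add, coe_dev_re, coe_dev_im, pr_lift,
      toMap_twistY, shift_eq]
    abel
  have h := eq_of_coe_eq_zero hq h0 (g • base) base
  simp only [q, lift_smul, lift_base, dev_smul, pr_smul, Complex.add_re, Complex.add_im] at h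
  have h' : (latticePoint (act twistY g)).im = (latticePoint g).im - (latticePoint g).re := by
    linarith
  have h'' : ((heis (act twistY g)).snd : ℝ) = ((heis g).snd : ℝ) - ((heis g).fst : ℝ) := h'
  exact_mod_cast h''

theorem act_twistX_genA : act twistX genA = genA :=
  act_genA_of_fix fun u => Subtype.ext (by
    rw [toMap_twistX]
    exact Prod.ext (by simp [horizontalArc, shift_eq_zero]) rfl)

theorem act_twistY_genB : act twistY genB = genB :=
  act_genB_of_fix fun u => Subtype.ext (by
    rw [toMap_twistY]
    exact Prod.ext rfl (by simp [verticalArc, shift_eq_zero]))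

/-- Since `genA` and `bdry` are fixed, `genB⁻¹ * act twistX genB` commutes with `genA` and so is a
power of it. The lattice action gives the exponent. -/
theorem act_twistX_genB : act twistX genB = genB * genA := by
  have h := act_bdry twistX
  simp only [bdry, map_mul, map_inv, act_twistX_genA] at h
  set B := act twistX genB with hB
  have hc : Commute (genB⁻¹ * B) genA := by
    have h1 := mul_right_cancel h
    have h2 : B * genA⁻¹ = genB * genA⁻¹ * genB⁻¹ * B := by rw [← h1]; group
    have h3 : genA⁻¹ * (genB⁻¹ * B) = genB⁻¹ * B * genA⁻¹ := by
      rw [mul_assoc genB⁻¹, h2]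
      group
    have h4 : Commute (genB⁻¹ * B) genA⁻¹ := h3.symm
    simpa using h4.inv_right
  obtain ⟨k, hk⟩ := exists_zpow_of_commute_genA hc
  have hBk : B = genB * genA ^ k := by rw [← hk, mul_inv_cancel_left]
  have h5 := fst_act_twistX genB
  rw [← hB, hBk, map_mul, map_zpow, Heisenberg.mul_fst, Heisenberg.zpow_fst, heis_genA,
    heis_genB] at h5
  have : k = 1 := by simpa using h5
  rw [hBk, this, zpow_one]

theorem act_twistY_genA : act twistY genA = genB⁻¹ * genA := by
  have h := act_bdry twistY
  simp only [bdry, map_mul, map_inv, act_twistY_genB] at h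
  set A := act twistY genA with hA
  have hc : Commute (A * genA⁻¹) genB := by
    have h1 : A⁻¹ * (genB⁻¹ * A) = genA⁻¹ * (genB⁻¹ * genA) := by
      have : genB * (A⁻¹ * (genB⁻¹ * A)) = genB * (genA⁻¹ * (genB⁻¹ * genA)) := by
        simpa only [mul_assoc] using h
      exact mul_left_cancel this
    have h2 : genB⁻¹ * A = A * (genA⁻¹ * (genB⁻¹ * genA)) := by rw [← h1]; group
    have h3 : A * genA⁻¹ * genB⁻¹ = genB⁻¹ * (A * genA⁻¹) := by
      rw [← mul_assoc genB⁻¹, h2]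
      group
    have h4 : Commute (A * genA⁻¹) genB⁻¹ := h3
    simpa using h4.inv_right
  obtain ⟨k, hk⟩ := exists_zpow_of_commute_genB hc
  have hAk : A = genB ^ k * genA := by rw [← hk, inv_mul_cancel_right]
  have h5 := snd_act_twistY genA
  rw [← hA, hAk, map_mul, map_zpow, Heisenberg.mul_snd, Heisenberg.zpow_snd, heis_genA,
    heis_genB] at h5
  have : k = -1 := by simpa using h5
  rw [hAk, this, zpow_neg_one]

end Cover

theorem isTwistAction_mcgAct : IsTwistAction mcgAct x y where
  act_one := mcgAct_one
  act_mul := mcgAct_mul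
  x_a := Cover.act_twistX_genA
  x_b := Cover.act_twistX_genB
  y_a := Cover.act_twistY_genA
  y_b := Cover.act_twistY_genB

end OneHoledTorus
end

noncomputable section
namespace OneHoledTorus

/-! ### The boundary twist -/

/-- The homeomorphism representing `δ`. -/
def twistδ : HomeoFixingBoundary :=
  restrict twistBoundary (radius_iff _ twistBoundary_fix) fun p hp => twistBoundary_fix p hp.le

/-- The angle of the homotopy unwinding the boundary twist. -/
def unwindAngle (u r : ℝ) : ℝ := angle r + u * (2 * π - angle r)

/-- The homotopy unwinding the boundary twist by rotating the boundary. -/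
def unwind (q : ℝ × Torus) : Torus :=
  ofComplex (toComplex q.2 * cis (-unwindAngle q.1 (radius q.2)))

theorem cis_neg_two_pi : cis (-(2 * π)) = 1 := by
  unfold cis
  rw [Complex.exp_eq_one_iff]
  exact ⟨-1, by push_cast; ring⟩

theorem unwind_outer {u : ℝ} {p : Torus} (h : 3 / 8 ≤ radius p) : unwind (u, p) = p := by
  have : unwindAngle u (radius p) = 2 * π := by
    rw [unwindAngle, angle_outer h]
    ring
  rw [unwind, this, cis_neg_two_pi, mul_one, ofComplex_toComplex]

theorem norm_le_of_radius {p : Torus} (h : radius p < 1 / 2) : ‖p‖ < 1 / 2 :=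
  (norm_le_radius p).trans_lt h

theorem continuous_unwind : Continuous unwind := by
  rw [continuous_iff_continuousAt]
  rintro ⟨u, p⟩
  rcases lt_or_ge (radius p) (1 / 2) with h | h
  · refine continuous_ofComplex.continuousAt.comp (ContinuousAt.mul ?_ ?_)
    · exact ContinuousAt.comp (f := Prod.snd) (x := (u, p))
        (continuousAt_toComplex (norm_le_of_radius h)) continuousAt_snd
    · have h1 : Continuous fun q : ℝ × Torus => radius q.2 := continuous_radius.comp continuous_snd
      refine (continuous_cis.comp (Continuous.neg ?_)).continuousAt
      unfold unwindAngle angle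
      fun_prop
  · refine continuous_snd.continuousAt.congr ?_
    filter_upwards [(continuous_radius.comp continuous_snd).continuousAt.eventually
      (lt_mem_nhds (show 3 / 8 < (radius ∘ Prod.snd) (u, p) from lt_of_lt_of_le (by norm_num) h))]
      with q hq
    exact (unwind_outer (le_of_lt hq)).symm

theorem radius_unwind (u : ℝ) (p : Torus) : radius (unwind (u, p)) = radius p := by
  rcases le_or_gt (3 / 8) (radius p) with h | h
  · rw [unwind_outer h]
  · have hn : ‖toComplex p * cis (-unwindAngle u (radius p))‖ = radius p := by
      rw [norm_mul, norm_cis, mul_one, radius_eq]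
    rw [unwind, radius_ofComplex ((supNorm_le_norm _).trans (by rw [hn]; linarith)), hn]

theorem unwind_zero (p : Torus) : unwind (0, p) = rotate (-1) p := by
  simp [unwind, unwindAngle, rotate, cis]

theorem unwind_one (p : Torus) : unwind (1, p) = p := by
  have : unwindAngle 1 (radius p) = 2 * π := by
    rw [unwindAngle]
    ring
  rw [unwind, this, cis_neg_two_pi, mul_one, ofComplex_toComplex]

/-- The homotopy from the boundary twist to the identity that rotates the boundary once. -/
def unwindHomotopy : C(unitInterval × Surface, Surface) where
  toFun q := ⟨unwind (q.1, q.2.1), by rw [radius_unwind]; exact q.2.2⟩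
  continuous_toFun := by
    refine Continuous.subtype_mk ?_ _
    exact continuous_unwind.comp ((continuous_subtype_val.comp continuous_fst).prodMk
      (continuous_subtype_val.comp continuous_snd))

theorem unwindHomotopy_zero (p : Surface) : unwindHomotopy (0, p) = toMap twistδ p :=
  Subtype.ext (unwind_zero p.1)

theorem unwindHomotopy_one (p : Surface) : unwindHomotopy (1, p) = p :=
  Subtype.ext (unwind_one p.1)

theorem unwindHomotopy_base (u : unitInterval) :
    unwindHomotopy (u, basePoint) = circ (u * (-(2 * π))) := by
  refine Subtype.ext ?_
  have h1 : radius basePoint.1 = 1 / 4 := basePoint_mem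
  have h2 : toComplex basePoint.1 = ((1 / 4 : ℝ) : ℂ) :=
    Complex.ext (coord_coe (by norm_num [abs_of_pos])) Cover.coord_zero
  change ofComplex (toComplex basePoint.1 * cis (-unwindAngle u (radius basePoint.1))) =
    ofComplex (((1 / 4 : ℝ) : ℂ) * cis (u * (-(2 * π))))
  rw [h1, h2, unwindAngle, angle_inner le_rfl]
  congr 3
  ring

namespace Cover

theorem ring_neg_two_pi : ring (-(2 * π)) = bdry⁻¹ • base := by
  have := ring_add_two_pi (-(2 * π))
  rw [neg_add_cancel, ring_zero] at this
  rw [this, inv_smul_smul]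

/-- Unwinding the twist drags the base point once clockwise around the boundary. The lifted homotopy
ends at a lift of the identity that sends `base` to `bdry⁻¹ • base`, hence at translation by
`bdry⁻¹`; its equivariance then compares the two actions. -/
theorem act_twistδ (g : F₂) : act twistδ g = bdry⁻¹ * g * bdry := by
  obtain ⟨G, hG, hG0⟩ := exists_lift_homotopy unwindHomotopy twistδ unwindHomotopy_zero
  have hb : ∀ u : unitInterval, G (u, base) = ring (u * (-(2 * π))) := by
    refine congrFun (eq_of_lifts (F := fun u => G (u, base))
      (G := fun u : unitInterval => ring (u * (-(2 * π)))) (by fun_prop) (by fun_prop)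
      (fun u => ?_) 0 ?_)
    · rw [hG, pr_base, unwindHomotopy_base, pr_ring]
    · rw [hG0, lift_base]
      simp [ring_zero]
  have h1 : G (1, base) = bdry⁻¹ • base := by
    rw [hb, ← ring_neg_two_pi]
    simp
  have h2 : G (1, g • base) = bdry⁻¹ • g • base := by
    refine congrFun (eq_of_lifts (F := fun e => G (1, e)) (G := fun e => bdry⁻¹ • e) (by fun_prop)
      (continuous_smul _) (fun e => ?_) base h1) (g • base)
    rw [hG, unwindHomotopy_one, pr_smul]
  have h3 : G (1, g • base) = act twistδ g • G (1, base) := by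
    refine congrFun (eq_of_lifts (F := fun u => G (u, g • base))
      (G := fun u => act twistδ g • G (u, base)) (by fun_prop)
      ((continuous_smul _).comp (by fun_prop)) (fun u => ?_) 0 ?_) 1
    · rw [hG, pr_smul, pr_smul, hG]
    · rw [hG0, hG0, lift_smul]
  have h4 : (bdry⁻¹ * g) • base = (act twistδ g * bdry⁻¹) • base := by
    rw [mul_smul, mul_smul, ← h2, h3, h1]
  rw [smul_base_injective h4, inv_mul_cancel_right]

end Cover

theorem δ_eq : δ = (x * y) ^ 6 := by
  refine mcgAct_injective (MonoidHom.ext fun g => ?_)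
  rw [isTwistAction_mcgAct.boundary]
  exact Cover.act_twistδ g

theorem mem_closure_x_y (φ : MCG) : φ ∈ Subgroup.closure {x, y} := by
  obtain ⟨f, rfl⟩ := QuotientGroup.mk_surjective φ
  obtain ⟨w, hw, e⟩ := isTwistAction_mcgAct.exists_eq (mcgAct f) (Cover.act_bdry f)
  rwa [← mcgAct_injective e]

theorem braid_relation : x * y * x = y * x * y := mcgAct_injective isTwistAction_mcgAct.braid

/-- Every open book with page the one-holed torus is of one of the six types. -/
theorem exists_type (φ : MCG) : ∃ ψ, SameOpenBook φ ψ ∧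
    (TypeA ψ ∨ TypeB ψ ∨ TypeC ψ ∨ TypeD ψ ∨ TypeE ψ ∨ TypeF ψ) := by
  obtain ⟨ρ, h, k, hk, hρ⟩ := exists_conj_of_braid braid_relation mem_closure_x_y φ
  refine ⟨_, ⟨h, hk⟩, ?_⟩
  have hδ : ((x * y) ^ 3) ^ (2 : ℤ) = δ := by
    rw [δ_eq, zpow_ofNat, ← pow_mul]
  -- Two factors `(x * y) ^ 3` make one `δ`, so even exponents give types A, C, E and odd ones B, D,
  -- F.
  obtain ⟨d, rfl | rfl⟩ := k.even_or_odd'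
  · rw [zpow_mul, hδ]
    rcases hρ with ⟨a, ha, rfl⟩ | ⟨m, rfl⟩ | ⟨m, hm, rfl⟩
    · exact Or.inl ⟨d, a, ha, rfl⟩
    · exact Or.inr (Or.inr (Or.inl ⟨d, m, rfl⟩))
    · exact Or.inr (Or.inr (Or.inr (Or.inr (Or.inl ⟨d, m, hm, (mul_assoc _ _ _).symm⟩))))
  · rw [zpow_add_one, zpow_mul, hδ]
    rcases hρ with ⟨a, ha, rfl⟩ | ⟨m, rfl⟩ | ⟨m, hm, rfl⟩
    · exact Or.inr (Or.inl ⟨d, a, ha, rfl⟩)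
    · exact Or.inr (Or.inr (Or.inr (Or.inl ⟨d, m, rfl⟩)))
    · exact Or.inr (Or.inr (Or.inr (Or.inr (Or.inr ⟨d, m, hm, (mul_assoc _ _ _).symm⟩))))

end OneHoledTorus
end

noncomputable section
namespace OneHoledTorus

/-! ### The fundamental group -/

/-- The base point of the cover, as a point of the fibre. -/
def baseFibre : Cover.pr ⁻¹' {basePoint} := ⟨Cover.base, rfl⟩

/-- The fundamental group of the surface as the group of deck transformations. -/
def deckEquiv : FundamentalGroup Surface basePoint ≃* F₂ᵐᵒᵖ :=
  Cover.isQuotientCoveringMap_pr.fundamentalGroupEquiv baseFibre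

theorem deckEquiv_smul_base (γ : FundamentalGroup Surface basePoint) :
    (deckEquiv γ).unop • Cover.base = (Cover.isCoveringMap_pr.monodromy γ baseFibre).1 :=
  Cover.isQuotientCoveringMap_pr.unop_fundamentalGroupToMulOpposite_smul (e := baseFibre)

/-- The lift of `f` carries the lift of a loop at the base point to the lift of its image; this
matches the action on deck transformations with the induced map on the fundamental group. -/
theorem lift_monodromy (f : HomeoFixingBoundary) (γ : FundamentalGroup Surface basePoint) :
    Cover.lift f (Cover.isCoveringMap_pr.monodromy γ baseFibre).1 =
      (Cover.isCoveringMap_pr.monodromy (inducedπ₁ f γ) baseFibre).1 := by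
  rw [inducedπ₁, FundamentalGroup.mapOfEq_apply]
  induction γ using Path.Homotopic.Quotient.ind with
  | mk γ =>
  let Γ : C(unitInterval, Cover) :=
    Cover.isCoveringMap_pr.liftPath γ Cover.base (γ.source.trans Cover.pr_base.symm)
  have hΓ : Cover.pr ∘ Γ = γ := Cover.isCoveringMap_pr.liftPath_lifts _ _ _
  have hΓ0 : Γ 0 = Cover.base := Cover.isCoveringMap_pr.liftPath_zero _ _ _
  let γ' : Path basePoint basePoint :=
    (γ.map (toMap f).continuous).cast (toMap_basePoint f).symm (toMap_basePoint f).symm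
  have key : (Cover.lift f).comp Γ =
      Cover.isCoveringMap_pr.liftPath γ' Cover.base (γ'.source.trans Cover.pr_base.symm) := by
    refine (Cover.isCoveringMap_pr.eq_liftPath_iff' _).2 ⟨?_, ?_⟩
    · funext t
      change Cover.pr (Cover.lift f (Γ t)) = toMap f (γ t)
      rw [Cover.pr_lift]
      exact congrArg (toMap f) (congrFun hΓ t)
    · rw [ContinuousMap.comp_apply, hΓ0, Cover.lift_base]
  exact DFunLike.congr_fun key 1

theorem deckEquiv_inducedπ₁ (f : HomeoFixingBoundary) (γ : FundamentalGroup Surface basePoint) :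
    (deckEquiv (inducedπ₁ f γ)).unop = Cover.act f (deckEquiv γ).unop :=
  Cover.smul_base_injective (by
    rw [deckEquiv_smul_base, ← lift_monodromy, Cover.act_smul_base, deckEquiv_smul_base])

/-! ### The first homology group -/

/-- The abelianization of the free group. -/
def abel : F₂ →* Multiplicative (Fin 2 → ℤ) where
  toFun g := Multiplicative.ofAdd ![(heis g).fst, (heis g).snd]
  map_one' := by simp
  map_mul' g h := by
    simp [← ofAdd_add]

theorem abel_genA : abel genA = Multiplicative.ofAdd ![1, 0] := by
  simp [abel, heis_genA]

theorem abel_genB : abel genB = Multiplicative.ofAdd ![0, 1] := by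
  simp [abel, heis_genB]

/-- The matrix of an endomorphism of the free group on the abelianization. -/
def abelMatrix (f : F₂ →* F₂) : Matrix (Fin 2) (Fin 2) ℤ :=
  !![(heis (f genA)).fst, (heis (f genB)).fst; (heis (f genA)).snd, (heis (f genB)).snd]

theorem abel_map (f : F₂ →* F₂) (g : F₂) :
    (abel (f g)).toAdd = (abelMatrix f).mulVec (abel g).toAdd := by
  have : abel.comp f = (AddMonoidHom.toMultiplicative
      (Matrix.mulVecLin (abelMatrix f)).toAddMonoidHom).comp abel := by
    refine F₂.hom_ext ?_ ?_
    · simp only [MonoidHom.comp_apply, abel_genA]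
      refine congrArg Multiplicative.ofAdd ?_
      funext i
      fin_cases i <;> simp [abelMatrix, Matrix.mulVec, dotProduct]
    · simp only [MonoidHom.comp_apply, abel_genB]
      refine congrArg Multiplicative.ofAdd ?_
      funext i
      fin_cases i <;> simp [abelMatrix, Matrix.mulVec, dotProduct]
  exact congrArg Multiplicative.toAdd (DFunLike.congr_fun this g)

/-- The homology class of a deck transformation. -/
def deckClass : F₂ →* Abelianization (FundamentalGroup Surface basePoint) where
  toFun g := Abelianization.of (deckEquiv.symm (MulOpposite.op g))
  map_one' := by rw [MulOpposite.op_one, map_one, map_one]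
  -- The order reversal between loops and deck transformations disappears in the abelianization.
  map_mul' g h := by rw [MulOpposite.op_mul, map_mul, map_mul, mul_comm]

theorem deckClass_deckEquiv (γ : FundamentalGroup Surface basePoint) :
    deckClass (deckEquiv γ).unop = Abelianization.of γ := by
  simp [deckClass]

/-- The coordinates of a homology class. -/
def homologyToInt : H₁ →+ (Fin 2 → ℤ) :=
  MonoidHom.toAdditiveLeft (Abelianization.lift
    { toFun := fun γ => abel (deckEquiv γ).unop
      map_one' := by rw [map_one, MulOpposite.unop_one, map_one]
      map_mul' := fun γ γ' => by rw [map_mul, MulOpposite.unop_mul, map_mul, mul_comm] })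

theorem homologyToInt_of (γ : FundamentalGroup Surface basePoint) :
    homologyToInt (Additive.ofMul (Abelianization.of γ)) = (abel (deckEquiv γ).unop).toAdd := rfl

/-- The homology class with given coordinates. -/
def intToHomology : (Fin 2 → ℤ) →+ H₁ where
  toFun v := v 0 • Additive.ofMul (deckClass genA) + v 1 • Additive.ofMul (deckClass genB)
  map_zero' := by simp
  map_add' v w := by
    simp only [Pi.add_apply, add_smul]
    abel

theorem intToHomology_abel (g : F₂) :
    intToHomology (abel g).toAdd = Additive.ofMul (deckClass g) := by
  have : (AddMonoidHom.toMultiplicative intToHomology).comp abel =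
      (AddMonoidHom.toMultiplicative (MonoidHom.toAdditive (MonoidHom.id _))).comp deckClass := by
    refine F₂.hom_ext ?_ ?_
    · simp only [MonoidHom.comp_apply, abel_genA]
      refine congrArg Multiplicative.ofAdd ?_
      simp [intToHomology]
      rfl
    · simp only [MonoidHom.comp_apply, abel_genB]
      refine congrArg Multiplicative.ofAdd ?_
      simp [intToHomology]
      rfl
  exact congrArg Multiplicative.toAdd (DFunLike.congr_fun this g)

theorem homologyToInt_deckClass (g : F₂) :
    homologyToInt (Additive.ofMul (deckClass g)) = (abel g).toAdd := by
  change homologyToInt (Additive.ofMul (Abelianization.of (deckEquiv.symm (MulOpposite.op g)))) = _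
  rw [homologyToInt_of, MulEquiv.apply_symm_apply, MulOpposite.unop_op]

/-- The first homology group is free of rank two. -/
def homologyEquiv : H₁ ≃ₗ[ℤ] (Fin 2 → ℤ) :=
  AddEquiv.toIntLinearEquiv
    { toFun := homologyToInt
      invFun := intToHomology
      left_inv := fun c => by
        obtain ⟨γ, rfl⟩ := QuotientGroup.mk_surjective (Additive.toMul c)
        change intToHomology (homologyToInt (Additive.ofMul (Abelianization.of γ))) = _
        rw [homologyToInt_of, intToHomology_abel, deckClass_deckEquiv]
        rfl
      right_inv := fun v => by
        change homologyToInt (v 0 • Additive.ofMul (deckClass genA) +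
          v 1 • Additive.ofMul (deckClass genB)) = v
        rw [map_add, map_zsmul, map_zsmul, homologyToInt_deckClass, homologyToInt_deckClass,
          abel_genA, abel_genB]
        funext i
        fin_cases i <;> simp
      map_add' := map_add _ }

theorem homologyEquiv_inducedH₁ (f : HomeoFixingBoundary) (c : H₁) :
    homologyEquiv (inducedH₁ f c) = (abelMatrix (Cover.act f)).mulVec (homologyEquiv c) := by
  obtain ⟨γ, hγ⟩ := QuotientGroup.mk_surjective (Additive.toMul c)
  have hc : c = Additive.ofMul (Abelianization.of γ) := congrArg Additive.ofMul hγ.symm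
  rw [hc]
  change homologyToInt (Additive.ofMul (Abelianization.of (inducedπ₁ f γ))) =
    (abelMatrix (Cover.act f)).mulVec (homologyToInt (Additive.ofMul (Abelianization.of γ)))
  rw [homologyToInt_of, homologyToInt_of, deckEquiv_inducedπ₁, abel_map]

theorem homologyTrace_eq (φ : MCG) : homologyTrace φ = (abelMatrix (mcgAct φ)).trace := by
  obtain ⟨f, rfl⟩ := QuotientGroup.mk_surjective φ
  change LinearMap.trace ℤ H₁ (inducedH₁ f) = (abelMatrix (Cover.act f)).trace
  rw [← LinearMap.trace_conj' (inducedH₁ f) homologyEquiv, ← Matrix.trace_toLin'_eq]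
  congr 1
  refine LinearMap.ext fun v => ?_
  rw [LinearEquiv.conj_apply_apply, homologyEquiv_inducedH₁, LinearEquiv.apply_symm_apply,
    Matrix.toLin'_apply]

/-! ### Matrices of mapping classes -/

/-- The matrix of a mapping class. -/
def mcgMatrix : MCG →* Matrix (Fin 2) (Fin 2) ℤ where
  toFun φ := abelMatrix (mcgAct φ)
  map_one' := by
    rw [mcgAct_one]
    ext i j
    fin_cases i <;> fin_cases j <;> simp [abelMatrix, heis_genA, heis_genB]
  map_mul' φ ψ := by
    rw [mcgAct_mul]
    have key : ∀ g, ![(heis (mcgAct φ (mcgAct ψ g))).fst, (heis (mcgAct φ (mcgAct ψ g))).snd] =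
        (abelMatrix (mcgAct φ)).mulVec ![(heis (mcgAct ψ g)).fst, (heis (mcgAct ψ g)).snd] :=
      fun g => abel_map (mcgAct φ) (mcgAct ψ g)
    have hA := key genA
    have hB := key genB
    ext i j
    fin_cases j
    · have := congrFun hA i
      fin_cases i <;> simpa [abelMatrix, Matrix.mul_apply, Matrix.mulVec, dotProduct] using this
    · have := congrFun hB i
      fin_cases i <;> simpa [abelMatrix, Matrix.mul_apply, Matrix.mulVec, dotProduct] using this

theorem homologyTrace_eq_trace (φ : MCG) : homologyTrace φ = (mcgMatrix φ).trace :=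
  homologyTrace_eq φ

theorem mcgMatrix_apply (φ : MCG) : mcgMatrix φ = abelMatrix (mcgAct φ) := rfl

theorem mcgMatrix_x : mcgMatrix x = !![1, 1; 0, 1] := by
  simp [mcgMatrix_apply, abelMatrix, isTwistAction_mcgAct.x_a, isTwistAction_mcgAct.x_b, heis_genA,
    heis_genB]

theorem mcgMatrix_y : mcgMatrix y = !![1, 0; -1, 1] := by
  simp [mcgMatrix_apply, abelMatrix, isTwistAction_mcgAct.y_a, isTwistAction_mcgAct.y_b, heis_genA,
    heis_genB]

theorem mcgMatrix_inv_of {φ : MCG} {A B : Matrix (Fin 2) (Fin 2) ℤ} (h : mcgMatrix φ = A)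
    (hAB : A * B = 1) : mcgMatrix φ⁻¹ = B := by
  calc mcgMatrix φ⁻¹ = mcgMatrix φ⁻¹ * (A * B) := by rw [hAB, mul_one]
    _ = B := by rw [← mul_assoc, ← h, ← map_mul, inv_mul_cancel, map_one, one_mul]

theorem mcgMatrix_xinv : mcgMatrix x⁻¹ = !![1, -1; 0, 1] :=
  mcgMatrix_inv_of mcgMatrix_x (by
    rw [Matrix.mul_fin_two, Matrix.one_fin_two]
    norm_num)

theorem mcgMatrix_yinv : mcgMatrix y⁻¹ = !![1, 0; 1, 1] :=
  mcgMatrix_inv_of mcgMatrix_y (by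
    rw [Matrix.mul_fin_two, Matrix.one_fin_two]
    norm_num)

theorem mcgMatrix_x_zpow (m : ℤ) : mcgMatrix (x ^ m) = !![1, m; 0, 1] := by
  induction m using Int.induction_on with
  | zero => rw [zpow_zero, map_one, Matrix.one_fin_two]
  | succ n ih =>
    rw [zpow_add_one, map_mul, ih, mcgMatrix_x, Matrix.mul_fin_two]
    simp [add_comm]
  | pred n ih =>
    rw [zpow_sub_one, map_mul, ih, mcgMatrix_xinv, Matrix.mul_fin_two]
    simp
    ring

theorem mcgMatrix_y_zpow (m : ℤ) : mcgMatrix (y ^ m) = !![1, 0; -m, 1] := by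
  induction m using Int.induction_on with
  | zero => rw [zpow_zero, map_one, neg_zero, Matrix.one_fin_two]
  | succ n ih =>
    rw [zpow_add_one, map_mul, ih, mcgMatrix_y, Matrix.mul_fin_two]
    simp
    ring
  | pred n ih =>
    rw [zpow_sub_one, map_mul, ih, mcgMatrix_yinv, Matrix.mul_fin_two]
    simp [add_comm]

theorem mcgMatrix_cube : mcgMatrix ((x * y) ^ 3) = -1 := by
  rw [map_pow, map_mul, mcgMatrix_x, mcgMatrix_y, pow_succ, pow_two, Matrix.mul_fin_two,
    Matrix.mul_fin_two, Matrix.mul_fin_two, Matrix.one_fin_two]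
  ext i j
  fin_cases i <;> fin_cases j <;> norm_num

theorem mcgMatrix_δ : mcgMatrix δ = 1 := by
  rw [δ_eq, show 6 = 3 * 2 from rfl, pow_mul, map_pow, mcgMatrix_cube]
  norm_num

theorem mcgMatrix_δ_zpow_mul (d : ℤ) (φ : MCG) : mcgMatrix (δ ^ d * φ) = mcgMatrix φ := by
  have h : mcgMatrix.toHomUnits δ = 1 := Units.ext mcgMatrix_δ
  have h' : mcgMatrix (δ ^ d) = 1 := by
    have : ((mcgMatrix.toHomUnits (δ ^ d) : (Matrix (Fin 2) (Fin 2) ℤ)ˣ) :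
        Matrix (Fin 2) (Fin 2) ℤ) = 1 := by
      rw [map_zpow, h, one_zpow, Units.val_one]
    exact this
  rw [map_mul, h', one_mul]

theorem mcgMatrix_δ_zpow_mul_cube_mul (d : ℤ) (φ : MCG) :
    mcgMatrix (δ ^ d * (x * y) ^ 3 * φ) = -mcgMatrix φ := by
  rw [mul_assoc, mcgMatrix_δ_zpow_mul, map_mul, mcgMatrix_cube, neg_one_mul]

/-- Each block multiplies on the left by the nonnegative matrix with rows `(1 + k, k)` and `(1, 1)`.
Any block makes the lower left entry positive, and a nonzero exponent makes the upper right entry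
positive. -/
theorem mcgMatrix_word (a : List ℕ) : ∃ p q r s : ℤ, mcgMatrix (word a) = !![p, q; r, s] ∧
    1 ≤ p ∧ 1 ≤ s ∧ 0 ≤ q ∧ 0 ≤ r ∧ p * s - q * r = 1 ∧ (a ≠ [] → 1 ≤ r) ∧
    ((∃ k ∈ a, k ≠ 0) → 1 ≤ q) := by
  induction a with
  | nil =>
    refine ⟨1, 0, 0, 1, ?_, le_rfl, le_rfl, le_rfl, le_rfl, by norm_num, fun h => absurd rfl h, ?_⟩
    · rw [← Matrix.one_fin_two]
      exact map_one mcgMatrix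
    · rintro ⟨k, hk, -⟩
      simp at hk
  | cons k a ih =>
    obtain ⟨p, q, r, s, h, hp, hs, hq, hr, hdet, -, hq'⟩ := ih
    have hk : (0 : ℤ) ≤ k := Int.natCast_nonneg k
    have h1 : mcgMatrix (word (k :: a)) =
        !![(1 + k) * p + k * r, (1 + k) * q + k * s; p + r, q + s] := by
      have e : word (k :: a) = x ^ (k : ℤ) * y⁻¹ * word a := by
        simp [word]
      rw [e, map_mul, map_mul, mcgMatrix_x_zpow, mcgMatrix_yinv, h, Matrix.mul_fin_two,
        Matrix.mul_fin_two]
      simp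
    refine ⟨_, _, _, _, h1, by nlinarith, by linarith, by nlinarith, by linarith,
      by linear_combination hdet, fun _ => by linarith, ?_⟩
    rintro ⟨j, hj, hj0⟩
    rcases List.mem_cons.1 hj with rfl | hj
    · have : (1 : ℤ) ≤ j := by exact_mod_cast Nat.one_le_iff_ne_zero.2 hj0
      nlinarith
    · have := hq' ⟨j, hj, hj0⟩
      nlinarith

/-- The determinant gives `p * s = 1 + q * r ≥ 2`, so the positive integers `p` and `s` are not both
`1`. -/
theorem two_lt_trace_word {a : List ℕ} (ha : ∃ k ∈ a, k ≠ 0) :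
    2 < (mcgMatrix (word a)).trace := by
  obtain ⟨p, q, r, s, h, hp, hs, -, -, hdet, hr, hq⟩ := mcgMatrix_word a
  have hq := hq ha
  have hr := hr (by
    rintro rfl
    obtain ⟨k, hk, -⟩ := ha
    simp at hk)
  rw [h, Matrix.trace_fin_two_of]
  have : 2 ≤ p * s := by nlinarith
  by_contra! hle
  have hp1 : p = 1 := by linarith
  have hs1 : s = 1 := by linarith
  subst hp1 hs1
  norm_num at this

theorem isPseudoAnosov_of_type {ψ : MCG} (h : TypeA ψ ∨ TypeB ψ) : IsPseudoAnosov ψ := by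
  rw [IsPseudoAnosov, homologyTrace_eq_trace]
  rcases h with ⟨d, a, ha, rfl⟩ | ⟨d, a, ha, rfl⟩
  · rw [mcgMatrix_δ_zpow_mul]
    exact (two_lt_trace_word ha).trans_le (le_abs_self _)
  · rw [mcgMatrix_δ_zpow_mul_cube_mul, Matrix.trace_neg, abs_neg]
    exact (two_lt_trace_word ha).trans_le (le_abs_self _)

theorem trace_y_zpow (m : ℤ) : (mcgMatrix (y ^ m)).trace = 2 := by
  rw [mcgMatrix_y_zpow, Matrix.trace_fin_two_of]
  norm_num

theorem trace_x_zpow_mul_yinv (m : ℤ) : (mcgMatrix (x ^ m * y⁻¹)).trace = m + 2 := by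
  rw [map_mul, mcgMatrix_x_zpow, mcgMatrix_yinv, Matrix.mul_fin_two, Matrix.trace_fin_two_of]
  ring

/-- Up to sign the trace is `2` for powers of `y` and `m + 2` for `x ^ m * y⁻¹`; the three admitted
exponents give `1`, `0` and `-1`. -/
theorem not_isPseudoAnosov_of_type {ψ : MCG} (h : TypeC ψ ∨ TypeD ψ ∨ TypeE ψ ∨ TypeF ψ) :
    ¬ IsPseudoAnosov ψ := by
  rw [IsPseudoAnosov, homologyTrace_eq_trace, not_lt]
  rcases h with ⟨d, m, rfl⟩ | ⟨d, m, rfl⟩ | ⟨d, m, hm, rfl⟩ | ⟨d, m, hm, rfl⟩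
  · rw [mcgMatrix_δ_zpow_mul, trace_y_zpow]
    norm_num
  · rw [mcgMatrix_δ_zpow_mul_cube_mul, Matrix.trace_neg, trace_y_zpow]
    norm_num
  · rw [mul_assoc, mcgMatrix_δ_zpow_mul, trace_x_zpow_mul_yinv]
    rcases hm with rfl | rfl | rfl <;> norm_num
  · rw [mul_assoc, mcgMatrix_δ_zpow_mul_cube_mul, Matrix.trace_neg, trace_x_zpow_mul_yinv]
    rcases hm with rfl | rfl | rfl <;> norm_num

end OneHoledTorus
end

theorem mainTheorem3 :
    (∀ φ : OneHoledTorus.MCG, ∃ ψ : OneHoledTorus.MCG, OneHoledTorus.SameOpenBook φ ψ ∧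
      (OneHoledTorus.TypeA ψ ∨ OneHoledTorus.TypeB ψ ∨ OneHoledTorus.TypeC ψ ∨
        OneHoledTorus.TypeD ψ ∨ OneHoledTorus.TypeE ψ ∨ OneHoledTorus.TypeF ψ)) ∧
    (∀ ψ : OneHoledTorus.MCG, (OneHoledTorus.TypeA ψ ∨ OneHoledTorus.TypeB ψ) →
      OneHoledTorus.IsPseudoAnosov ψ) ∧
    (∀ ψ : OneHoledTorus.MCG, (OneHoledTorus.TypeC ψ ∨ OneHoledTorus.TypeD ψ ∨
      OneHoledTorus.TypeE ψ ∨ OneHoledTorus.TypeF ψ) → ¬ OneHoledTorus.IsPseudoAnosov ψ) := by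
  exact ⟨OneHoledTorus.exists_type, fun _ h => OneHoledTorus.isPseudoAnosov_of_type h,
    fun _ h => OneHoledTorus.not_isPseudoAnosov_of_type h⟩
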